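/- Let $n\ge 1$. For a measurable set $E\subset\mathbb R^n$, a point $q\in\partial E$ and $s\in(0,1)$ let $$\mathcal I_s[E](q)=\lim_{\rho\to0^+}\int_{\mathbb R^n\setminus B_\rho(q)}\frac{\chi_{\mathbb R^n\setminus E}(y)-\chi_E(y)}{|y-q|^{n+s}}\,dy$$ be the $s$-fractional mean curvature of $E$ at $q$, whenever this limit exists and is finite. Write $x=(x',x_n)$ for $x\in\mathbb R^n$, let $B'_r$ be the open ball of radius $r$ about $0$ in $\mathbb R^{n-1}$, and let $Q_{r,h}=B'_r\times(-h,h)$. Let $\omega_{n-1}$ be the $(n-2)$-dimensional area of the unit sphere of $\mathbb R^{n-1}$, that is, $n-1$ times the volume of its unit ball (so $\omega_0=0$ and $\omega_1=2$). **Convergence of sets.** Let $\alpha\in(0,1]$ and $q\in\partial E$. We say that measurable sets $E_k\subset\mathbb R^n$ $(k\in\mathbb N)$ converge to $E$ in the $C^{1,\alpha}$ sense in a neighbourhood of $q$ if $|(E_k\Delta E)\cap B_R|\to0$ for every $R>0$ and if there are $r,h>0$, a rigid motion of $\mathbb R^n$ taking $q$ to $0$, and functions $u,u_k\in C^{1,\alpha}(\overline{B'_{2r}})$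 with $u(0)=0$ such that, after applying this one motion to $E$ and to all the $E_k$, $$E\cap Q_{2r,2h}=\{x'\in B'_{2r},\ u(x')<x_n<2h\},\qquad E_k\cap Q_{2r,2h}=\{x'\in B'_{2r},\ u_k(x')<x_n<2h\}\quad\text{for all }k,$$ and $\|u_k-u\|_{C^{1,\alpha}(\overline{B'_{2r}})}\to0$, where $\|v\|_{C^{1,\alpha}(S)}=\sup_S|v|+\sup_S|\nabla v|+\sup_{x\ne y\in S}\frac{|\nabla v(x)-\nabla v(y)|}{|x-y|^\alpha}$. Convergence in the $C^2$ sense is defined in the same way, with $C^2(\overline{B'_{2r}})$ and its norm in place of $C^{1,\alpha}(\overline{B'_{2r}})$ and its norm. **Mean curvature.** If $E$ is, after a rigid motion taking $q$ to $0$, the supergraph $\{x_n>u(x')\}$ of a $C^2$ function $u$ with $u(0)=0$ in some cylinder $Q_{r,h}$, then its classical mean curvature at $q$ is $$H[E](q)=\frac1{n-1}\,\operatorname{div}\!\left(\frac{\nabla u}{\sqrt{1+|\nabla u|^2}}\right)(0),$$ the arithmetic mean of the principal curvatures, positive for balls (for $n=1$ we set $H[E](q)=0$). Rigid motions may include reflections.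 **Theorem.** (1) Let $\alpha\in(0,1]$, let $E_k\to E$ in the $C^{1,\alpha}$ sense in a neighbourhood of $q\in\partial E$, let $q_k\in\partial E_k$ with $q_k\to q$, and let $s,s_k\in(0,\alpha)$ with $s_k\to s$. Then $\mathcal I_s[E](q)$ exists, $\mathcal I_{s_k}[E_k](q_k)$ exists for all sufficiently large $k$, and $$\lim_{k\to\infty}\mathcal I_{s_k}[E_k](q_k)=\mathcal I_s[E](q).$$ (2) Let $E_k\to E$ in the $C^2$ sense in a neighbourhood of $q\in\partial E$, let $q_k\in\partial E_k$ with $q_k\to q$, and let $s_k\in(0,1)$ with $s_k\to1$. Then $H[E](q)$ is well defined (it does not depend on the choice of the rigid motion and of $u$), $\mathcal I_{s_k}[E_k](q_k)$ exists for all sufficiently large $k$, and $$\lim_{k\to\infty}(1-s_k)\,\mathcal I_{s_k}[E_k](q_k)=\omega_{n-1}\,H[E](q).$$ -/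

import Mathlib

open MeasureTheory Filter Topology Set Metric
open scoped ENNReal

noncomputable section

/-- The `(n-1)`-dimensional area of the unit sphere of `ℝⁿ`; the sphere of `ℝ⁰` is empty, so the
value at `n = 0` is `0`. -/
def sphereArea (n : ℕ) : ℝ :=
  (volume : Measure (EuclideanSpace ℝ (Fin n))).toSphere.real univ

/-- The area of the unit sphere is `n` times the volume of the unit ball. -/
theorem sphereArea_eq (n : ℕ) :
    sphereArea n = n * (volume : Measure (EuclideanSpace ℝ (Fin n))).real (ball 0 1) := by
  simp [sphereArea, Measure.toSphere_real_apply_univ]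

/-! ### Fractional mean curvature -/

/-- The truncated fractional mean curvature: the integral over the complement of `B_ρ(q)` of
`(χ_{CE}(y) - χ_E(y)) / |y - q|^(n+s)`. -/
def truncFracCurvature {n : ℕ} (s : ℝ) (E : Set (EuclideanSpace ℝ (Fin n)))
    (q : EuclideanSpace ℝ (Fin n)) (ρ : ℝ) : ℝ :=
  ∫ y in (ball q ρ)ᶜ,
    (Eᶜ.indicator (fun _ => (1 : ℝ)) y - E.indicator (fun _ => (1 : ℝ)) y)
      / ‖y - q‖ ^ ((n : ℝ) + s)

/-- The principal value defining the fractional mean curvature exists and is finite. -/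
def FracCurvatureExists {n : ℕ} (s : ℝ) (E : Set (EuclideanSpace ℝ (Fin n)))
    (q : EuclideanSpace ℝ (Fin n)) : Prop :=
  ∃ I : ℝ, Tendsto (truncFracCurvature s E q) (𝓝[>] 0) (𝓝 I)

/-- The `s`-fractional mean curvature of `E` at `q`, as a principal value (meaningful when
`FracCurvatureExists s E q`). -/
def fracCurvature {n : ℕ} (s : ℝ) (E : Set (EuclideanSpace ℝ (Fin n)))
    (q : EuclideanSpace ℝ (Fin n)) : ℝ :=
  limUnder (𝓝[>] (0 : ℝ)) (truncFracCurvature s E q)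

/-! ### Hölder and `C²` norms

They are used on closed balls `S` of positive radius only. There `ContDiffOn ℝ j u S` says that `u`
is continuous on `S`, is of class `C^j` inside, and that its derivatives up to order `j` extend
continuously to `S`; the derivatives within `S` are these extensions. -/

variable {X : Type*} [NormedAddCommGroup X]

/-- `sup_S |v|`. -/
def supNormOn {F : Type*} [NormedAddCommGroup F] (S : Set X) (v : X → F) : ℝ≥0∞ :=
  ⨆ x ∈ S, ‖v x‖ₑ

/-- The `α`-Hölder seminorm `sup_{x ≠ y ∈ S} |v x - v y| / |x - y|^α`. -/
def holderSeminormOn {F : Type*} [NormedAddCommGroup F] (α : ℝ) (S : Set X) (v : X → F) : ℝ≥0∞ :=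
  ⨆ x ∈ S, ⨆ y ∈ S, ⨆ _ : x ≠ y, ‖v x - v y‖ₑ / ‖x - y‖ₑ ^ α

/-- The `C^{1,α}(S)` norm: `sup_S |u| + sup_S |∇u| + [∇u]_{C^{0,α}(S)}`. -/
def c1HolderNormOn [NormedSpace ℝ X] (α : ℝ) (S : Set X) (u : X → ℝ) : ℝ≥0∞ :=
  supNormOn S u + (supNormOn S (fderivWithin ℝ u S) + holderSeminormOn α S (fderivWithin ℝ u S))

/-- `u ∈ C^{1,α}(S)`. -/
def MemC1Holder [NormedSpace ℝ X] (α : ℝ) (S : Set X) (u : X → ℝ) : Prop :=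
  ContDiffOn ℝ 1 u S ∧ c1HolderNormOn α S u < ∞

/-- The `C²(S)` norm: `sup_S |u| + sup_S |∇u| + sup_S |D²u|`. -/
def c2NormOn [NormedSpace ℝ X] (S : Set X) (u : X → ℝ) : ℝ≥0∞ :=
  supNormOn S u + (supNormOn S (fderivWithin ℝ u S)
    + supNormOn S (fderivWithin ℝ (fderivWithin ℝ u S) S))

/-! ### Sets that are locally supergraphs -/

/-- The first `m` coordinates `x'` of `x ∈ ℝ^{m+1}`. -/
def horiz {m : ℕ} (x : EuclideanSpace ℝ (Fin (m + 1))) : EuclideanSpace ℝ (Fin m) :=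
  WithLp.toLp 2 (fun i => x i.castSucc)

/-- The last coordinate of `x ∈ ℝ^{m+1}`. -/
def vert {m : ℕ} (x : EuclideanSpace ℝ (Fin (m + 1))) : ℝ := x (Fin.last m)

/-- The open cylinder `Q_{r,h} = B'_r × (-h, h)`. -/
def graphCylinder (m : ℕ) (r h : ℝ) : Set (EuclideanSpace ℝ (Fin (m + 1))) :=
  {x | horiz x ∈ ball 0 r ∧ -h < vert x ∧ vert x < h}

/-- After the rigid motion which takes `q` to the origin (with inverse `z ↦ q + L z`), the set `E`
coincides in `Q_{r,h}` with the supergraph of `u`. -/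
def IsSupergraphIn {m : ℕ} (E : Set (EuclideanSpace ℝ (Fin (m + 1))))
    (q : EuclideanSpace ℝ (Fin (m + 1)))
    (L : EuclideanSpace ℝ (Fin (m + 1)) ≃ₗᵢ[ℝ] EuclideanSpace ℝ (Fin (m + 1)))
    (r h : ℝ) (u : EuclideanSpace ℝ (Fin m) → ℝ) : Prop :=
  {z | q + L z ∈ E} ∩ graphCylinder m r h
    = {z | horiz z ∈ ball 0 r ∧ u (horiz z) < vert z ∧ vert z < h}

/-- Local convergence in measure. -/
def ConvergesLocallyInMeasure {n : ℕ} (Ek : ℕ → Set (EuclideanSpace ℝ (Fin n)))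
    (E : Set (EuclideanSpace ℝ (Fin n))) : Prop :=
  ∀ R : ℝ, 0 < R → Tendsto (fun k => volume (symmDiff (Ek k) E ∩ ball 0 R)) atTop (𝓝 0)

/-- `E_k → E` in the `C^{1,α}` sense in a neighbourhood of `q`. -/
def ConvergesC1Holder {m : ℕ} (α : ℝ) (Ek : ℕ → Set (EuclideanSpace ℝ (Fin (m + 1))))
    (E : Set (EuclideanSpace ℝ (Fin (m + 1)))) (q : EuclideanSpace ℝ (Fin (m + 1))) : Prop :=
  ConvergesLocallyInMeasure Ek E ∧
  ∃ (L : EuclideanSpace ℝ (Fin (m + 1)) ≃ₗᵢ[ℝ] EuclideanSpace ℝ (Fin (m + 1)))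
    (r h : ℝ) (u : EuclideanSpace ℝ (Fin m) → ℝ) (uk : ℕ → EuclideanSpace ℝ (Fin m) → ℝ),
    0 < r ∧ 0 < h ∧ u 0 = 0 ∧
    MemC1Holder α (closedBall 0 (2 * r)) u ∧
    IsSupergraphIn E q L (2 * r) (2 * h) u ∧
    (∀ k, MemC1Holder α (closedBall 0 (2 * r)) (uk k)) ∧
    (∀ k, IsSupergraphIn (Ek k) q L (2 * r) (2 * h) (uk k)) ∧
    Tendsto (fun k => c1HolderNormOn α (closedBall 0 (2 * r)) (uk k - u)) atTop (𝓝 0)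

/-- `E_k → E` in the `C²` sense in a neighbourhood of `q`. -/
def ConvergesC2 {m : ℕ} (Ek : ℕ → Set (EuclideanSpace ℝ (Fin (m + 1))))
    (E : Set (EuclideanSpace ℝ (Fin (m + 1)))) (q : EuclideanSpace ℝ (Fin (m + 1))) : Prop :=
  ConvergesLocallyInMeasure Ek E ∧
  ∃ (L : EuclideanSpace ℝ (Fin (m + 1)) ≃ₗᵢ[ℝ] EuclideanSpace ℝ (Fin (m + 1)))
    (r h : ℝ) (u : EuclideanSpace ℝ (Fin m) → ℝ) (uk : ℕ → EuclideanSpace ℝ (Fin m) → ℝ),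
    0 < r ∧ 0 < h ∧ u 0 = 0 ∧
    ContDiffOn ℝ 2 u (closedBall 0 (2 * r)) ∧
    IsSupergraphIn E q L (2 * r) (2 * h) u ∧
    (∀ k, ContDiffOn ℝ 2 (uk k) (closedBall 0 (2 * r))) ∧
    (∀ k, IsSupergraphIn (Ek k) q L (2 * r) (2 * h) (uk k)) ∧
    Tendsto (fun k => c2NormOn (closedBall 0 (2 * r)) (uk k - u)) atTop (𝓝 0)

/-! ### Classical mean curvature -/

/-- `(1/m) div (∇u / √(1 + |∇u|²))` at the origin of `ℝ^m`: the arithmetic mean of the principal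
curvatures of the graph of `u` over the origin, positive when the supergraph is locally strictly
convex. -/
def graphMeanCurvature {m : ℕ} (u : EuclideanSpace ℝ (Fin m) → ℝ) : ℝ :=
  (1 / (m : ℝ)) * LinearMap.trace ℝ (EuclideanSpace ℝ (Fin m))
    (fderiv ℝ (fun x => (√(1 + ‖gradient u x‖ ^ 2))⁻¹ • gradient u x) 0).toLinearMap

/-- `H` is the classical mean curvature at `q` of the set `E`, which near `q` is, in suitable
orthonormal coordinates centred at `q`, the supergraph of a function of class `C²`. -/
def IsMeanCurvatureAt {m : ℕ} (E : Set (EuclideanSpace ℝ (Fin (m + 1))))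
    (q : EuclideanSpace ℝ (Fin (m + 1))) (H : ℝ) : Prop :=
  ∃ (L : EuclideanSpace ℝ (Fin (m + 1)) ≃ₗᵢ[ℝ] EuclideanSpace ℝ (Fin (m + 1)))
    (r h : ℝ) (u : EuclideanSpace ℝ (Fin m) → ℝ),
    0 < r ∧ 0 < h ∧ u 0 = 0 ∧ ContDiffOn ℝ 2 u (closedBall 0 r) ∧
    IsSupergraphIn E q L r h u ∧ H = graphMeanCurvature u

/-- The classical mean curvature of `E` at `q` (meaningful when there is exactly one `H` with
`IsMeanCurvatureAt E q H`). -/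
def meanCurvature {m : ℕ} (E : Set (EuclideanSpace ℝ (Fin (m + 1))))
    (q : EuclideanSpace ℝ (Fin (m + 1))) : ℝ :=
  Classical.epsilon (IsMeanCurvatureAt E q)

end

/-!
The fractional curvature is invariant under rigid motions, so one may place the boundary point at the
origin and describe the set near it, in a cylinder `B'_δ × (-h, h)`, as the supergraph `t > φ(x)` of a
function with `φ(0) = 0`. The cylinder and the kernel are invariant under `z ↦ -z`. Hence the sign
function `χ_{CE} - χ_E` may be replaced inside the cylinder by its even part, which on the line over
`x` is supported between `-φ(-x)` and `φ(x)`. So the principal value is the sum of two absolutely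
convergent integrals (`tendsto_truncFracCurvature`): the far field, over the complement of the
cylinder, and
`∫_{|x| < δ} ∫_{-φ(-x)}^{φ(x)} (|x|² + t²)^{-(n+s)/2} dt dx`,
whose inner integral is called `bandIntegral`. Its length is `φ(x) + φ(-x) = O(|x|^{1+α})`, so the
inner integral is `O(|x|^{1+α-n-s})`, which is integrable on `ℝ^{n-1}` for `s < α`, with bounds that
only depend on the `C^{1,α}` norm.

Part (1) follows by dominated convergence in the band integral and in the far field, where the
kernels converge in `L¹` and the sets locally in measure (`tendsto_farField`).

For part (2) the far field is bounded (`exists_farField_bound`), so it disappears after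
multiplication by `1 - s`. With `m = n - 1`, in polar coordinates `x = r θ` of `ℝ^m` the band integral
is `r^{1-m-s}` times a bounded quantity which tends to
`A(θ, θ) (1 + ⟨b, θ⟩²)^{-(m+2)/2}`, where `b = ∇u(0)`, `A = D²u(0)` (`tendsto_bandIntegral_radial`), and
the measures `(1 - s) r^{-s} dr` concentrate at `r = 0` (`tendsto_concentration`). So the limit is
the integral of this function over the unit sphere of `ℝ^m`. It equals the area of the sphere times
the mean curvature (`integral_sphere_bilin`): up to the factor `m + 2` it is the integral of `A(x, x)`
over the ellipsoid `|x|² + ⟨b, x⟩² < 1`, which a linear change of variables turns into the integral of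
a quadratic form over the unit ball. In this way no rotation making the tangent plane horizontal is
needed. As the left-hand side of the limit only depends on the set, the classical mean curvature
does not depend on the representation by a graph (`IsMeanCurvatureAt.unique`).
-/

noncomputable section

/-! ### Horizontal and vertical coordinates -/

section Coordinates

variable {m : ℕ}

theorem norm_sq_eq_horiz_vert (z : EuclideanSpace ℝ (Fin (m + 1))) :
    ‖z‖ ^ 2 = ‖horiz z‖ ^ 2 + vert z ^ 2 := by
  simp [EuclideanSpace.norm_sq_eq, Fin.sum_univ_castSucc, horiz, vert]

theorem continuous_horiz : Continuous (horiz : EuclideanSpace ℝ (Fin (m + 1)) → _) := by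
  unfold horiz
  fun_prop

theorem continuous_vert : Continuous (vert : EuclideanSpace ℝ (Fin (m + 1)) → ℝ) := by
  unfold vert
  fun_prop

@[simp] theorem horiz_neg (z : EuclideanSpace ℝ (Fin (m + 1))) : horiz (-z) = -horiz z := by
  ext i; simp [horiz]

@[simp] theorem vert_neg (z : EuclideanSpace ℝ (Fin (m + 1))) : vert (-z) = -vert z := by
  simp [vert]

@[simp] theorem horiz_add (z w : EuclideanSpace ℝ (Fin (m + 1))) :
    horiz (z + w) = horiz z + horiz w := by
  ext i; simp [horiz]

@[simp] theorem vert_add (z w : EuclideanSpace ℝ (Fin (m + 1))) :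
    vert (z + w) = vert z + vert w := by
  simp [vert]

@[simp] theorem horiz_zero : horiz (0 : EuclideanSpace ℝ (Fin (m + 1))) = 0 := by
  ext i; simp [horiz]

@[simp] theorem vert_zero : vert (0 : EuclideanSpace ℝ (Fin (m + 1))) = 0 := by
  simp [vert]

/-- The point `(x, t)` of `ℝ^{m+1}`. -/
def joinPoint (p : EuclideanSpace ℝ (Fin m) × ℝ) : EuclideanSpace ℝ (Fin (m + 1)) :=
  WithLp.toLp 2 (Fin.snoc (α := fun _ => ℝ) (fun i => p.1 i) p.2)

@[simp] theorem horiz_joinPoint (p : EuclideanSpace ℝ (Fin m) × ℝ) : horiz (joinPoint p) = p.1 := by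
  ext i; simp [horiz, joinPoint]

@[simp] theorem vert_joinPoint (p : EuclideanSpace ℝ (Fin m) × ℝ) : vert (joinPoint p) = p.2 := by
  simp [vert, joinPoint]

theorem joinPoint_horiz_vert (z : EuclideanSpace ℝ (Fin (m + 1))) :
    joinPoint (horiz z, vert z) = z := by
  ext i
  refine Fin.lastCases ?_ (fun j => ?_) i <;> simp [horiz, vert, joinPoint]

theorem continuous_joinPoint :
    Continuous (joinPoint : EuclideanSpace ℝ (Fin m) × ℝ → EuclideanSpace ℝ (Fin (m + 1))) := by
  unfold joinPoint
  refine (PiLp.continuous_toLp 2 _).comp (continuous_pi fun i => ?_)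
  refine Fin.lastCases ?_ (fun j => ?_) i
  · simpa using continuous_snd
  · simp only [Fin.snoc_castSucc]
    fun_prop

/-- The identification `z ↦ (z', z_n)` of `ℝ^{m+1}` with `ℝ^m × ℝ`. -/
def splitPoint : EuclideanSpace ℝ (Fin (m + 1)) ≃ᵐ EuclideanSpace ℝ (Fin m) × ℝ where
  toFun z := (horiz z, vert z)
  invFun := joinPoint
  left_inv := joinPoint_horiz_vert
  right_inv p := by simp
  measurable_toFun := (continuous_horiz.prodMk continuous_vert).measurable
  measurable_invFun := continuous_joinPoint.measurable

theorem measurePreserving_splitPoint :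
    MeasurePreserving (splitPoint : EuclideanSpace ℝ (Fin (m + 1)) ≃ᵐ _) volume
      ((volume : Measure (EuclideanSpace ℝ (Fin m))).prod (volume : Measure ℝ)) := by
  have h1 := PiLp.volume_preserving_ofLp (Fin (m + 1))
  have h2 := volume_preserving_piFinSuccAbove (fun _ : Fin (m + 1) => ℝ) (Fin.last m)
  have h3 : MeasurePreserving (Prod.swap : ℝ × (Fin m → ℝ) → (Fin m → ℝ) × ℝ)
      (volume.prod volume) (volume.prod volume) := Measure.measurePreserving_swap
  have h4 : MeasurePreserving (Prod.map (WithLp.toLp 2) id : (Fin m → ℝ) × ℝ → _)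
      (volume.prod volume) ((volume : Measure (EuclideanSpace ℝ (Fin m))).prod volume) :=
    (PiLp.volume_preserving_toLp (Fin m)).prod (MeasurePreserving.id _)
  have h := (h4.comp h3).comp (h2.comp h1)
  have key : ⇑(splitPoint : EuclideanSpace ℝ (Fin (m + 1)) ≃ᵐ _)
      = (Prod.map (WithLp.toLp 2) id ∘ Prod.swap) ∘
        (MeasurableEquiv.piFinSuccAbove (fun _ : Fin (m + 1) => ℝ) (Fin.last m)) ∘ WithLp.ofLp := by
    funext z
    refine Prod.ext ?_ ?_
    · ext i
      simp [splitPoint, horiz, MeasurableEquiv.piFinSuccAbove, Fin.init]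
    · simp [splitPoint, vert, MeasurableEquiv.piFinSuccAbove]
  rw [key]
  exact h

theorem isOpen_graphCylinder (r h : ℝ) : IsOpen (graphCylinder m r h) := by
  have : graphCylinder m r h = horiz ⁻¹' ball 0 r ∩ vert ⁻¹' Ioo (-h) h := by
    ext z; simp [graphCylinder]
  rw [this]
  exact (isOpen_ball.preimage continuous_horiz).inter (isOpen_Ioo.preimage continuous_vert)

theorem neg_mem_graphCylinder {r h : ℝ} {z : EuclideanSpace ℝ (Fin (m + 1))}
    (hz : z ∈ graphCylinder m r h) : -z ∈ graphCylinder m r h := by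
  obtain ⟨h1, h2, h3⟩ := hz
  refine ⟨by simpa using h1, ?_, ?_⟩ <;> rw [vert_neg] <;> linarith

theorem norm_horiz_le (z : EuclideanSpace ℝ (Fin (m + 1))) : ‖horiz z‖ ≤ ‖z‖ := by
  have := norm_sq_eq_horiz_vert z
  nlinarith [norm_nonneg z, norm_nonneg (horiz z), sq_nonneg (vert z)]

theorem abs_vert_le (z : EuclideanSpace ℝ (Fin (m + 1))) : |vert z| ≤ ‖z‖ := by
  have := norm_sq_eq_horiz_vert z
  exact abs_le_of_sq_le_sq (by nlinarith [sq_nonneg ‖horiz z‖]) (norm_nonneg z)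

theorem ball_subset_graphCylinder {r h ρ : ℝ} (hr : ρ ≤ r) (hh : ρ ≤ h) :
    ball 0 ρ ⊆ graphCylinder m r h := by
  intro z hz
  rw [mem_ball_zero_iff] at hz
  have h1 := norm_horiz_le z
  have h2 := abs_le.1 (abs_vert_le z)
  refine ⟨mem_ball_zero_iff.2 (by linarith), by linarith, by linarith⟩

theorem convex_graphCylinder (r h : ℝ) : Convex ℝ (graphCylinder m r h) := by
  have h1 : IsLinearMap ℝ (horiz : EuclideanSpace ℝ (Fin (m + 1)) → _) :=
    ⟨horiz_add, fun c z => by ext i; simp [horiz]⟩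
  have h2 : IsLinearMap ℝ (vert : EuclideanSpace ℝ (Fin (m + 1)) → ℝ) :=
    ⟨vert_add, fun c z => by simp [vert]⟩
  have : graphCylinder m r h = horiz ⁻¹' ball 0 r ∩ vert ⁻¹' Ioo (-h) h := by
    ext z; simp [graphCylinder]
  rw [this]
  exact ((convex_ball 0 r).is_linear_preimage h1).inter ((convex_Ioo _ _).is_linear_preimage h2)

end Coordinates

/-! ### The sign function of a set and the kernel -/

section Kernel

variable {X : Type*}

/-- The function `χ_{CF} - χ_F`. -/
def sideSign (F : Set X) (y : X) : ℝ :=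
  Fᶜ.indicator (fun _ => (1 : ℝ)) y - F.indicator (fun _ => (1 : ℝ)) y

theorem sideSign_of_mem {F : Set X} {y : X} (h : y ∈ F) : sideSign F y = -1 := by
  simp [sideSign, h]

theorem sideSign_of_notMem {F : Set X} {y : X} (h : y ∉ F) : sideSign F y = 1 := by
  simp [sideSign, h]

theorem abs_sideSign (F : Set X) (y : X) : |sideSign F y| = 1 := by
  by_cases h : y ∈ F <;> simp [sideSign, h]

theorem abs_sideSign_sub_le (F G : Set X) (y : X) :
    |sideSign F y - sideSign G y| ≤ 2 * (symmDiff F G).indicator (fun _ => (1 : ℝ)) y := by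
  by_cases h : y ∈ F <;> by_cases h' : y ∈ G <;>
    simp [sideSign, h, h', Set.mem_symmDiff] <;> norm_num

theorem aestronglyMeasurable_sideSign [MeasurableSpace X] {μ : Measure X} {F : Set X}
    (hF : NullMeasurableSet F μ) : AEStronglyMeasurable (sideSign F) μ :=
  (aestronglyMeasurable_const.indicator₀ hF.compl).sub (aestronglyMeasurable_const.indicator₀ hF)

variable {n : ℕ}

theorem truncFracCurvature_eq (s : ℝ) (E : Set (EuclideanSpace ℝ (Fin n)))
    (q : EuclideanSpace ℝ (Fin n)) (ρ : ℝ) :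
    truncFracCurvature s E q ρ
      = ∫ y in (ball q ρ)ᶜ, sideSign E y * (‖y - q‖ ^ ((n : ℝ) + s))⁻¹ := rfl

/-- The fractional curvature is invariant under rigid motions. -/
theorem truncFracCurvature_rigidMotion (s : ℝ) (E : Set (EuclideanSpace ℝ (Fin n)))
    (q : EuclideanSpace ℝ (Fin n)) (L : EuclideanSpace ℝ (Fin n) ≃ₗᵢ[ℝ] EuclideanSpace ℝ (Fin n)) :
    truncFracCurvature s E q = truncFracCurvature s {z | q + L z ∈ E} 0 := by
  funext ρ
  have hmp : MeasurePreserving (fun z => q + L z) (volume : Measure (EuclideanSpace ℝ (Fin n)))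
      volume := (measurePreserving_add_left volume q).comp L.measurePreserving
  have hemb : MeasurableEmbedding (fun z => q + L z) :=
    (measurableEmbedding_addLeft q).comp L.toHomeomorph.measurableEmbedding
  rw [truncFracCurvature_eq, truncFracCurvature_eq,
    ← hmp.setIntegral_preimage_emb hemb]
  have : (fun z => q + L z) ⁻¹' (ball q ρ)ᶜ = (ball 0 ρ)ᶜ := by
    ext z; simp
  rw [this]
  refine setIntegral_congr_fun measurableSet_ball.compl fun z _ => ?_
  simp only [sideSign, Set.indicator, add_sub_cancel_left, L.norm_map, sub_zero]
  rfl

theorem nullMeasurableSet_rigidMotion {E : Set (EuclideanSpace ℝ (Fin n))}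
    (hE : NullMeasurableSet E volume) (q : EuclideanSpace ℝ (Fin n))
    (L : EuclideanSpace ℝ (Fin n) ≃ₗᵢ[ℝ] EuclideanSpace ℝ (Fin n)) :
    NullMeasurableSet {z | q + L z ∈ E} volume := by
  have hmp : MeasurePreserving (fun z => q + L z) (volume : Measure (EuclideanSpace ℝ (Fin n)))
      volume := (measurePreserving_add_left volume q).comp L.measurePreserving
  exact hE.preimage hmp.quasiMeasurePreserving

theorem inv_rpow_norm_le {w : EuclideanSpace ℝ (Fin n)} {a K p : ℝ}
    (ha : 0 < a) (hp : 0 ≤ p) (h : a ≤ K * ‖w‖) (hK : 0 ≤ K) :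
    (‖w‖ ^ p)⁻¹ ≤ K ^ p * a ^ (-p) := by
  have hw : 0 < ‖w‖ := by
    by_contra hc
    have : ‖w‖ = 0 := le_antisymm (not_lt.1 hc) (norm_nonneg _)
    rw [this] at h; linarith
  have h1 : a ^ p ≤ (K * ‖w‖) ^ p := Real.rpow_le_rpow ha.le h hp
  rw [Real.mul_rpow hK hw.le] at h1
  rw [Real.rpow_neg ha.le, inv_le_iff_one_le_mul₀ (by positivity)]
  have : 0 < a ^ p := by positivity
  rw [mul_assoc, mul_comm, mul_assoc, inv_mul_eq_div, one_le_div this]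
  linarith

theorem measurable_inv_rpow_norm (p : ℝ) :
    Measurable (fun z : EuclideanSpace ℝ (Fin n) => (‖z‖ ^ p)⁻¹) := by
  fun_prop

theorem integrableOn_kernel_compl_ball {ρ p : ℝ} (hρ : 0 < ρ) (hp : (n : ℝ) < p) :
    IntegrableOn (fun z : EuclideanSpace ℝ (Fin n) => (‖z‖ ^ p)⁻¹) (ball 0 ρ)ᶜ := by
  have h1 : Integrable (fun z : EuclideanSpace ℝ (Fin n) => (1 + ‖z‖) ^ (-p)) :=
    integrable_one_add_norm (by simpa using hp)
  have hp0 : 0 ≤ p := by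
    have : (0 : ℝ) ≤ n := Nat.cast_nonneg n
    linarith
  refine ((h1.const_mul ((1 / ρ + 1) ^ p)).integrableOn).mono'
    (measurable_inv_rpow_norm p).aestronglyMeasurable ?_
  refine (ae_restrict_iff' measurableSet_ball.compl).2 (Eventually.of_forall fun z hz => ?_)
  have hz' : ρ ≤ ‖z‖ := by simpa using hz
  rw [Real.norm_of_nonneg (by positivity)]
  refine inv_rpow_norm_le (by positivity) hp0 ?_ (by positivity)
  have : 1 ≤ 1 / ρ * ‖z‖ := by rw [one_div, inv_mul_eq_div, one_le_div hρ]; exact hz'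
  linarith

end Kernel

/-! ### The principal value at a point of a graph -/

section PrincipalValue

/-- The integral of a function against the antisymmetric difference of two half-lines: only the
interval between the end points of the half-lines contributes. -/
theorem setIntegral_halfLine_difference {h a b : ℝ} (ha : |a| < h) (hb : |b| < h) {G : ℝ → ℝ}
    (hG : ∀ t ∈ Ioo (-h) h,
      G t = ((if a < t then -1 else 1) + (if t < b then -1 else 1)) / 2) (k : ℝ → ℝ) :
    ∫ t in Ioo (-h) h, G t * k t = ∫ t in b..a, k t := by
  rw [abs_lt] at ha hb
  rcases le_or_gt b a with hab | hab
  · have h1 : ∀ t ∈ Ioo (-h) h, G t * k t = (Icc b a).indicator k t := by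
      intro t ht
      rw [hG t ht]
      by_cases h1 : a < t <;> by_cases h2 : t < b
      · linarith
      · simp [h1, h2]
      · simp [h1, h2]
      · simp [h1, h2, not_lt.1 h1, not_lt.1 h2]
    rw [setIntegral_congr_fun measurableSet_Ioo h1, setIntegral_indicator measurableSet_Icc,
      inter_eq_right.2 (show Icc b a ⊆ Ioo (-h) h from
        fun t ht => ⟨by linarith [ht.1], by linarith [ht.2]⟩),
      integral_Icc_eq_integral_Ioc, intervalIntegral.integral_of_le hab]
  · have h1 : ∀ t ∈ Ioo (-h) h, G t * k t = (Ioo a b).indicator (fun t => -k t) t := by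
      intro t ht
      rw [hG t ht]
      by_cases h1 : a < t <;> by_cases h2 : t < b
      · simp [h1, h2]
      · simp [h1, h2]
      · simp [h1, h2]
      · linarith
    rw [setIntegral_congr_fun measurableSet_Ioo h1, setIntegral_indicator measurableSet_Ioo,
      inter_eq_right.2 (show Ioo a b ⊆ Ioo (-h) h from
        fun t ht => ⟨by linarith [ht.1], by linarith [ht.2]⟩),
      ← integral_Ioc_eq_integral_Ioo, intervalIntegral.integral_symm,
      intervalIntegral.integral_of_le hab.le, integral_neg]

variable {m : ℕ}

/-- The integral of the kernel `|z|^{-p}` over the part of the vertical line through `x` between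
the graph of `φ` and its image under `z ↦ -z`, counted with sign. -/
def bandIntegral (p : ℝ) (φ : EuclideanSpace ℝ (Fin m) → ℝ) (x : EuclideanSpace ℝ (Fin m)) : ℝ :=
  ∫ t in (-φ (-x))..φ x, (√(‖x‖ ^ 2 + t ^ 2) ^ p)⁻¹

/-- In `B'_δ × (-h, h)` the set `F` is the supergraph of `φ`, which takes values in `(-h, h)`. -/
def IsCentredGraph (F : Set (EuclideanSpace ℝ (Fin (m + 1)))) (δ h : ℝ)
    (φ : EuclideanSpace ℝ (Fin m) → ℝ) : Prop :=
  (∀ z ∈ graphCylinder m δ h, z ∈ F ↔ φ (horiz z) < vert z) ∧ ∀ x ∈ ball 0 δ, |φ x| < h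

theorem integrableOn_ball_rpow_norm {a δ : ℝ} (ha : -(m : ℝ) < a) :
    IntegrableOn (fun x : EuclideanSpace ℝ (Fin m) => ‖x‖ ^ a) (ball 0 δ) := by
  rcases Nat.eq_zero_or_pos m with rfl | hm
  · have : (fun x : EuclideanSpace ℝ (Fin 0) => ‖x‖ ^ a) = fun _ => (0 : ℝ) ^ a := by
      funext x
      rw [Subsingleton.elim x 0, norm_zero]
    rw [this]
    exact integrableOn_const measure_ball_lt_top.ne
  · refine integrableOn_ball_of_norm_le_rpow (C := 1) (α := -a) (by simpa using Nat.succ_le_of_lt hm)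
      (by simp; linarith) (Eventually.of_forall fun x => ?_) (measurable_norm.pow_const a).aestronglyMeasurable
    rw [neg_neg, one_mul, Real.norm_of_nonneg (by positivity)]

theorem kernel_le {p : ℝ} (hp : 0 < p) {x : EuclideanSpace ℝ (Fin m)} (hx : x ≠ 0) (t : ℝ) :
    (√(‖x‖ ^ 2 + t ^ 2) ^ p)⁻¹ ≤ (‖x‖ ^ p)⁻¹ := by
  have hx' : 0 < ‖x‖ := norm_pos_iff.2 hx
  refine inv_anti₀ (by positivity) (Real.rpow_le_rpow hx'.le ?_ hp.le)
  exact Real.le_sqrt_of_sq_le (by nlinarith [sq_nonneg t])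

variable {F : Set (EuclideanSpace ℝ (Fin (m + 1)))} {φ : EuclideanSpace ℝ (Fin m) → ℝ}
  {δ h M α s : ℝ}

theorem abs_bandIntegral_le {p : ℝ} (hp : 0 < p) (hα : 0 < 1 + α) (hM : 0 ≤ M)
    (hφ : ∀ x ∈ ball 0 δ, |φ x + φ (-x)| ≤ M * ‖x‖ ^ (1 + α))
    {x : EuclideanSpace ℝ (Fin m)} (hx : x ∈ ball 0 δ) :
    |bandIntegral p φ x| ≤ M * ‖x‖ ^ (1 + α - p) := by
  have h1 := hφ x hx
  rcases eq_or_ne x 0 with rfl | hx0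
  · have h2 : φ 0 = 0 := by
      rw [neg_zero, norm_zero, Real.zero_rpow hα.ne', mul_zero] at h1
      have := abs_nonpos_iff.1 h1
      linarith
    simp only [bandIntegral, neg_zero, h2, intervalIntegral.integral_same, abs_zero]
    positivity
  · have h2 := intervalIntegral.norm_integral_le_of_norm_le_const
      (a := -φ (-x)) (b := φ x) (f := fun t => (√(‖x‖ ^ 2 + t ^ 2) ^ p)⁻¹) (C := (‖x‖ ^ p)⁻¹)
      (fun t _ => by rw [Real.norm_of_nonneg (by positivity)]; exact kernel_le hp hx0 t)
    have hx' : 0 < ‖x‖ := norm_pos_iff.2 hx0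
    rw [sub_neg_eq_add] at h2
    calc |bandIntegral p φ x| ≤ (‖x‖ ^ p)⁻¹ * |φ x + φ (-x)| := h2
      _ ≤ (‖x‖ ^ p)⁻¹ * (M * ‖x‖ ^ (1 + α)) := by gcongr
      _ = M * ‖x‖ ^ (1 + α - p) := by
        rw [Real.rpow_sub hx', div_eq_mul_inv]; ring

/-- The values of the symmetrised sign function on a vertical line. -/
theorem symm_sideSign_joinPoint (hF : IsCentredGraph F δ h φ) {x : EuclideanSpace ℝ (Fin m)}
    (hx : x ∈ ball 0 δ) {t : ℝ} (ht : t ∈ Ioo (-h) h) :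
    (sideSign F (joinPoint (x, t)) + sideSign F (-joinPoint (x, t))) / 2
      = ((if φ x < t then -1 else 1) + (if t < -φ (-x) then -1 else 1)) / 2 := by
  have hz : joinPoint (x, t) ∈ graphCylinder m δ h := by
    refine ⟨by simpa using hx, by simpa using ht.1, by simpa using ht.2⟩
  have h1 := hF.1 _ hz
  have h2 := hF.1 _ (neg_mem_graphCylinder hz)
  simp only [horiz_joinPoint, vert_joinPoint, horiz_neg, vert_neg] at h1 h2
  have e1 : sideSign F (joinPoint (x, t)) = if φ x < t then -1 else 1 := by
    split_ifs with hc
    · exact sideSign_of_mem (h1.2 hc)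
    · exact sideSign_of_notMem (fun h => hc (h1.1 h))
  have e2 : sideSign F (-joinPoint (x, t)) = if t < -φ (-x) then -1 else 1 := by
    split_ifs with hc
    · exact sideSign_of_mem (h2.2 (by linarith))
    · exact sideSign_of_notMem (fun h => hc (by linarith [h2.1 h]))
  rw [e1, e2]

/-- On a vertical line the symmetrised integrand is bounded by `|x|^{-p}` and lives between the
graph and its reflection. -/
theorem abs_symm_integrand_le {p : ℝ} (hp : 0 < p) (hα : 0 < 1 + α)
    (hF : IsCentredGraph F δ h φ)
    (hφ : ∀ x ∈ ball 0 δ, |φ x + φ (-x)| ≤ M * ‖x‖ ^ (1 + α))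
    {x : EuclideanSpace ℝ (Fin m)} (hx : x ∈ ball 0 δ) {t : ℝ} (ht : t ∈ Ioo (-h) h) :
    ‖(sideSign F (joinPoint (x, t)) + sideSign F (-joinPoint (x, t))) / 2
        * (√(‖x‖ ^ 2 + t ^ 2) ^ p)⁻¹‖
      ≤ (uIcc (-φ (-x)) (φ x)).indicator (fun _ => (‖x‖ ^ p)⁻¹) t := by
  rw [symm_sideSign_joinPoint hF hx ht]
  -- Over `x = 0` the bound by `|x|^{-p} = 0` (a junk value) holds since the band is reduced to the
  -- origin, where the kernel has the junk value `0` too.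
  have hk : (√(‖x‖ ^ 2 + t ^ 2) ^ p)⁻¹ ≤ (‖x‖ ^ p)⁻¹ ∨ (x = 0 ∧ t ≠ 0) := by
    rcases eq_or_ne x 0 with rfl | hx0
    · rcases eq_or_ne t 0 with rfl | ht0
      · left; simp
      · exact Or.inr ⟨rfl, ht0⟩
    · exact Or.inl (kernel_le hp hx0 t)
  have hzero : x = 0 → φ x = 0 := by
    rintro rfl
    have h1 := hφ 0 hx
    rw [neg_zero, norm_zero, Real.zero_rpow hα.ne', mul_zero] at h1
    have := abs_nonpos_iff.1 h1
    linarith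
  have hpos : 0 ≤ (√(‖x‖ ^ 2 + t ^ 2) ^ p)⁻¹ := by positivity
  have hnn : 0 ≤ (uIcc (-φ (-x)) (φ x)).indicator (fun _ => (‖x‖ ^ p)⁻¹) t :=
    indicator_nonneg (fun _ _ => by positivity) _
  rcases hk with hk | ⟨rfl, ht0⟩
  · by_cases h1 : φ x < t <;> by_cases h2 : t < -φ (-x)
    · rw [indicator_of_mem (mem_uIcc.2 (Or.inr ⟨h1.le, h2.le⟩))]
      rw [norm_mul, Real.norm_of_nonneg hpos]
      simpa [h1, h2] using hk
    · simpa [h1, h2] using hnn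
    · simpa [h1, h2] using hnn
    · rw [indicator_of_mem (mem_uIcc.2 (Or.inl ⟨not_lt.1 h2, not_lt.1 h1⟩))]
      rw [norm_mul, Real.norm_of_nonneg hpos]
      simpa [h1, h2] using hk
  · have h0 := hzero rfl
    rcases lt_or_gt_of_ne ht0 with h1 | h1
    · have h2 : ¬ (0 < t) := not_lt.2 h1.le
      simpa [h0, h1, h2] using hnn
    · have h2 : ¬ (t < 0) := not_lt.2 h1.le
      simpa [h0, h1, h2] using hnn

theorem norm_eq_sqrt (z : EuclideanSpace ℝ (Fin (m + 1))) :
    ‖z‖ = √(‖horiz z‖ ^ 2 + vert z ^ 2) := by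
  rw [← norm_sq_eq_horiz_vert, Real.sqrt_sq (norm_nonneg z)]

/-- The symmetrised integrand in the coordinates `(x, t)`. -/
def symmIntegrand (F : Set (EuclideanSpace ℝ (Fin (m + 1)))) (p : ℝ)
    (y : EuclideanSpace ℝ (Fin m) × ℝ) : ℝ :=
  (sideSign F (joinPoint y) + sideSign F (-joinPoint y)) / 2 * (√(‖y.1‖ ^ 2 + y.2 ^ 2) ^ p)⁻¹

theorem symmIntegrand_splitPoint (p : ℝ) (z : EuclideanSpace ℝ (Fin (m + 1))) :
    symmIntegrand F p (splitPoint z)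
      = (sideSign F z + sideSign F (-z)) / 2 * (‖z‖ ^ p)⁻¹ := by
  have h : splitPoint z = (horiz z, vert z) := rfl
  rw [symmIntegrand, h, joinPoint_horiz_vert, norm_eq_sqrt z]

theorem aestronglyMeasurable_symm_sideSign (hF : NullMeasurableSet F volume) :
    AEStronglyMeasurable (fun z => (sideSign F z + sideSign F (-z)) / 2) volume := by
  have h1 := aestronglyMeasurable_sideSign hF
  have h2 : AEStronglyMeasurable (fun z => sideSign F (-z)) volume :=
    h1.comp_quasiMeasurePreserving (Measure.measurePreserving_neg volume).quasiMeasurePreserving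
  simp only [div_eq_mul_inv]
  exact AEStronglyMeasurable.mul_const (h1.add h2) _

theorem aestronglyMeasurable_symmIntegrand (hF : NullMeasurableSet F volume) (p : ℝ) :
    AEStronglyMeasurable (symmIntegrand F p) (volume.prod volume) := by
  have h1 : AEStronglyMeasurable (fun z => symmIntegrand F p (splitPoint z)) volume := by
    simp only [symmIntegrand_splitPoint]
    exact (aestronglyMeasurable_symm_sideSign hF).mul
      (measurable_inv_rpow_norm p).aestronglyMeasurable
  exact (measurePreserving_splitPoint.aestronglyMeasurable_comp_iff
    splitPoint.measurableEmbedding).1 h1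

/-- Over `x`, the symmetrized integrand lives on a band of length `|φ x + φ (-x)| ≤ M ‖x‖ ^ (1 + α)`,
on which the kernel is at most `‖x‖ ^ (-p)`; the resulting bound `‖x‖ ^ (1 + α - p)` is integrable
in dimension `m` because `s < α`. -/
theorem integrable_symmIntegrand (hF : NullMeasurableSet F volume) (hg : IsCentredGraph F δ h φ)
    (hα : 0 < 1 + α) (hM : 0 ≤ M)
    (hφ : ∀ x ∈ ball 0 δ, |φ x + φ (-x)| ≤ M * ‖x‖ ^ (1 + α)) (hs : s < α)
    (hp : 0 < ((m + 1 : ℕ) : ℝ) + s) :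
    Integrable (symmIntegrand F (((m + 1 : ℕ) : ℝ) + s))
      ((volume.restrict (ball 0 δ)).prod (volume.restrict (Ioo (-h) h))) := by
  set p := ((m + 1 : ℕ) : ℝ) + s with hpdef
  have hmeas : AEStronglyMeasurable (symmIntegrand F p)
      ((volume.restrict (ball 0 δ)).prod (volume.restrict (Ioo (-h) h))) := by
    rw [Measure.prod_restrict]
    exact (aestronglyMeasurable_symmIntegrand hF p).restrict
  have hbound : ∀ x ∈ ball (0 : EuclideanSpace ℝ (Fin m)) δ,
      ∀ᵐ t ∂(volume.restrict (Ioo (-h) h)), ‖symmIntegrand F p (x, t)‖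
        ≤ (uIcc (-φ (-x)) (φ x)).indicator (fun _ => (‖x‖ ^ p)⁻¹) t := by
    intro x hx
    refine (ae_restrict_iff' measurableSet_Ioo).2 (Eventually.of_forall fun t ht => ?_)
    exact abs_symm_integrand_le hp hα hg hφ hx ht
  have hint : ∀ x : EuclideanSpace ℝ (Fin m),
      Integrable ((uIcc (-φ (-x)) (φ x)).indicator (fun _ => (‖x‖ ^ p)⁻¹)) volume := fun x =>
    (integrable_indicator_iff measurableSet_uIcc).2
      (integrableOn_const (by rw [uIcc]; exact measure_Icc_lt_top.ne))
  rw [integrable_prod_iff hmeas]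
  constructor
  · filter_upwards [hmeas.prodMk_left, ae_restrict_mem measurableSet_ball] with x hx1 hx
    exact (hint x).integrableOn.mono' hx1 (hbound x hx)
  · refine ((integrableOn_ball_rpow_norm (m := m) (a := 1 + α - p) (δ := δ) ?_).const_mul M).mono'
      hmeas.norm.integral_prod_right' ?_
    · rw [hpdef]; push_cast; linarith
    · filter_upwards [ae_restrict_mem measurableSet_ball] with x hx
      rw [Real.norm_of_nonneg (integral_nonneg fun _ => norm_nonneg _)]
      calc ∫ t in Ioo (-h) h, ‖symmIntegrand F p (x, t)‖
          ≤ ∫ t in Ioo (-h) h, (uIcc (-φ (-x)) (φ x)).indicator (fun _ => (‖x‖ ^ p)⁻¹) t := by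
            refine integral_mono_of_nonneg (Eventually.of_forall fun _ => norm_nonneg _)
              (hint x).integrableOn (hbound x hx)
        _ ≤ ∫ t, (uIcc (-φ (-x)) (φ x)).indicator (fun _ => (‖x‖ ^ p)⁻¹) t :=
            setIntegral_le_integral (hint x)
              (Eventually.of_forall fun t => indicator_nonneg (fun _ _ => by positivity) _)
        _ = |φ x + φ (-x)| * (‖x‖ ^ p)⁻¹ := by
            rw [integral_indicator measurableSet_uIcc, setIntegral_const, smul_eq_mul,
              measureReal_def, Real.volume_interval, ENNReal.toReal_ofReal (abs_nonneg _),
              sub_neg_eq_add]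
        _ ≤ M * ‖x‖ ^ (1 + α) * (‖x‖ ^ p)⁻¹ := by gcongr; exact hφ x hx
        _ ≤ M * ‖x‖ ^ (1 + α - p) := by
            rcases eq_or_ne x 0 with rfl | hx0
            · rw [norm_zero, Real.zero_rpow hα.ne', mul_zero, zero_mul]
              positivity
            · rw [Real.rpow_sub (norm_pos_iff.2 hx0), div_eq_mul_inv, mul_assoc]

theorem integral_symmIntegrand_slice (hg : IsCentredGraph F δ h φ) (p : ℝ)
    {x : EuclideanSpace ℝ (Fin m)} (hx : x ∈ ball 0 δ) :
    ∫ t in Ioo (-h) h, symmIntegrand F p (x, t) = bandIntegral p φ x := by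
  have hx' : -x ∈ ball (0 : EuclideanSpace ℝ (Fin m)) δ := by simpa using hx
  refine setIntegral_halfLine_difference (hg.2 x hx) (by rw [abs_neg]; exact hg.2 _ hx')
    (fun t ht => symm_sideSign_joinPoint hg hx ht) _

theorem integrableOn_bandIntegral (hF : NullMeasurableSet F volume) (hg : IsCentredGraph F δ h φ)
    (hα : 0 < 1 + α) (hM : 0 ≤ M)
    (hφ : ∀ x ∈ ball 0 δ, |φ x + φ (-x)| ≤ M * ‖x‖ ^ (1 + α)) (hs : s < α)
    (hp : 0 < ((m + 1 : ℕ) : ℝ) + s) :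
    IntegrableOn (bandIntegral (((m + 1 : ℕ) : ℝ) + s) φ) (ball 0 δ) := by
  refine (integrable_symmIntegrand hF hg hα hM hφ hs hp).integral_prod_left.congr ?_
  filter_upwards [ae_restrict_mem measurableSet_ball] with x hx
  exact integral_symmIntegrand_slice hg _ hx

theorem splitPoint_preimage (δ h : ℝ) :
    (splitPoint : EuclideanSpace ℝ (Fin (m + 1)) ≃ᵐ _) ⁻¹' (ball 0 δ ×ˢ Ioo (-h) h)
      = graphCylinder m δ h := rfl

/-- At a point of a `C^{1,α}` graph the principal value exists for `s < α`. By the symmetry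
`z ↦ -z` the cylinder contributes the absolutely convergent integral of `bandIntegral`. -/
theorem tendsto_truncFracCurvature (hF : NullMeasurableSet F volume)
    (hg : IsCentredGraph F δ h φ) (hδ : 0 < δ) (hh : 0 < h)
    (hα : 0 < 1 + α) (hM : 0 ≤ M)
    (hφ : ∀ x ∈ ball 0 δ, |φ x + φ (-x)| ≤ M * ‖x‖ ^ (1 + α)) (hs : s < α) (hs0 : 0 < s) :
    Tendsto (truncFracCurvature s F 0) (𝓝[>] 0)
      (𝓝 ((∫ x in ball 0 δ, bandIntegral (((m + 1 : ℕ) : ℝ) + s) φ x)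
        + ∫ z in (graphCylinder m δ h)ᶜ, sideSign F z * (‖z‖ ^ (((m + 1 : ℕ) : ℝ) + s))⁻¹)) := by
  set p := ((m + 1 : ℕ) : ℝ) + s with hpdef
  have hp : 0 < p := by positivity
  have hC : MeasurableSet (graphCylinder m δ h) := (isOpen_graphCylinder δ h).measurableSet
  set f : EuclideanSpace ℝ (Fin (m + 1)) → ℝ := fun z => sideSign F z * (‖z‖ ^ p)⁻¹ with hf
  set g : EuclideanSpace ℝ (Fin (m + 1)) → ℝ :=
    fun z => (sideSign F z + sideSign F (-z)) / 2 * (‖z‖ ^ p)⁻¹ with hgdef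
  have hprod := integrable_symmIntegrand hF hg hα hM hφ hs hp
  have hprod' : IntegrableOn (symmIntegrand F p) (ball 0 δ ×ˢ Ioo (-h) h)
      (volume.prod volume) := by
    rw [IntegrableOn, ← Measure.prod_restrict]; exact hprod
  have hgint : IntegrableOn g (graphCylinder m δ h) := by
    have h1 := (measurePreserving_splitPoint.integrableOn_comp_preimage
      splitPoint.measurableEmbedding).2 hprod'
    rw [splitPoint_preimage] at h1
    exact h1.congr_fun (fun z _ => symmIntegrand_splitPoint p z) hC
  have hgval : ∫ z in graphCylinder m δ h, g z = ∫ x in ball 0 δ, bandIntegral p φ x := by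
    have h1 := measurePreserving_splitPoint.setIntegral_preimage_emb
      splitPoint.measurableEmbedding (symmIntegrand F p)
      (ball (0 : EuclideanSpace ℝ (Fin m)) δ ×ˢ Ioo (-h) h)
    rw [splitPoint_preimage, ← Measure.prod_restrict, integral_prod _ hprod] at h1
    simp only [symmIntegrand_splitPoint] at h1
    rw [hgdef, h1]
    exact setIntegral_congr_fun measurableSet_ball fun x hx => integral_symmIntegrand_slice hg p hx
  have hfint : ∀ ρ, 0 < ρ → IntegrableOn f (ball 0 ρ)ᶜ := by
    intro ρ hρ
    refine (integrableOn_kernel_compl_ball (n := m + 1) hρ (p := p)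
      (by rw [hpdef]; linarith)).mono'
      ((aestronglyMeasurable_sideSign hF).restrict.mul
        (measurable_inv_rpow_norm p).aestronglyMeasurable) (Eventually.of_forall fun z => ?_)
    rw [hf, norm_mul, Real.norm_eq_abs, abs_sideSign, one_mul,
      Real.norm_of_nonneg (by positivity)]
  have hlim : Tendsto (fun ρ => ∫ z in graphCylinder m δ h, ((ball 0 ρ)ᶜ).indicator g z)
      (𝓝[>] 0) (𝓝 (∫ z in graphCylinder m δ h, g z)) := by
    refine tendsto_integral_filter_of_dominated_convergence (fun z => ‖g z‖)
      (Eventually.of_forall fun ρ =>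
        hgint.aestronglyMeasurable.indicator measurableSet_ball.compl)
      (Eventually.of_forall fun ρ => Eventually.of_forall fun z => norm_indicator_le_norm_self _ _)
      hgint.norm (Eventually.of_forall fun z => ?_)
    rcases eq_or_ne z 0 with rfl | hz
    · have : g 0 = 0 := by simp [hgdef, Real.zero_rpow hp.ne']
      rw [this]
      refine tendsto_const_nhds.congr fun ρ => ?_
      by_cases h : (0 : EuclideanSpace ℝ (Fin (m + 1))) ∈ (ball 0 ρ)ᶜ
      · rw [indicator_of_mem h, this]
      · rw [indicator_of_notMem h]
    · refine tendsto_const_nhds.congr' ?_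
      filter_upwards [Ioo_mem_nhdsGT (norm_pos_iff.2 hz)] with ρ hρ
      rw [indicator_of_mem]
      simpa using hρ.2.le
  rw [← hgval]
  refine (hlim.add_const _).congr' ?_
  filter_upwards [Ioo_mem_nhdsGT (lt_min hδ hh)] with ρ hρ
  have hsub : ball 0 ρ ⊆ graphCylinder m δ h :=
    ball_subset_graphCylinder (hρ.2.le.trans (min_le_left _ _)) (hρ.2.le.trans (min_le_right _ _))
  set D := graphCylinder m δ h \ ball 0 ρ with hD
  have hfD : IntegrableOn f D := (hfint ρ hρ.1).mono_set fun z hz => hz.2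
  have hneg : MeasurePreserving (fun z : EuclideanSpace ℝ (Fin (m + 1)) => -z) volume volume :=
    Measure.measurePreserving_neg volume
  have hnegD : (fun z : EuclideanSpace ℝ (Fin (m + 1)) => -z) ⁻¹' D = D := by
    ext z
    simp only [mem_preimage, hD, Set.mem_sdiff, mem_ball_zero_iff, norm_neg]
    refine and_congr_left fun _ => ⟨fun hz => ?_, neg_mem_graphCylinder⟩
    simpa using neg_mem_graphCylinder hz
  have hemb : MeasurableEmbedding (fun z : EuclideanSpace ℝ (Fin (m + 1)) => -z) :=
    (Homeomorph.neg _).measurableEmbedding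
  have hfD' : IntegrableOn (fun z => f (-z)) D := by
    have := (hneg.integrableOn_comp_preimage hemb).2 hfD
    rwa [hnegD] at this
  have hsymm : ∫ z in D, f z = ∫ z in D, g z := by
    have h1 : ∫ z in D, f (-z) = ∫ z in D, f z := by
      have := hneg.setIntegral_preimage_emb hemb f D
      rwa [hnegD] at this
    have h2 : ∀ z, g z = (f z + f (-z)) / 2 := by
      intro z
      simp only [hf, hgdef, norm_neg]
      ring
    simp only [h2]
    rw [integral_div, integral_add hfD hfD', h1]
    ring
  have hsplit : (ball (0 : EuclideanSpace ℝ (Fin (m + 1))) ρ)ᶜ = D ∪ (graphCylinder m δ h)ᶜ := by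
    ext z
    simp only [hD, mem_union, Set.mem_sdiff, mem_compl_iff]
    constructor
    · intro hz
      by_cases hzc : z ∈ graphCylinder m δ h
      · exact Or.inl ⟨hzc, hz⟩
      · exact Or.inr hzc
    · rintro (hz | hz)
      · exact hz.2
      · exact fun h => hz (hsub h)
  have hfC : IntegrableOn f (graphCylinder m δ h)ᶜ :=
    (hfint ρ hρ.1).mono_set (compl_subset_compl.2 hsub)
  have htr : truncFracCurvature s F 0 ρ = ∫ z in (ball 0 ρ)ᶜ, f z := by
    rw [truncFracCurvature_eq]
    simp only [sub_zero, hf, hpdef]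
  have hval : ∫ z in (ball 0 ρ)ᶜ, f z = (∫ z in D, f z) + ∫ z in (graphCylinder m δ h)ᶜ, f z := by
    rw [hsplit]
    exact setIntegral_union (disjoint_left.2 fun z (hz : z ∈ D) hz' => hz' hz.1) hC.compl hfD hfC
  rw [htr, hval, hsymm, setIntegral_indicator measurableSet_ball.compl]
  rfl

end PrincipalValue

/-! ### The contribution of the far field -/

section FarField

variable {n : ℕ}

/-- Integrals of a fixed integrable function over sets converging to `∅` locally in measure tend
to `0`. -/
theorem tendsto_setIntegral_of_locally_null {G : EuclideanSpace ℝ (Fin n) → ℝ} (hG : Integrable G)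
    {S : ℕ → Set (EuclideanSpace ℝ (Fin n))}
    (hS : ∀ R : ℝ, 0 < R → Tendsto (fun k => volume (S k ∩ ball 0 R)) atTop (𝓝 0)) :
    Tendsto (fun k => ∫⁻ y in S k, ‖G y‖ₑ) atTop (𝓝 0) := by
  have hfin : ∫⁻ y, ‖G y‖ₑ ≠ ∞ := hG.2.ne
  have htail : Tendsto (fun N : ℕ => ∫⁻ y, (ball 0 (N : ℝ))ᶜ.indicator (fun y => ‖G y‖ₑ) y) atTop
      (𝓝 (∫⁻ _ : EuclideanSpace ℝ (Fin n), 0)) := by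
    refine tendsto_lintegral_of_dominated_convergence' (fun y => ‖G y‖ₑ)
      (fun N => hG.1.enorm.indicator measurableSet_ball.compl)
      (fun N => Eventually.of_forall fun y => indicator_le_self _ _ _) hfin
      (Eventually.of_forall fun y => ?_)
    refine tendsto_const_nhds.congr' ?_
    obtain ⟨N0, hN0⟩ := exists_nat_gt ‖y‖
    filter_upwards [eventually_ge_atTop N0] with N hN
    rw [indicator_of_notMem]
    have : (N0 : ℝ) ≤ N := by exact_mod_cast hN
    simp only [mem_compl_iff, mem_ball_zero_iff, not_not]
    linarith
  rw [lintegral_zero] at htail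
  rw [ENNReal.tendsto_nhds_zero] at htail ⊢
  intro ε hε
  have hε2 : 0 < ε / 2 := ENNReal.half_pos hε.ne'
  obtain ⟨N, hN, hN1⟩ := ((htail _ hε2).and (eventually_ge_atTop 1)).exists
  have hNpos : (0 : ℝ) < N := by exact_mod_cast hN1
  have hnear := tendsto_setLIntegral_zero hfin (hS N hNpos)
  rw [ENNReal.tendsto_nhds_zero] at hnear
  filter_upwards [hnear _ hε2] with k hk
  calc ∫⁻ y in S k, ‖G y‖ₑ
      ≤ ∫⁻ y in (S k ∩ ball 0 N) ∪ (ball 0 (N : ℝ))ᶜ, ‖G y‖ₑ := by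
        refine lintegral_mono_set fun y hy => ?_
        by_cases h : y ∈ ball (0 : EuclideanSpace ℝ (Fin n)) N
        · exact Or.inl ⟨hy, h⟩
        · exact Or.inr h
    _ ≤ (∫⁻ y in S k ∩ ball 0 N, ‖G y‖ₑ) + ∫⁻ y in (ball 0 (N : ℝ))ᶜ, ‖G y‖ₑ :=
        lintegral_union_le _ _ _
    _ ≤ ε / 2 + ε / 2 := by
        refine add_le_add hk ?_
        rwa [← lintegral_indicator measurableSet_ball.compl]
    _ = ε := ENNReal.add_halves ε

/-- The kernel is bounded by an integrable function which does not depend on the centre, as long as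
the centre stays bounded, nor on the exponent, as long as it stays away from `n`. -/
theorem kernel_le_uniform {ρ Q p₀ p₁ p : ℝ} (hρ : 0 < ρ) (hQ : 0 ≤ Q) (hp : p ∈ Icc p₀ p₁)
    (hp0 : 0 ≤ p₀) {y w : EuclideanSpace ℝ (Fin n)} (hw : ρ ≤ ‖w‖) (hy : ‖y‖ ≤ Q + ‖w‖) :
    (‖w‖ ^ p)⁻¹ ≤ ((1 + Q) / ρ + 1) ^ p₁ * (1 + ‖y‖) ^ (-p₀) := by
  have hK : 1 ≤ (1 + Q) / ρ + 1 := by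
    have : 0 ≤ (1 + Q) / ρ := by positivity
    linarith
  have h1 := inv_rpow_norm_le (a := 1 + ‖y‖) (w := w) (K := (1 + Q) / ρ + 1) (p := p)
    (by positivity) (hp0.trans hp.1) (by
      have : 1 + Q ≤ (1 + Q) / ρ * ‖w‖ := by
        rw [div_mul_eq_mul_div, le_div_iff₀ hρ]
        gcongr
      linarith) (by positivity)
  refine h1.trans ?_
  have h2 : (1 + ‖y‖) ^ (-p) ≤ (1 + ‖y‖) ^ (-p₀) :=
    Real.rpow_le_rpow_of_exponent_le (by linarith [norm_nonneg y]) (by linarith [hp.1])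
  have h3 := Real.rpow_le_rpow_of_exponent_le hK hp.2
  gcongr

theorem exists_farField_bound {ρ p₀ p₁ : ℝ} (hρ : 0 < ρ) (hp0 : (n : ℝ) < p₀)
    {C : Set (EuclideanSpace ℝ (Fin n))} (hC : ball 0 ρ ⊆ C) (hCm : MeasurableSet C) :
    ∃ B : ℝ, ∀ (F : Set (EuclideanSpace ℝ (Fin n))), ∀ p ∈ Icc p₀ p₁,
      |∫ z in Cᶜ, sideSign F z * (‖z‖ ^ p)⁻¹| ≤ B := by
  have hn : (0 : ℝ) ≤ n := Nat.cast_nonneg n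
  have h1 : Integrable (fun z : EuclideanSpace ℝ (Fin n) =>
      ((1 + 0) / ρ + 1) ^ p₁ * (1 + ‖z‖) ^ (-p₀)) :=
    (integrable_one_add_norm (by simpa using hp0)).const_mul _
  refine ⟨∫ z in Cᶜ, ((1 + 0) / ρ + 1) ^ p₁ * (1 + ‖z‖) ^ (-p₀), fun F p hp => ?_⟩
  refine norm_integral_le_of_norm_le (G := ℝ) h1.integrableOn
    ((ae_restrict_iff' hCm.compl).2 (Eventually.of_forall fun z hz => ?_))
  rw [norm_mul, Real.norm_eq_abs, abs_sideSign, one_mul, Real.norm_of_nonneg (by positivity)]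
  have hzρ : ρ ≤ ‖z‖ := by
    by_contra hc
    exact hz (hC (mem_ball_zero_iff.2 (not_le.1 hc)))
  exact kernel_le_uniform hρ le_rfl hp (by linarith) hzρ (by linarith)

/-- The far field converges: the kernels converge in `L¹`, the sets locally in measure. -/
theorem tendsto_farField {Ek : ℕ → Set (EuclideanSpace ℝ (Fin n))}
    {E : Set (EuclideanSpace ℝ (Fin n))} {qk : ℕ → EuclideanSpace ℝ (Fin n)}
    {q : EuclideanSpace ℝ (Fin n)} {pk : ℕ → ℝ} {p ρ : ℝ}
    (L : EuclideanSpace ℝ (Fin n) ≃ₗᵢ[ℝ] EuclideanSpace ℝ (Fin n))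
    (hE : NullMeasurableSet E volume) (hEk : ∀ k, NullMeasurableSet (Ek k) volume)
    (hconv : ConvergesLocallyInMeasure Ek E) (hq : Tendsto qk atTop (𝓝 q))
    (hpk : Tendsto pk atTop (𝓝 p)) (hp : (n : ℝ) < p)
    {C : Set (EuclideanSpace ℝ (Fin n))} (hρ : 0 < ρ) (hC : ball 0 ρ ⊆ C) (hCo : IsOpen C)
    (hCc : Convex ℝ C) :
    Tendsto (fun k => ∫ z in Cᶜ, sideSign {z | qk k + L z ∈ Ek k} z * (‖z‖ ^ pk k)⁻¹) atTop
      (𝓝 (∫ z in Cᶜ, sideSign {z | q + L z ∈ E} z * (‖z‖ ^ p)⁻¹)) := by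
  have hn : (0 : ℝ) ≤ n := Nat.cast_nonneg n
  set K : ℝ → EuclideanSpace ℝ (Fin n) → ℝ := fun p => Cᶜ.indicator fun z => (‖z‖ ^ p)⁻¹ with hK
  have hKm : ∀ p, Measurable (K p) := fun p =>
    (measurable_inv_rpow_norm p).indicator hCo.measurableSet.compl
  set T : EuclideanSpace ℝ (Fin n) → EuclideanSpace ℝ (Fin n) → EuclideanSpace ℝ (Fin n) :=
    fun c y => L.symm (y - c) with hT
  have hTm : ∀ c, Measurable (T c) := fun c =>
    L.symm.continuous.measurable.comp (measurable_id.sub_const c)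
  -- the integral in the original coordinates
  have hrw : ∀ (c : EuclideanSpace ℝ (Fin n)) (A : Set (EuclideanSpace ℝ (Fin n))) (p : ℝ),
      ∫ z in Cᶜ, sideSign {z | c + L z ∈ A} z * (‖z‖ ^ p)⁻¹
        = ∫ y, sideSign A y * K p (T c y) := by
    intro c A p
    have hmp : MeasurePreserving (fun z => c + L z) (volume : Measure (EuclideanSpace ℝ (Fin n)))
        volume := (measurePreserving_add_left volume c).comp L.measurePreserving
    have hemb : MeasurableEmbedding (fun z => c + L z) :=
      (measurableEmbedding_addLeft c).comp L.toHomeomorph.measurableEmbedding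
    rw [← hmp.integral_comp hemb, ← integral_indicator hCo.measurableSet.compl]
    refine integral_congr_ae (Eventually.of_forall fun z => ?_)
    have h1 : sideSign A (c + L z) = sideSign {z | c + L z ∈ A} z := rfl
    simp only [hT, hK, add_sub_cancel_left, LinearIsometryEquiv.symm_apply_apply, h1]
    by_cases hz : z ∈ Cᶜ
    · rw [indicator_of_mem hz, indicator_of_mem hz]
    · rw [indicator_of_notMem hz, indicator_of_notMem hz, mul_zero]
  simp only [hrw]
  set p₀ := (n + p) / 2 with hp₀
  set Q := ‖q‖ + 1 with hQ
  set G : EuclideanSpace ℝ (Fin n) → ℝ :=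
    fun y => ((1 + Q) / ρ + 1) ^ (p + 1) * (1 + ‖y‖) ^ (-p₀) with hGdef
  have hG : Integrable G :=
    (integrable_one_add_norm (by rw [finrank_euclideanSpace_fin]; linarith)).const_mul _
  have hbd : ∀ c : EuclideanSpace ℝ (Fin n), ‖c‖ ≤ Q → ∀ p' ∈ Icc p₀ (p + 1), ∀ y,
      ‖K p' (T c y)‖ ≤ G y := by
    intro c hc p' hp' y
    have hG0 : 0 ≤ G y := by positivity
    by_cases hz : T c y ∈ Cᶜ
    · simp only [hK]
      rw [indicator_of_mem hz, Real.norm_of_nonneg (by positivity)]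
      refine kernel_le_uniform hρ (by positivity) hp' (by linarith) ?_ ?_
      · by_contra hc'
        exact hz (hC (mem_ball_zero_iff.2 (not_le.1 hc')))
      · have : ‖T c y‖ = ‖y - c‖ := L.symm.norm_map _
        rw [this]
        have := norm_add_le c (y - c)
        rw [add_sub_cancel] at this
        linarith
    · simp only [hK]
      rw [indicator_of_notMem hz, norm_zero]
      exact hG0
  have hpmem : p ∈ Icc p₀ (p + 1) := ⟨by rw [hp₀]; linarith, by linarith⟩
  have hpkmem : ∀ᶠ k in atTop, pk k ∈ Icc p₀ (p + 1) :=
    hpk.eventually (Icc_mem_nhds (by rw [hp₀]; linarith) (by linarith))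
  have hqkmem : ∀ᶠ k in atTop, ‖qk k‖ ≤ Q :=
    hq.norm.eventually (Iic_mem_nhds (by rw [hQ]; linarith))
  have hKint : Integrable (fun y => K p (T q y)) :=
    hG.mono' ((hKm p).comp (hTm q)).aestronglyMeasurable
      (Eventually.of_forall (hbd q (by rw [hQ]; linarith) p hpmem))
  have hKkint : ∀ᶠ k in atTop, Integrable (fun y => K (pk k) (T (qk k) y)) := by
    filter_upwards [hpkmem, hqkmem] with k h1 h2
    exact hG.mono' ((hKm _).comp (hTm _)).aestronglyMeasurable
      (Eventually.of_forall (hbd _ h2 _ h1))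
  have hmulint : ∀ (A : Set (EuclideanSpace ℝ (Fin n))) (f : EuclideanSpace ℝ (Fin n) → ℝ),
      NullMeasurableSet A volume → Integrable f → Integrable (fun y => sideSign A y * f y) := by
    intro A f hA hf
    refine hf.norm.mono' ((aestronglyMeasurable_sideSign hA).mul hf.1)
      (Eventually.of_forall fun y => ?_)
    rw [norm_mul, Real.norm_eq_abs, abs_sideSign, one_mul]
  -- the kernels converge in `L¹`
  have hlim1 : Tendsto (fun k => ∫ y, sideSign (Ek k) y * (K (pk k) (T (qk k) y) - K p (T q y)))
      atTop (𝓝 (∫ _ : EuclideanSpace ℝ (Fin n), (0 : ℝ))) := by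
    refine tendsto_integral_filter_of_dominated_convergence (fun y => G y + G y)
      (Eventually.of_forall fun k => (aestronglyMeasurable_sideSign (hEk k)).mul
        (((hKm _).comp (hTm _)).sub ((hKm _).comp (hTm _))).aestronglyMeasurable) ?_
      (hG.add hG) ?_
    · filter_upwards [hpkmem, hqkmem] with k h1 h2
      refine Eventually.of_forall fun y => ?_
      rw [norm_mul, Real.norm_eq_abs, abs_sideSign, one_mul]
      exact (norm_sub_le _ _).trans (add_le_add (hbd _ h2 _ h1 y)
        (hbd q (by rw [hQ]; linarith) p hpmem y))
    · have hmp : MeasurePreserving (T q) volume volume :=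
        L.symm.measurePreserving.comp (measurePreserving_sub_right volume q)
      have hfr : ∀ᵐ y, T q y ∉ frontier C := by
        have h0 : ∀ᵐ z : EuclideanSpace ℝ (Fin n), z ∉ frontier C :=
          measure_eq_zero_iff_ae_notMem.1 (hCc.addHaar_frontier volume)
        exact hmp.quasiMeasurePreserving.ae h0
      filter_upwards [hfr] with y hy
      have hTk : Tendsto (fun k => T (qk k) y) atTop (𝓝 (T q y)) :=
        (L.symm.continuous.tendsto _).comp (tendsto_const_nhds.sub hq)
      have hKlim : Tendsto (fun k => K (pk k) (T (qk k) y)) atTop (𝓝 (K p (T q y))) := by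
        by_cases hyC : T q y ∈ C
        · have : K p (T q y) = 0 := by
            simp only [hK]; rw [indicator_of_notMem]; simpa using hyC
          rw [this]
          refine tendsto_const_nhds.congr' ?_
          filter_upwards [hTk.eventually (hCo.mem_nhds hyC)] with k hk
          simp only [hK]; rw [indicator_of_notMem]; exact fun h => h hk
        · have hycl : T q y ∈ (closure C)ᶜ := by
            intro h
            rw [hCo.frontier_eq] at hy
            exact hy ⟨h, hyC⟩
          have h0 : T q y ≠ 0 := by
            intro h
            exact hyC (h ▸ hC (mem_ball_self hρ))
          have : K p (T q y) = (‖T q y‖ ^ p)⁻¹ := by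
            simp only [hK]; rw [indicator_of_mem]; exact hyC
          rw [this]
          have hl : Tendsto (fun k => (‖T (qk k) y‖ ^ pk k)⁻¹) atTop (𝓝 (‖T q y‖ ^ p)⁻¹) :=
            (hTk.norm.rpow hpk (Or.inl (norm_ne_zero_iff.2 h0))).inv₀
              (by have := norm_pos_iff.2 h0; positivity)
          refine hl.congr' ?_
          filter_upwards [hTk.eventually (isClosed_closure.isOpen_compl.mem_nhds hycl)] with k hk
          simp only [hK]; rw [indicator_of_mem]
          exact fun h => hk (subset_closure h)
      rw [tendsto_zero_iff_norm_tendsto_zero]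
      have h2 := (tendsto_sub_nhds_zero_iff.2 hKlim).norm
      rw [norm_zero] at h2
      refine h2.congr fun k => ?_
      rw [norm_mul, Real.norm_eq_abs (sideSign _ _), abs_sideSign, one_mul]
  rw [integral_zero] at hlim1
  -- the sets converge in `L¹` with respect to the limit kernel
  have hlim2 : Tendsto (fun k => ∫ y, (sideSign (Ek k) y - sideSign E y) * K p (T q y))
      atTop (𝓝 0) := by
    have h1 := tendsto_setIntegral_of_locally_null (hKint.const_mul 2) hconv
    rw [tendsto_zero_iff_norm_tendsto_zero]
    have h2 : Tendsto (fun k => ‖∫ y, (sideSign (Ek k) y - sideSign E y) * K p (T q y)‖ₑ)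
        atTop (𝓝 0) := by
      refine tendsto_of_tendsto_of_tendsto_of_le_of_le tendsto_const_nhds h1
        (fun _ => zero_le) fun k => ?_
      refine (enorm_integral_le_lintegral_enorm _).trans ?_
      rw [← lintegral_indicator₀ (by
        exact ((hEk k).diff hE).union (hE.diff (hEk k)))]
      refine lintegral_mono fun y => ?_
      by_cases hy : y ∈ symmDiff (Ek k) E
      · rw [indicator_of_mem hy, enorm_mul, enorm_mul]
        gcongr
        have := abs_sideSign_sub_le (Ek k) E y
        rw [indicator_of_mem hy] at this
        rw [← ofReal_norm, ← ofReal_norm]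
        refine ENNReal.ofReal_le_ofReal ?_
        simpa using this
      · have := abs_sideSign_sub_le (Ek k) E y
        rw [indicator_of_notMem hy, mul_zero] at this
        rw [abs_nonpos_iff.1 this, zero_mul, enorm_zero]
        exact zero_le
    have h3 := (ENNReal.tendsto_toReal ENNReal.zero_ne_top).comp h2
    simpa [Function.comp_def] using h3
  have hsum := (hlim1.add hlim2).add_const (∫ y, sideSign E y * K p (T q y))
  rw [add_zero, zero_add] at hsum
  refine hsum.congr' ?_
  filter_upwards [hKkint] with k hk
  have e1 : ∫ y, sideSign (Ek k) y * (K (pk k) (T (qk k) y) - K p (T q y))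
      = (∫ y, sideSign (Ek k) y * K (pk k) (T (qk k) y)) - ∫ y, sideSign (Ek k) y * K p (T q y) := by
    rw [← integral_sub (hmulint _ _ (hEk k) hk) (hmulint _ _ (hEk k) hKint)]
    simp only [mul_sub]
  have e2 : ∫ y, (sideSign (Ek k) y - sideSign E y) * K p (T q y)
      = (∫ y, sideSign (Ek k) y * K p (T q y)) - ∫ y, sideSign E y * K p (T q y) := by
    rw [← integral_sub (hmulint _ _ (hEk k) hKint) (hmulint _ _ hE hKint)]
    simp only [sub_mul]
  rw [e1, e2]
  ring

end FarField

/-! ### Functions with Hölder continuous gradient -/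

section Gradient

variable {X : Type*} [NormedAddCommGroup X] [NormedSpace ℝ X]

/-- A mean value estimate for symmetric second differences. -/
theorem abs_symm_second_difference_sub_le {f : X → ℝ} {x z : X} {c K : ℝ}
    (hf : ∀ τ ∈ Icc (-1 : ℝ) 1, DifferentiableAt ℝ f (x + τ • z))
    (hK : ∀ τ ∈ Icc (0 : ℝ) 1,
      |fderiv ℝ f (x + τ • z) z - fderiv ℝ f (x + (-τ) • z) z - 2 * τ * c| ≤ K) :
    |f (x + z) + f (x + -z) - 2 * f x - c| ≤ K := by
  have hline : ∀ σ τ : ℝ, HasDerivAt (fun τ : ℝ => x + (σ * τ) • z) (σ • z) τ := by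
    intro σ τ
    have h1 : HasDerivAt (fun τ : ℝ => σ * τ) σ τ := by
      simpa using (hasDerivAt_id τ).const_mul σ
    exact (h1.smul_const z).const_add x
  have hd : ∀ τ ∈ Icc (0 : ℝ) 1, HasDerivWithinAt
      (fun τ : ℝ => f (x + (1 * τ) • z) + f (x + (-1 * τ) • z) - τ ^ 2 * c)
      (fderiv ℝ f (x + τ • z) z - fderiv ℝ f (x + (-τ) • z) z - 2 * τ * c) (Icc 0 1) τ := by
    intro τ hτ
    have h1 := (hf (1 * τ) ⟨by linarith [hτ.1], by linarith [hτ.2]⟩).hasFDerivAt.comp_hasDerivAt τ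
      (hline 1 τ)
    have h2 := (hf (-1 * τ) ⟨by linarith [hτ.2], by linarith [hτ.1]⟩).hasFDerivAt.comp_hasDerivAt
      τ (hline (-1) τ)
    have h3 : HasDerivAt (fun τ : ℝ => τ ^ 2 * c) (2 * τ * c) τ := by
      simpa using (hasDerivAt_pow 2 τ).mul_const c
    refine ((h1.add h2).sub h3).hasDerivWithinAt.congr_deriv ?_
    simp [sub_eq_add_neg]
  have := norm_image_sub_le_of_norm_deriv_le_segment_01' hd (fun τ hτ => hK τ ⟨hτ.1, hτ.2.le⟩)
  simp only [one_smul, mul_one, neg_smul, one_pow, one_mul, mul_zero, zero_smul,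
    add_zero, ne_eq, OfNat.ofNat_ne_zero, not_false_eq_true, zero_pow, zero_mul, sub_zero,
    Real.norm_eq_abs] at this
  convert this using 2
  ring

/-- On the ball of radius `R` about `0` the function `v` is differentiable, `|∇v| ≤ Λ`, and `∇v` is
`α`-Hölder continuous with constant `M`. -/
structure HasGradBounds (α R Λ M : ℝ) (v : X → ℝ) : Prop where
  diff : ∀ x ∈ ball (0 : X) R, DifferentiableAt ℝ v x
  bound : ∀ x ∈ ball (0 : X) R, ‖fderiv ℝ v x‖ ≤ Λ
  holder : ∀ x ∈ ball (0 : X) R, ∀ y ∈ ball (0 : X) R,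
    ‖fderiv ℝ v x - fderiv ℝ v y‖ ≤ M * ‖x - y‖ ^ α

namespace HasGradBounds

variable {α R Λ M Λ' M' : ℝ} {v w : X → ℝ}

theorem add (hv : HasGradBounds α R Λ M v) (hw : HasGradBounds α R Λ' M' w) :
    HasGradBounds α R (Λ + Λ') (M + M') (v + w) where
  diff x hx := (hv.diff x hx).add (hw.diff x hx)
  bound x hx := by
    rw [fderiv_add (hv.diff x hx) (hw.diff x hx)]
    exact (norm_add_le _ _).trans (add_le_add (hv.bound x hx) (hw.bound x hx))
  holder x hx y hy := by
    rw [fderiv_add (hv.diff x hx) (hw.diff x hx), fderiv_add (hv.diff y hy) (hw.diff y hy),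
      add_sub_add_comm, add_mul]
    exact (norm_add_le _ _).trans (add_le_add (hv.holder x hx y hy) (hw.holder x hx y hy))

theorem mono (hv : HasGradBounds α R Λ M v) (hΛ : Λ ≤ Λ') (hM : M ≤ M') :
    HasGradBounds α R Λ' M' v where
  diff := hv.diff
  bound x hx := (hv.bound x hx).trans hΛ
  holder x hx y hy := (hv.holder x hx y hy).trans (by gcongr)

theorem abs_sub_le (hv : HasGradBounds α R Λ M v) {x y : X} (hx : x ∈ ball 0 R)
    (hy : y ∈ ball 0 R) : |v y - v x| ≤ Λ * ‖y - x‖ :=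
  (convex_ball (0 : X) R).norm_image_sub_le_of_norm_fderiv_le hv.diff hv.bound hx hy

theorem add_smul_mem_ball {r : ℝ} {x z : X} (hx : ‖x‖ < r) (hz : ‖z‖ < r) {τ : ℝ}
    (hτ : τ ∈ Icc (-1 : ℝ) 1) : x + τ • z ∈ ball (0 : X) (2 * r) := by
  rw [mem_ball_zero_iff]
  calc ‖x + τ • z‖ ≤ ‖x‖ + |τ| * ‖z‖ := by
        refine (norm_add_le _ _).trans ?_
        rw [norm_smul, Real.norm_eq_abs]
    _ ≤ ‖x‖ + 1 * ‖z‖ := by gcongr; exact abs_le.2 hτ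
    _ < 2 * r := by linarith

theorem abs_second_difference_le {r : ℝ} (hv : HasGradBounds α (2 * r) Λ M v) (hα0 : 0 ≤ α)
    (hα : α ≤ 1) (hM : 0 ≤ M) {x z : X} (hx : ‖x‖ < r) (hz : ‖z‖ < r) :
    |v (x + z) + v (x + -z) - 2 * v x| ≤ 2 * M * ‖z‖ ^ (1 + α) := by
  rcases eq_or_ne z 0 with rfl | hz0
  · have : v x + v x - 2 * v x = 0 := by ring
    simp only [add_zero, neg_zero, this, abs_zero]
    positivity
  have h := abs_symm_second_difference_sub_le (f := v) (x := x) (z := z) (c := 0)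
    (K := 2 * M * ‖z‖ ^ (1 + α))
    (fun τ hτ => hv.diff _ (add_smul_mem_ball hx hz hτ)) (fun τ hτ => ?_)
  · simpa using h
  · rw [mul_zero, sub_zero, ← sub_apply]
    have h1 : ‖(x + τ • z) - (x + (-τ) • z)‖ ≤ 2 * ‖z‖ := by
      have : (x + τ • z) - (x + (-τ) • z) = (2 * τ) • z := by
        rw [add_sub_add_left_eq_sub, ← sub_smul]; ring_nf
      rw [this, norm_smul, Real.norm_of_nonneg (by linarith [hτ.1])]
      gcongr
      linarith [hτ.2]
    calc |(fderiv ℝ v (x + τ • z) - fderiv ℝ v (x + (-τ) • z)) z|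
        ≤ ‖fderiv ℝ v (x + τ • z) - fderiv ℝ v (x + (-τ) • z)‖ * ‖z‖ :=
          (fderiv ℝ v (x + τ • z) - fderiv ℝ v (x + (-τ) • z)).le_opNorm z
      _ ≤ M * ‖(x + τ • z) - (x + (-τ) • z)‖ ^ α * ‖z‖ := by
          gcongr
          exact hv.holder _ (add_smul_mem_ball hx hz ⟨by linarith [hτ.1], hτ.2⟩) _
            (add_smul_mem_ball hx hz ⟨by linarith [hτ.2], by linarith [hτ.1]⟩)
      _ ≤ M * (2 * ‖z‖) ^ α * ‖z‖ := by gcongr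
      _ = 2 ^ α * M * ‖z‖ ^ (1 + α) := by
          rw [Real.mul_rpow (by norm_num) (norm_nonneg z),
            Real.rpow_add (norm_pos_iff.2 hz0), Real.rpow_one]
          ring
      _ ≤ 2 * M * ‖z‖ ^ (1 + α) := by
          gcongr
          calc (2 : ℝ) ^ α ≤ 2 ^ (1 : ℝ) :=
                Real.rpow_le_rpow_of_exponent_le (by norm_num) hα
            _ = 2 := Real.rpow_one 2

end HasGradBounds

theorem norm_le_of_supNormOn_le {X F : Type*} [NormedAddCommGroup F] {S : Set X} {v : X → F} {C : ℝ}
    (hC : 0 ≤ C) (h : supNormOn S v ≤ ENNReal.ofReal C) {x : X} (hx : x ∈ S) : ‖v x‖ ≤ C := by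
  have h1 : ‖v x‖ₑ ≤ ENNReal.ofReal C := (le_iSup₂ (f := fun x _ => ‖v x‖ₑ) x hx).trans h
  rwa [← ofReal_norm, ENNReal.ofReal_le_ofReal_iff hC] at h1

theorem norm_sub_le_of_holderSeminormOn_le {X F : Type*} [NormedAddCommGroup X]
    [NormedAddCommGroup F] {S : Set X}
    {v : X → F} {C α : ℝ} (hC : 0 ≤ C) (h : holderSeminormOn α S v ≤ ENNReal.ofReal C) {x y : X}
    (hx : x ∈ S) (hy : y ∈ S) : ‖v x - v y‖ ≤ C * ‖x - y‖ ^ α := by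
  rcases eq_or_ne x y with rfl | hxy
  · rw [sub_self, norm_zero]; positivity
  have h1 : ‖v x - v y‖ₑ / ‖x - y‖ₑ ^ α ≤ ENNReal.ofReal C := by
    refine le_trans ?_ h
    refine le_iSup₂_of_le (f := fun x _ => _) x hx ?_
    refine le_iSup₂_of_le (f := fun y _ => _) y hy ?_
    exact le_iSup_of_le (f := fun _ => _) hxy le_rfl
  have hpos : 0 < ‖x - y‖ := norm_pos_iff.2 (sub_ne_zero.2 hxy)
  rw [← ofReal_norm, ← ofReal_norm, ENNReal.ofReal_rpow_of_pos hpos,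
    ← ENNReal.ofReal_div_of_pos (by positivity), ENNReal.ofReal_le_ofReal_iff hC,
    div_le_iff₀ (by positivity)] at h1
  exact h1

variable {R : ℝ} {w : X → ℝ} {C α : ℝ}

theorem fderivWithin_closedBall {F : Type*} [NormedAddCommGroup F] [NormedSpace ℝ F] (v : X → F)
    {x : X} (hx : x ∈ ball 0 R) : fderivWithin ℝ v (closedBall 0 R) x = fderiv ℝ v x :=
  fderivWithin_of_mem_nhds (Filter.mem_of_superset (isOpen_ball.mem_nhds hx) ball_subset_closedBall)

theorem ContDiffOn.differentiableAt_ball {j : WithTop ℕ∞} (hw : ContDiffOn ℝ j w (closedBall 0 R))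
    (hj : 1 ≤ j) {x : X} (hx : x ∈ ball 0 R) : DifferentiableAt ℝ w x :=
  (hw.contDiffAt (Filter.mem_of_superset (isOpen_ball.mem_nhds hx)
    ball_subset_closedBall)).differentiableAt (by positivity)

theorem hasGradBounds_of_c1HolderNormOn_le (hC : 0 ≤ C)
    (hw : ContDiffOn ℝ 1 w (closedBall 0 R))
    (h : c1HolderNormOn α (closedBall 0 R) w ≤ ENNReal.ofReal C) :
    HasGradBounds α R C C w where
  diff x hx := hw.differentiableAt_ball le_rfl hx
  bound x hx := by
    have h1 : supNormOn (closedBall 0 R) (fderivWithin ℝ w (closedBall 0 R)) ≤ ENNReal.ofReal C :=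
      le_trans (le_trans le_self_add le_add_self) h
    have := norm_le_of_supNormOn_le hC h1 (ball_subset_closedBall hx)
    rwa [fderivWithin_closedBall w hx] at this
  holder x hx y hy := by
    have h1 : holderSeminormOn α (closedBall 0 R) (fderivWithin ℝ w (closedBall 0 R))
        ≤ ENNReal.ofReal C := le_trans (le_trans le_add_self le_add_self) h
    have := norm_sub_le_of_holderSeminormOn_le hC h1 (ball_subset_closedBall hx)
      (ball_subset_closedBall hy)
    rwa [fderivWithin_closedBall w hx, fderivWithin_closedBall w hy] at this

theorem ContDiffOn.differentiableAt_fderiv_ball (hw : ContDiffOn ℝ 2 w (closedBall 0 R))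
    {x : X} (hx : x ∈ ball 0 R) : DifferentiableAt ℝ (fderiv ℝ w) x := by
  have h1 : ContDiffAt ℝ 2 w x := hw.contDiffAt
    (Filter.mem_of_superset (isOpen_ball.mem_nhds hx) ball_subset_closedBall)
  exact (h1.fderiv_right (m := 1) (by norm_num)).differentiableAt (by norm_num)

theorem norm_fderiv_fderiv_le_of_c2NormOn_le (hC : 0 ≤ C)
    (h : c2NormOn (closedBall 0 R) w ≤ ENNReal.ofReal C) {x : X} (hx : x ∈ ball 0 R) :
    ‖fderiv ℝ (fderiv ℝ w) x‖ ≤ C := by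
  have h1 : supNormOn (closedBall 0 R) (fderivWithin ℝ (fderivWithin ℝ w (closedBall 0 R))
      (closedBall 0 R)) ≤ ENNReal.ofReal C := le_trans (le_trans le_add_self le_add_self) h
  have := norm_le_of_supNormOn_le hC h1 (ball_subset_closedBall hx)
  rw [fderivWithin_closedBall _ hx] at this
  have he : fderivWithin ℝ w (closedBall 0 R) =ᶠ[𝓝 x] fderiv ℝ w :=
    Filter.eventuallyEq_of_mem (isOpen_ball.mem_nhds hx) fun y hy => fderivWithin_closedBall w hy
  rwa [he.fderiv_eq] at this

theorem hasGradBounds_of_c2NormOn_le (hC : 0 ≤ C) (hw : ContDiffOn ℝ 2 w (closedBall 0 R))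
    (h : c2NormOn (closedBall 0 R) w ≤ ENNReal.ofReal C) :
    HasGradBounds 1 R C C w where
  diff x hx := hw.differentiableAt_ball one_le_two hx
  bound x hx := by
    have h1 : supNormOn (closedBall 0 R) (fderivWithin ℝ w (closedBall 0 R)) ≤ ENNReal.ofReal C :=
      le_trans (le_trans le_self_add le_add_self) h
    have := norm_le_of_supNormOn_le hC h1 (ball_subset_closedBall hx)
    rwa [fderivWithin_closedBall w hx] at this
  holder x hx y hy := by
    rw [Real.rpow_one]
    exact (convex_ball (0 : X) R).norm_image_sub_le_of_norm_fderiv_le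
      (fun z hz => hw.differentiableAt_fderiv_ball hz)
      (fun z hz => norm_fderiv_fderiv_le_of_c2NormOn_le hC h hz) hy hx

theorem abs_le_of_c1HolderNormOn_le (hC : 0 ≤ C)
    (h : c1HolderNormOn α (closedBall 0 R) w ≤ ENNReal.ofReal C) {x : X} (hx : x ∈ ball 0 R) :
    |w x| ≤ C :=
  norm_le_of_supNormOn_le hC (le_trans le_self_add h) (ball_subset_closedBall hx)

theorem abs_le_of_c2NormOn_le (hC : 0 ≤ C)
    (h : c2NormOn (closedBall 0 R) w ≤ ENNReal.ofReal C) {x : X} (hx : x ∈ ball 0 R) :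
    |w x| ≤ C :=
  norm_le_of_supNormOn_le hC (le_trans le_self_add h) (ball_subset_closedBall hx)

end Gradient

/-! ### Boundary points of a supergraph -/

section Boundary

variable {m : ℕ}

/-- The graph of `v` translated so that the point over `x₀` becomes the origin. -/
def centredAt (v : EuclideanSpace ℝ (Fin m) → ℝ) (x₀ x : EuclideanSpace ℝ (Fin m)) : ℝ :=
  v (x₀ + x) - v x₀

variable {E : Set (EuclideanSpace ℝ (Fin (m + 1)))} {q q₁ : EuclideanSpace ℝ (Fin (m + 1))}
  {L : EuclideanSpace ℝ (Fin (m + 1)) ≃ₗᵢ[ℝ] EuclideanSpace ℝ (Fin (m + 1))}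
  {r h Λ M α δ s : ℝ} {v : EuclideanSpace ℝ (Fin m) → ℝ}

theorem IsSupergraphIn.mem_iff (hE : IsSupergraphIn E q L r h v)
    {z : EuclideanSpace ℝ (Fin (m + 1))} (hz : z ∈ graphCylinder m r h) :
    q + L z ∈ E ↔ v (horiz z) < vert z := by
  have := Set.ext_iff.1 hE z
  constructor
  · intro h1
    exact (this.1 ⟨h1, hz⟩).2.1
  · intro h1
    exact (this.2 ⟨hz.1, h1, hz.2.2⟩).1

/-- Boundary points inside the cylinder lie on the graph. -/
theorem IsSupergraphIn.eq_of_mem_frontier (hE : IsSupergraphIn E q L r h v)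
    {z : EuclideanSpace ℝ (Fin (m + 1))} (hz : z ∈ graphCylinder m r h)
    (hv : ContinuousAt v (horiz z)) (hf : q + L z ∈ frontier E) : v (horiz z) = vert z := by
  have hcont : ContinuousAt (fun z => v (horiz z)) z :=
    ContinuousAt.comp (f := horiz) hv continuous_horiz.continuousAt
  have hvert : ContinuousAt (vert : EuclideanSpace ℝ (Fin (m + 1)) → ℝ) z :=
    continuous_vert.continuousAt
  have hcyl := (isOpen_graphCylinder r h).mem_nhds hz
  let e : EuclideanSpace ℝ (Fin (m + 1)) ≃ₜ EuclideanSpace ℝ (Fin (m + 1)) :=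
    L.toHomeomorph.trans (Homeomorph.addLeft q)
  have hf' : z ∈ frontier (e ⁻¹' E) := by
    rw [← e.preimage_frontier]; exact hf
  rcases lt_trichotomy (v (horiz z)) (vert z) with hlt | heq | hgt
  · exfalso
    have h1 : e ⁻¹' E ∈ 𝓝 z := by
      filter_upwards [hcont.eventually_lt hvert hlt, hcyl] with y hy hyc
      exact (hE.mem_iff hyc).2 hy
    exact hf'.2 (mem_interior_iff_mem_nhds.2 h1)
  · exact heq
  · exfalso
    have h1 : (e ⁻¹' E)ᶜ ∈ 𝓝 z := by
      filter_upwards [hvert.eventually_lt hcont hgt, hcyl] with y hy hyc hyE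
      exact absurd ((hE.mem_iff hyc).1 hyE) (not_lt.2 hy.le)
    have h2 := mem_interior_iff_mem_nhds.2 h1
    rw [interior_compl] at h2
    exact h2 hf'.1

/-- Around a boundary point near the centre, the set is again the supergraph of a function. -/
theorem IsSupergraphIn.isCentredGraph (hE : IsSupergraphIn E q L (2 * r) (2 * h) v)
    (hv : HasGradBounds α (2 * r) Λ M v) (hΛ : 0 < Λ) (hδr : δ ≤ r) (hδh : Λ * δ ≤ h)
    (hq₁ : q₁ ∈ frontier E) (hx : ‖horiz (L.symm (q₁ - q))‖ < r)
    (ht : |vert (L.symm (q₁ - q))| < h) :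
    IsCentredGraph {z | q₁ + L z ∈ E} δ h (centredAt v (horiz (L.symm (q₁ - q)))) := by
  set z₀ := L.symm (q₁ - q) with hz₀
  have hqz : q + L z₀ = q₁ := by simp [hz₀]
  have hr : 0 < r := (norm_nonneg _).trans_lt hx
  have hh : 0 < h := (abs_nonneg _).trans_lt ht
  have hx2 : horiz z₀ ∈ ball (0 : EuclideanSpace ℝ (Fin m)) (2 * r) :=
    mem_ball_zero_iff.2 (by linarith)
  rw [abs_lt] at ht
  have hz₀c : z₀ ∈ graphCylinder m (2 * r) (2 * h) := ⟨hx2, by linarith, by linarith⟩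
  have hgraph : v (horiz z₀) = vert z₀ :=
    hE.eq_of_mem_frontier hz₀c (hv.diff _ hx2).continuousAt (by rwa [hqz])
  have hmem : ∀ x ∈ ball (0 : EuclideanSpace ℝ (Fin m)) δ, horiz z₀ + x ∈
      ball (0 : EuclideanSpace ℝ (Fin m)) (2 * r) := by
    intro x hxδ
    rw [mem_ball_zero_iff] at hxδ ⊢
    linarith [norm_add_le (horiz z₀) x]
  constructor
  · intro z hz
    have hzc : z₀ + z ∈ graphCylinder m (2 * r) (2 * h) := by
      refine ⟨?_, ?_, ?_⟩
      · rw [horiz_add]; exact hmem _ hz.1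
      · rw [vert_add]; linarith [hz.2.1]
      · rw [vert_add]; linarith [hz.2.2]
    have h1 := hE.mem_iff hzc
    rw [map_add, ← add_assoc, hqz, horiz_add, vert_add] at h1
    rw [Set.mem_ofPred_eq, h1, centredAt, hgraph]
    constructor <;> intro h <;> linarith
  · intro x hxδ
    have h1 := hv.abs_sub_le hx2 (hmem x hxδ)
    rw [add_sub_cancel_left] at h1
    have h2 : Λ * ‖x‖ < Λ * δ := by
      gcongr; exact mem_ball_zero_iff.1 hxδ
    exact h1.trans_lt (by linarith)

theorem abs_centredAt_add_neg_le (hv : HasGradBounds α (2 * r) Λ M v) (hα0 : 0 ≤ α) (hα : α ≤ 1)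
    (hM : 0 ≤ M) (hδr : δ ≤ r) {x₀ : EuclideanSpace ℝ (Fin m)} (hx₀ : ‖x₀‖ < r) :
    ∀ x ∈ ball 0 δ, |centredAt v x₀ x + centredAt v x₀ (-x)| ≤ 2 * M * ‖x‖ ^ (1 + α) := by
  intro x hx
  have := hv.abs_second_difference_le hα0 hα hM hx₀
    (z := x) ((mem_ball_zero_iff.1 hx).trans_le hδr)
  convert this using 2
  simp only [centredAt]
  ring

/-- The fractional curvature at a boundary point as the sum of a band integral and a far field. -/
theorem IsSupergraphIn.tendsto_truncFracCurvature (hEm : NullMeasurableSet E volume)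
    (hE : IsSupergraphIn E q L (2 * r) (2 * h) v)
    (hv : HasGradBounds α (2 * r) Λ M v) (hα0 : 0 ≤ α) (hα : α ≤ 1) (hΛ : 0 < Λ) (hM : 0 ≤ M)
    (hδ : 0 < δ) (hδr : δ ≤ r) (hδh : Λ * δ ≤ h)
    (hq₁ : q₁ ∈ frontier E) (hx : ‖horiz (L.symm (q₁ - q))‖ < r)
    (ht : |vert (L.symm (q₁ - q))| < h) (hs : s ∈ Ioo 0 α) :
    Tendsto (truncFracCurvature s E q₁) (𝓝[>] 0)
      (𝓝 ((∫ x in ball 0 δ, bandIntegral (((m + 1 : ℕ) : ℝ) + s)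
          (centredAt v (horiz (L.symm (q₁ - q)))) x)
        + ∫ z in (graphCylinder m δ h)ᶜ,
          sideSign {z | q₁ + L z ∈ E} z * (‖z‖ ^ (((m + 1 : ℕ) : ℝ) + s))⁻¹)) := by
  rw [truncFracCurvature_rigidMotion s E q₁ L]
  exact _root_.tendsto_truncFracCurvature (nullMeasurableSet_rigidMotion hEm q₁ L)
    (hE.isCentredGraph hv hΛ hδr hδh hq₁ hx ht) hδ ((abs_nonneg _).trans_lt ht) (by linarith)
    (by positivity) (abs_centredAt_add_neg_le hv hα0 hα hM hδr hx) hs.2 hs.1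

end Boundary

/-! ### Convergence of the fractional curvature in the `C^{1,α}` sense -/

section HolderConvergence

variable {m : ℕ}

theorem bandIntegral_zero (p : ℝ) {φ : EuclideanSpace ℝ (Fin m) → ℝ} (h : φ 0 = 0) :
    bandIntegral p φ 0 = 0 := by
  simp [bandIntegral, h]

theorem continuous_integral_kernel {x : EuclideanSpace ℝ (Fin m)} (hx : x ≠ 0) :
    Continuous fun y : ℝ × ℝ => ∫ t in 0..y.2, (√(‖x‖ ^ 2 + t ^ 2) ^ y.1)⁻¹ := by
  have hpos : ∀ t : ℝ, 0 < √(‖x‖ ^ 2 + t ^ 2) := fun t =>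
    Real.sqrt_pos.2 (by have := norm_pos_iff.2 hx; positivity)
  refine intervalIntegral.continuous_parametric_intervalIntegral_of_continuous
    (f := fun (y : ℝ × ℝ) (t : ℝ) => (√(‖x‖ ^ 2 + t ^ 2) ^ y.1)⁻¹) ?_ continuous_snd
  refine Continuous.inv₀ ?_ (fun y => (Real.rpow_pos_of_pos (hpos _) _).ne')
  refine Continuous.rpow (by fun_prop) (by fun_prop) fun y => Or.inl (hpos _).ne'

theorem bandIntegral_eq_sub {x : EuclideanSpace ℝ (Fin m)} (hx : x ≠ 0) (p : ℝ)
    (φ : EuclideanSpace ℝ (Fin m) → ℝ) :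
    bandIntegral p φ x = (∫ t in 0..φ x, (√(‖x‖ ^ 2 + t ^ 2) ^ p)⁻¹)
      - ∫ t in 0..(-φ (-x)), (√(‖x‖ ^ 2 + t ^ 2) ^ p)⁻¹ := by
  have hpos : ∀ t : ℝ, 0 < √(‖x‖ ^ 2 + t ^ 2) := fun t =>
    Real.sqrt_pos.2 (by have := norm_pos_iff.2 hx; positivity)
  have hc : Continuous fun t : ℝ => (√(‖x‖ ^ 2 + t ^ 2) ^ p)⁻¹ :=
    Continuous.inv₀ (Continuous.rpow (by fun_prop) continuous_const fun t => Or.inl (hpos t).ne')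
      (fun t => (Real.rpow_pos_of_pos (hpos _) _).ne')
  rw [intervalIntegral.integral_interval_sub_left (hc.intervalIntegrable _ _)
    (hc.intervalIntegrable _ _), bandIntegral]

theorem tendsto_bandIntegral {φk : ℕ → EuclideanSpace ℝ (Fin m) → ℝ}
    {φ : EuclideanSpace ℝ (Fin m) → ℝ} {pk : ℕ → ℝ} {p : ℝ} {x : EuclideanSpace ℝ (Fin m)}
    (hx : x ≠ 0) (hpk : Tendsto pk atTop (𝓝 p)) (h1 : Tendsto (fun k => φk k x) atTop (𝓝 (φ x)))
    (h2 : Tendsto (fun k => φk k (-x)) atTop (𝓝 (φ (-x)))) :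
    Tendsto (fun k => bandIntegral (pk k) (φk k) x) atTop (𝓝 (bandIntegral p φ x)) := by
  simp only [bandIntegral_eq_sub hx]
  exact (((continuous_integral_kernel hx).tendsto (p, φ x)).comp (hpk.prodMk_nhds h1)).sub
    (((continuous_integral_kernel hx).tendsto (p, -φ (-x))).comp (hpk.prodMk_nhds h2.neg))

/-- Dominated convergence, with bound `M ‖x‖ ^ (1 + α - p₁)` for a fixed exponent `p₁` between `p`
and `m + 1 + α`, which works for all large `k` at once. -/
theorem tendsto_integral_bandIntegral {φk : ℕ → EuclideanSpace ℝ (Fin m) → ℝ}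
    {φ : EuclideanSpace ℝ (Fin m) → ℝ} {pk : ℕ → ℝ} {p α M δ : ℝ} (hα : 0 < 1 + α) (hM : 0 ≤ M)
    (hδ : δ ≤ 1) (hpk : Tendsto pk atTop (𝓝 p)) (hp0 : 0 < p) (hp : p < m + 1 + α)
    (hmeas : ∀ᶠ k in atTop,
      AEStronglyMeasurable (bandIntegral (pk k) (φk k)) (volume.restrict (ball 0 δ)))
    (hbd : ∀ᶠ k in atTop, ∀ x ∈ ball 0 δ, |φk k x + φk k (-x)| ≤ M * ‖x‖ ^ (1 + α))
    (hφ0 : ∀ k, φk k 0 = 0) (hφ : φ 0 = 0)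
    (hlim : ∀ x ∈ ball 0 δ, Tendsto (fun k => φk k x) atTop (𝓝 (φ x))) :
    Tendsto (fun k => ∫ x in ball 0 δ, bandIntegral (pk k) (φk k) x) atTop
      (𝓝 (∫ x in ball 0 δ, bandIntegral p φ x)) := by
  set p₁ := (p + (m + 1 + α)) / 2 with hp₁
  have hpk1 : ∀ᶠ k in atTop, pk k ∈ Ioo 0 p₁ :=
    hpk.eventually (Ioo_mem_nhds hp0 (by rw [hp₁]; linarith))
  refine tendsto_integral_filter_of_dominated_convergence (fun x => M * ‖x‖ ^ (1 + α - p₁)) hmeas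
    ?_ ((integrableOn_ball_rpow_norm (by rw [hp₁]; linarith)).const_mul M) ?_
  · filter_upwards [hpk1, hbd] with k hk1 hk2
    filter_upwards [ae_restrict_mem measurableSet_ball] with x hx
    rcases eq_or_ne x 0 with rfl | hx0
    · rw [bandIntegral_zero _ (hφ0 k), norm_zero]
      positivity
    · refine (abs_bandIntegral_le hk1.1 hα hM hk2 hx).trans ?_
      gcongr ?_ * ?_
      exact Real.rpow_le_rpow_of_exponent_ge (norm_pos_iff.2 hx0)
        ((mem_ball_zero_iff.1 hx).le.trans hδ) (by linarith [hk1.2])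
  · filter_upwards [ae_restrict_mem measurableSet_ball] with x hx
    rcases eq_or_ne x 0 with rfl | hx0
    · simp only [bandIntegral_zero _ (hφ0 _), bandIntegral_zero _ hφ]
      exact tendsto_const_nhds
    · exact tendsto_bandIntegral hx0 hpk (hlim x hx) (hlim (-x) (by simpa using hx))

theorem tendsto_centredAt {uk : ℕ → EuclideanSpace ℝ (Fin m) → ℝ} {u : EuclideanSpace ℝ (Fin m) → ℝ}
    {R : ℝ} (hR : 0 < R) (hu : ∀ x ∈ ball 0 R, ContinuousAt u x)
    (huk : TendstoUniformlyOn uk u atTop (ball 0 R)) {xk : ℕ → EuclideanSpace ℝ (Fin m)}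
    (hxk : Tendsto xk atTop (𝓝 0)) {x : EuclideanSpace ℝ (Fin m)} (hx : x ∈ ball 0 R) :
    Tendsto (fun k => centredAt (uk k) (xk k) x) atTop (𝓝 (centredAt u 0 x)) := by
  have key : ∀ y ∈ ball (0 : EuclideanSpace ℝ (Fin m)) R,
      Tendsto (fun k => uk k (xk k + y)) atTop (𝓝 (u (0 + y))) := by
    intro y hy
    have hy' : 0 + y ∈ ball (0 : EuclideanSpace ℝ (Fin m)) R := by simpa using hy
    refine huk.tendsto_comp (hu _ hy').continuousWithinAt ?_
    rw [isOpen_ball.nhdsWithin_eq hy']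
    exact hxk.add_const y
  have h0 := key 0 (mem_ball_self hR)
  simp only [add_zero] at h0
  exact (key x hx).sub h0

theorem tendsto_localCoordinate {n : ℕ} {qk : ℕ → EuclideanSpace ℝ (Fin n)}
    {q : EuclideanSpace ℝ (Fin n)} (L : EuclideanSpace ℝ (Fin n) ≃ₗᵢ[ℝ] EuclideanSpace ℝ (Fin n))
    (hq : Tendsto qk atTop (𝓝 q)) : Tendsto (fun k => L.symm (qk k - q)) atTop (𝓝 0) := by
  have := (L.symm.continuous.tendsto _).comp (hq.sub_const q)
  rwa [sub_self, map_zero] at this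

/-- Bounds which are uniform along a sequence converging in `C^{1,α}` or in `C²`. -/
theorem exists_uniform_gradBounds {X : Type*} [NormedAddCommGroup X] [NormedSpace ℝ X]
    {α R : ℝ} {u : X → ℝ} {uk : ℕ → X → ℝ} {N : (X → ℝ) → ℝ≥0∞}
    (hgrad : ∀ (w : X → ℝ) (C : ℝ), 0 ≤ C → (w = u ∨ ∃ k, w = uk k - u) → N w ≤ ENNReal.ofReal C →
      HasGradBounds α R C C w)
    (hval : ∀ (w : X → ℝ) (C : ℝ), 0 ≤ C → N w ≤ ENNReal.ofReal C → ∀ x ∈ ball (0 : X) R, |w x| ≤ C)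
    (hu : N u < ∞) (hconv : Tendsto (fun k => N (uk k - u)) atTop (𝓝 0)) :
    TendstoUniformlyOn uk u atTop (ball 0 R) ∧
      ∃ Λ, 0 < Λ ∧ HasGradBounds α R Λ Λ u ∧ ∀ᶠ k in atTop, HasGradBounds α R Λ Λ (uk k) := by
  constructor
  · rw [Metric.tendstoUniformlyOn_iff]
    intro ε hε
    have h1 : ∀ᶠ k in atTop, N (uk k - u) ≤ ENNReal.ofReal (ε / 2) :=
      hconv.eventually (Iic_mem_nhds (ENNReal.ofReal_pos.2 (half_pos hε)))
    filter_upwards [h1] with k hk x hx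
    have := hval _ _ (half_pos hε).le hk x hx
    rw [dist_comm, Real.dist_eq]
    exact this.trans_lt (half_lt_self hε)
  · have h0 : HasGradBounds α R (N u).toReal (N u).toReal u :=
      hgrad u _ ENNReal.toReal_nonneg (Or.inl rfl) (by rw [ENNReal.ofReal_toReal hu.ne])
    have hpos : 0 ≤ (N u).toReal := ENNReal.toReal_nonneg
    refine ⟨(N u).toReal + 1, by positivity, h0.mono (by linarith) (by linarith), ?_⟩
    have h1 : ∀ᶠ k in atTop, N (uk k - u) ≤ ENNReal.ofReal 1 :=
      hconv.eventually (Iic_mem_nhds (ENNReal.ofReal_pos.2 one_pos))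
    filter_upwards [h1] with k hk
    have := h0.add (hgrad _ 1 zero_le_one (Or.inr ⟨k, rfl⟩) hk)
    rwa [add_sub_cancel] at this

theorem fracCurvature_eq_of_tendsto {n : ℕ} {s : ℝ} {E : Set (EuclideanSpace ℝ (Fin n))}
    {q : EuclideanSpace ℝ (Fin n)} {I : ℝ}
    (h : Tendsto (truncFracCurvature s E q) (𝓝[>] 0) (𝓝 I)) : fracCurvature s E q = I :=
  h.limUnder_eq

/-- Continuity of the fractional curvature along sets converging in the `C^{1,α}` sense. -/
theorem fracCurvature_tendsto_of_convergesC1Holder {α : ℝ} (hα : 0 < α) (hα1 : α ≤ 1)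
    {E : Set (EuclideanSpace ℝ (Fin (m + 1)))} {Ek : ℕ → Set (EuclideanSpace ℝ (Fin (m + 1)))}
    {q : EuclideanSpace ℝ (Fin (m + 1))} {qk : ℕ → EuclideanSpace ℝ (Fin (m + 1))}
    {s : ℝ} {sk : ℕ → ℝ} (hE : NullMeasurableSet E volume)
    (hEk : ∀ k, NullMeasurableSet (Ek k) volume) (hqE : q ∈ frontier E)
    (hconv : ConvergesC1Holder α Ek E q) (hqk : ∀ k, qk k ∈ frontier (Ek k))
    (hq : Tendsto qk atTop (𝓝 q)) (hs : s ∈ Ioo 0 α) (hsk : ∀ k, sk k ∈ Ioo 0 α)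
    (hlim : Tendsto sk atTop (𝓝 s)) :
    FracCurvatureExists s E q ∧
      (∀ᶠ k in atTop, FracCurvatureExists (sk k) (Ek k) (qk k)) ∧
      Tendsto (fun k => fracCurvature (sk k) (Ek k) (qk k)) atTop (𝓝 (fracCurvature s E q)) := by
  obtain ⟨hmeas, L, r, h, u, uk, hr, hh, hu0, hu, hEu, huk, hEuk, hN⟩ := hconv
  obtain ⟨hunif, Λ, hΛ, hgu, hguk⟩ := exists_uniform_gradBounds (α := α) (R := 2 * r)
    (N := c1HolderNormOn α (closedBall 0 (2 * r)))
    (fun w C hC hw hle => hasGradBounds_of_c1HolderNormOn_le hC (by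
      rcases hw with rfl | ⟨k, rfl⟩
      · exact hu.1
      · exact (huk k).1.sub hu.1) hle)
    (fun w C hC hle x hx => abs_le_of_c1HolderNormOn_le hC hle hx) hu.2 hN
  set δ := min (min r 1) (h / Λ) with hδdef
  have hδ : 0 < δ := lt_min (lt_min hr one_pos) (div_pos hh hΛ)
  have hδr : δ ≤ r := (min_le_left _ _).trans (min_le_left _ _)
  have hδ1 : δ ≤ 1 := (min_le_left _ _).trans (min_le_right _ _)
  have hδh : Λ * δ ≤ h := by
    have : δ ≤ h / Λ := min_le_right _ _
    rwa [le_div_iff₀ hΛ, mul_comm] at this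
  have hz := tendsto_localCoordinate L hq
  have hx : Tendsto (fun k => horiz (L.symm (qk k - q))) atTop (𝓝 0) := by
    have := (continuous_horiz.tendsto _).comp hz
    rwa [horiz_zero] at this
  have ht : Tendsto (fun k => vert (L.symm (qk k - q))) atTop (𝓝 0) := by
    have := (continuous_vert.tendsto _).comp hz
    rwa [vert_zero] at this
  have hxr : ∀ᶠ k in atTop, ‖horiz (L.symm (qk k - q))‖ < r := by
    have := hx.norm
    rw [norm_zero] at this
    exact this.eventually (Iio_mem_nhds hr)
  have hth : ∀ᶠ k in atTop, |vert (L.symm (qk k - q))| < h := by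
    have := ht.abs
    rw [abs_zero] at this
    exact this.eventually (Iio_mem_nhds hh)
  have hz0 : L.symm (q - q) = 0 := by rw [sub_self, map_zero]
  have hE0 := hEu.tendsto_truncFracCurvature hE hgu hα.le hα1 hΛ hΛ.le hδ hδr hδh hqE
    (by rw [hz0, horiz_zero, norm_zero]; exact hr) (by rw [hz0, vert_zero, abs_zero]; exact hh) hs
  rw [hz0, horiz_zero] at hE0
  have hEk0 := (hguk.and (hxr.and hth)).mono fun k hk =>
    (hEuk k).tendsto_truncFracCurvature (hEk k) hk.1 hα.le hα1 hΛ hΛ.le hδ hδr hδh (hqk k)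
      hk.2.1 hk.2.2 (hsk k)
  refine ⟨⟨_, hE0⟩, hEk0.mono fun k hk => ⟨_, hk⟩, ?_⟩
  rw [fracCurvature_eq_of_tendsto hE0]
  have hpk : Tendsto (fun k => ((m + 1 : ℕ) : ℝ) + sk k) atTop (𝓝 (((m + 1 : ℕ) : ℝ) + s)) :=
    hlim.const_add _
  have hnear := tendsto_integral_bandIntegral (m := m) (α := α) (M := 2 * Λ) (δ := δ)
    (φk := fun k => centredAt (uk k) (horiz (L.symm (qk k - q)))) (φ := centredAt u 0)
    (by linarith) (by positivity) hδ1 hpk (by have := hs.1; positivity)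
    (by push_cast; linarith [hs.2])
    (by
      filter_upwards [hguk, hxr, hth] with k hk1 hk2 hk3
      have := (hsk k).1
      exact (integrableOn_bandIntegral (nullMeasurableSet_rigidMotion (hEk k) (qk k) L)
        ((hEuk k).isCentredGraph hk1 hΛ hδr hδh (hqk k) hk2 hk3) (by linarith) (by positivity)
        (abs_centredAt_add_neg_le hk1 hα.le hα1 hΛ.le hδr hk2) (hsk k).2
        (by positivity)).aestronglyMeasurable)
    (by
      filter_upwards [hguk, hxr] with k hk1 hk2
      exact abs_centredAt_add_neg_le hk1 hα.le hα1 hΛ.le hδr hk2)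
    (fun k => by simp [centredAt]) (by simp [centredAt])
    (fun x hxδ => tendsto_centredAt (by positivity)
      (fun y hy => (hgu.diff y hy).continuousAt) hunif hx
      (ball_subset_ball (by linarith) hxδ))
  have hfar := tendsto_farField (n := m + 1) L hE hEk hmeas hq hpk (by linarith [hs.1])
    (C := graphCylinder m δ h) (lt_min hδ hh)
    (ball_subset_graphCylinder (min_le_left _ _) (min_le_right _ _)) (isOpen_graphCylinder δ h)
    (convex_graphCylinder δ h)
  refine (hnear.add hfar).congr' ?_
  filter_upwards [hEk0] with k hk
  exact (fracCurvature_eq_of_tendsto hk).symm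

end HolderConvergence

/-! ### Polar coordinates and concentration at the origin -/

section Polar

theorem integral_volumeIoiPow (k : ℕ) (f : ℝ → ℝ) :
    ∫ r : Ioi (0 : ℝ), f r ∂(Measure.volumeIoiPow k) = ∫ r in Ioi (0 : ℝ), r ^ k * f r := by
  simp only [Measure.volumeIoiPow, ENNReal.ofReal]
  rw [integral_withDensity_eq_integral_smul,
    integral_subtype_comap measurableSet_Ioi fun a ↦ Real.toNNReal (a ^ k) • f a,
    setIntegral_congr_fun measurableSet_Ioi fun x hx ↦ ?_]
  · rw [NNReal.smul_def, Real.coe_toNNReal _ (pow_nonneg (le_of_lt hx) _), smul_eq_mul]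
  · exact (measurable_subtype_coe.pow_const _).real_toNNReal

theorem integrable_volumeIoiPow_iff (k : ℕ) (f : ℝ → ℝ) :
    Integrable (fun r : Ioi (0 : ℝ) => f r) (Measure.volumeIoiPow k)
      ↔ IntegrableOn (fun r => r ^ k * f r) (Ioi 0) := by
  rw [Measure.volumeIoiPow, integrable_withDensity_iff_integrable_smul',
    integrableOn_iff_comap_subtypeVal measurableSet_Ioi]
  · refine integrable_congr (Eventually.of_forall ?_)
    rintro ⟨x, hx : 0 < x⟩
    simp (disch := positivity) [ENNReal.toReal_ofReal]
  · fun_prop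
  · simp

variable {m : ℕ} {f : EuclideanSpace ℝ (Fin m) → ℝ}

theorem integrable_polar (hf : Integrable f) :
    Integrable (fun y : sphere (0 : EuclideanSpace ℝ (Fin m)) 1 × Ioi (0 : ℝ) =>
        f ((y.2 : ℝ) • (y.1 : EuclideanSpace ℝ (Fin m))))
      ((volume : Measure (EuclideanSpace ℝ (Fin m))).toSphere.prod
        (Measure.volumeIoiPow (m - 1))) := by
  have hmp := (volume : Measure (EuclideanSpace ℝ (Fin m))).measurePreserving_homeomorphUnitSphereProd
  rw [finrank_euclideanSpace_fin] at hmp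
  rw [← hmp.integrable_comp_emb (Homeomorph.measurableEmbedding _)]
  have h1 : Integrable (fun x : ({0}ᶜ : Set (EuclideanSpace ℝ (Fin m))) => f x)
      (volume.comap Subtype.val) :=
    (integrableOn_iff_comap_subtypeVal (measurableSet_singleton _).compl).1 hf.integrableOn
  refine h1.congr (Eventually.of_forall fun x => ?_)
  have hx : ‖(x : EuclideanSpace ℝ (Fin m))‖ ≠ 0 := norm_ne_zero_iff.2 x.2
  simp [smul_smul, hx]

theorem integral_polar [Nontrivial (EuclideanSpace ℝ (Fin m))] (hf : Integrable f) :
    ∫ x, f x = ∫ θ : sphere (0 : EuclideanSpace ℝ (Fin m)) 1,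
      (∫ r in Ioi (0 : ℝ), r ^ (m - 1) * f (r • (θ : EuclideanSpace ℝ (Fin m))))
        ∂(volume : Measure (EuclideanSpace ℝ (Fin m))).toSphere := by
  have hmp := (volume : Measure (EuclideanSpace ℝ (Fin m))).measurePreserving_homeomorphUnitSphereProd
  rw [finrank_euclideanSpace_fin] at hmp
  have h1 : ∫ x, f x = ∫ x : ({0}ᶜ : Set (EuclideanSpace ℝ (Fin m))), f x
      ∂(volume.comap Subtype.val) := by
    rw [integral_subtype_comap (measurableSet_singleton _).compl f, restrict_compl_singleton]
  have h2 := hmp.integral_comp (Homeomorph.measurableEmbedding _)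
    (fun y : sphere (0 : EuclideanSpace ℝ (Fin m)) 1 × Ioi (0 : ℝ) =>
        f ((y.2 : ℝ) • (y.1 : EuclideanSpace ℝ (Fin m))))
  rw [integral_prod _ (integrable_polar hf)] at h2
  rw [h1]
  simp only [← integral_volumeIoiPow (m - 1) fun r => f (r • _)]
  rw [← h2]
  refine integral_congr_ae (Eventually.of_forall fun x => ?_)
  have hx : ‖(x : EuclideanSpace ℝ (Fin m))‖ ≠ 0 := norm_ne_zero_iff.2 x.2
  simp [smul_smul, hx]

theorem integrable_polar_slice (hf : Integrable f) :
    ∀ᵐ θ : sphere (0 : EuclideanSpace ℝ (Fin m)) 1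
      ∂(volume : Measure (EuclideanSpace ℝ (Fin m))).toSphere,
      IntegrableOn (fun r : ℝ => r ^ (m - 1) * f (r • (θ : EuclideanSpace ℝ (Fin m)))) (Ioi 0) := by
  filter_upwards [(integrable_polar hf).prod_right_ae] with θ hθ
  exact (integrable_volumeIoiPow_iff _ fun r => f (r • (θ : EuclideanSpace ℝ (Fin m)))).1 hθ

theorem aestronglyMeasurable_polar_slice (hf : Integrable f) :
    AEStronglyMeasurable (fun θ : sphere (0 : EuclideanSpace ℝ (Fin m)) 1 =>
      ∫ r in Ioi (0 : ℝ), r ^ (m - 1) * f (r • (θ : EuclideanSpace ℝ (Fin m))))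
      (volume : Measure (EuclideanSpace ℝ (Fin m))).toSphere := by
  simp only [← integral_volumeIoiPow (m - 1) fun r => f (r • _)]
  exact (integrable_polar hf).integral_prod_left.aestronglyMeasurable

theorem setIntegral_rpow_neg {s δ : ℝ} (hs : s < 1) (hδ : 0 < δ) :
    IntegrableOn (fun r : ℝ => r ^ (-s)) (Ioo 0 δ) ∧
      (1 - s) * ∫ r in Ioo 0 δ, r ^ (-s) = δ ^ (1 - s) := by
  constructor
  · rw [intervalIntegral.integrableOn_Ioo_rpow_iff hδ]; linarith
  · rw [← integral_Ioc_eq_integral_Ioo, ← intervalIntegral.integral_of_le hδ.le,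
      integral_rpow (Or.inl (by linarith)), Real.zero_rpow (by linarith), sub_zero,
      show -s + 1 = 1 - s by ring]
    have : 1 - s ≠ 0 := by linarith
    field_simp

/-- As `s ↑ 1` the measures `(1 - s) r^{-s} dr` on `(0, δ)` concentrate at `0`. -/
theorem tendsto_concentration {sk : ℕ → ℝ} (hsk : ∀ k, sk k ∈ Ioo (0 : ℝ) 1)
    (hlim : Tendsto sk atTop (𝓝 1)) {δ M G : ℝ} (hδ : 0 < δ) {g : ℕ → ℝ → ℝ}
    (hbd : ∀ᶠ k in atTop, ∀ r ∈ Ioo 0 δ, |g k r| ≤ M)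
    (hint : ∀ᶠ k in atTop, IntegrableOn (fun r => r ^ (-sk k) * g k r) (Ioo 0 δ))
    (hg : Tendsto (fun y : ℕ × ℝ => g y.1 y.2) (atTop ×ˢ 𝓝[>] 0) (𝓝 G)) :
    Tendsto (fun k => (1 - sk k) * ∫ r in Ioo 0 δ, r ^ (-sk k) * g k r) atTop (𝓝 G) := by
  have hs0 : Tendsto (fun k => 1 - sk k) atTop (𝓝 0) := by
    simpa using hlim.const_sub 1
  have hδs : Tendsto (fun k => δ ^ (1 - sk k)) atTop (𝓝 1) := by
    have := (Real.continuousAt_const_rpow hδ.ne').tendsto.comp hs0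
    rwa [Real.rpow_zero] at this
  -- it suffices to treat `g - G`
  suffices hsuff : Tendsto (fun k => (1 - sk k) * ∫ r in Ioo 0 δ, r ^ (-sk k) * (g k r - G)) atTop
      (𝓝 0) by
    have h1 := hsuff.add (hδs.const_mul G)
    rw [zero_add, mul_one] at h1
    refine h1.congr' ?_
    filter_upwards [hint] with k hk
    obtain ⟨hi, hv⟩ := setIntegral_rpow_neg (hsk k).2 hδ
    simp only [mul_sub]
    rw [integral_sub hk (hi.mul_const G), integral_mul_const, ← hv]
    ring
  rw [Metric.tendsto_nhds]
  intro ε hε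
  have hev : ∀ᶠ y in atTop ×ˢ 𝓝[>] (0 : ℝ), |g y.1 y.2 - G| < ε / 4 := by
    have := (Metric.tendsto_nhds.1 hg) (ε / 4) (by positivity)
    simpa [Real.dist_eq] using this
  obtain ⟨pa, hpa, pb, hpb, hp⟩ := eventually_prod_iff.1 hev
  obtain ⟨η₀, hη₀, hη₀'⟩ := mem_nhdsGT_iff_exists_Ioo_subset.1 hpb
  rw [mem_Ioi] at hη₀
  set η := min η₀ 1 with hη
  have hηpos : 0 < η := lt_min hη₀ one_pos
  set c := |M| + |G| with hc
  have hc0 : 0 ≤ c := by positivity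
  have hlim2 : Tendsto (fun k => ε / 4 * δ ^ (1 - sk k) + (1 - sk k) * (c * η⁻¹ * δ)) atTop
      (𝓝 (ε / 4 * 1 + 0 * (c * η⁻¹ * δ))) := (hδs.const_mul _).add (hs0.mul_const _)
  have hlim3 := hlim2.eventually (Iio_mem_nhds (show ε / 4 * 1 + 0 * (c * η⁻¹ * δ) < ε by linarith))
  filter_upwards [hbd, hpa, hlim3] with k hk1 hk2 hk3
  obtain ⟨hi, hv⟩ := setIntegral_rpow_neg (hsk k).2 hδ
  have h1s : 0 < 1 - sk k := by linarith [(hsk k).2]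
  have hpt : ∀ r ∈ Ioo (0 : ℝ) δ, ‖r ^ (-sk k) * (g k r - G)‖ ≤ ε / 4 * r ^ (-sk k) + c * η⁻¹ := by
    intro r hr
    have hr0 : 0 ≤ r ^ (-sk k) := Real.rpow_nonneg hr.1.le _
    rw [norm_mul, Real.norm_of_nonneg hr0, Real.norm_eq_abs]
    rcases lt_or_ge r η with hrη | hrη
    · have h2 : |g k r - G| < ε / 4 := hp hk2 (hη₀' ⟨hr.1, hrη.trans_le (min_le_left _ _)⟩)
      have h3 : 0 ≤ c * η⁻¹ := by positivity
      nlinarith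
    · have h2 : |g k r - G| ≤ c :=
        (abs_sub _ _).trans (add_le_add ((hk1 r hr).trans (le_abs_self _)) le_rfl)
      have h3 : r ^ (-sk k) ≤ η⁻¹ := by
        calc r ^ (-sk k) ≤ η ^ (-sk k) :=
              Real.rpow_le_rpow_of_nonpos hηpos hrη (by linarith [(hsk k).1])
          _ ≤ η ^ (-1 : ℝ) := Real.rpow_le_rpow_of_exponent_ge hηpos (min_le_right _ _)
              (by linarith [(hsk k).2])
          _ = η⁻¹ := Real.rpow_neg_one η
      calc r ^ (-sk k) * |g k r - G| ≤ η⁻¹ * c := by gcongr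
        _ ≤ ε / 4 * r ^ (-sk k) + c * η⁻¹ := by
          have : 0 ≤ ε / 4 * r ^ (-sk k) := by positivity
          linarith
  have hbound := norm_integral_le_of_norm_le (μ := volume.restrict (Ioo 0 δ))
    ((hi.const_mul (ε / 4)).add (integrableOn_const (C := c * η⁻¹) measure_Ioo_lt_top.ne))
    ((ae_restrict_iff' measurableSet_Ioo).2 (Eventually.of_forall hpt))
  have heval : ∫ r in Ioo 0 δ, (ε / 4 * r ^ (-sk k) + c * η⁻¹)
      = ε / 4 * (∫ r in Ioo 0 δ, r ^ (-sk k)) + c * η⁻¹ * δ := by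
    rw [integral_add (hi.const_mul (ε / 4)) (integrableOn_const measure_Ioo_lt_top.ne),
      integral_const_mul, setIntegral_const, Real.volume_real_Ioo_of_le hδ.le, smul_eq_mul]
    ring
  rw [dist_zero_right, norm_mul, Real.norm_of_nonneg h1s.le]
  calc (1 - sk k) * ‖∫ r in Ioo 0 δ, r ^ (-sk k) * (g k r - G)‖
      ≤ (1 - sk k) * (ε / 4 * (∫ r in Ioo 0 δ, r ^ (-sk k)) + c * η⁻¹ * δ) := by
        rw [← heval]
        exact mul_le_mul_of_nonneg_left hbound h1s.le
    _ = ε / 4 * δ ^ (1 - sk k) + (1 - sk k) * (c * η⁻¹ * δ) := by rw [← hv]; ring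
    _ < ε := hk3

/-- The limit of `(1 - s) ∫_{B_δ} f` as `s ↑ 1`, for functions which are asymptotically homogeneous
of degree `1 - m - s` at the origin of `ℝ^m`. -/
theorem tendsto_integral_asymptotically_homogeneous (hm : 0 < m) {sk : ℕ → ℝ}
    (hsk : ∀ k, sk k ∈ Ioo (0 : ℝ) 1) (hlim : Tendsto sk atTop (𝓝 1)) {δ M : ℝ} (hδ : 0 < δ)
    {fk : ℕ → EuclideanSpace ℝ (Fin m) → ℝ} {Ψ : EuclideanSpace ℝ (Fin m) → ℝ}
    (hint : ∀ᶠ k in atTop, IntegrableOn (fk k) (ball 0 δ))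
    (hbd : ∀ᶠ k in atTop, ∀ x ∈ ball 0 δ, |fk k x| ≤ M * ‖x‖ ^ (1 - m - sk k))
    (hΨ : ∀ θ : EuclideanSpace ℝ (Fin m), ‖θ‖ = 1 →
      Tendsto (fun y : ℕ × ℝ => y.2 ^ (m - 1 + sk y.1) * fk y.1 (y.2 • θ)) (atTop ×ˢ 𝓝[>] 0)
        (𝓝 (Ψ θ))) :
    Tendsto (fun k => (1 - sk k) * ∫ x in ball 0 δ, fk k x) atTop
      (𝓝 (∫ θ : sphere (0 : EuclideanSpace ℝ (Fin m)) 1, Ψ θ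
        ∂(volume : Measure (EuclideanSpace ℝ (Fin m))).toSphere)) := by
  have : Nonempty (Fin m) := ⟨⟨0, hm⟩⟩
  have : Nontrivial (EuclideanSpace ℝ (Fin m)) := inferInstance
  -- the radial integrals
  set I : ℕ → sphere (0 : EuclideanSpace ℝ (Fin m)) 1 → ℝ := fun k θ =>
    (1 - sk k) * ∫ r in Ioi (0 : ℝ), r ^ (m - 1) *
      (ball 0 δ).indicator (fk k) (r • (θ : EuclideanSpace ℝ (Fin m))) with hI
  have hnorm : ∀ θ : sphere (0 : EuclideanSpace ℝ (Fin m)) 1,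
      ‖(θ : EuclideanSpace ℝ (Fin m))‖ = 1 := fun θ => by simp
  have hind : ∀ᶠ k in atTop, Integrable ((ball 0 δ).indicator (fk k)) :=
    hint.mono fun k hk => (integrable_indicator_iff measurableSet_ball).2 hk
  have hslice : ∀ k, ∀ θ : sphere (0 : EuclideanSpace ℝ (Fin m)) 1,
      (fun r : ℝ => (Ioi (0 : ℝ)).indicator (fun r => r ^ (m - 1) *
        (ball 0 δ).indicator (fk k) (r • (θ : EuclideanSpace ℝ (Fin m)))) r)
      = (Ioo 0 δ).indicator (fun r => r ^ (-sk k) * (r ^ (m - 1 + sk k) *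
        fk k (r • (θ : EuclideanSpace ℝ (Fin m))))) := by
    intro k θ
    funext r
    by_cases hr : 0 < r
    · have hmem : r • (θ : EuclideanSpace ℝ (Fin m)) ∈ ball (0 : EuclideanSpace ℝ (Fin m)) δ
          ↔ r ∈ Ioo 0 δ := by
        rw [mem_ball_zero_iff, norm_smul, hnorm, mul_one, Real.norm_of_nonneg hr.le]
        exact ⟨fun h => ⟨hr, h⟩, fun h => h.2⟩
      rw [indicator_of_mem (mem_Ioi.2 hr)]
      by_cases hrδ : r ∈ Ioo 0 δ
      · rw [indicator_of_mem hrδ, indicator_of_mem (hmem.2 hrδ), ← mul_assoc,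
          ← Real.rpow_add hr, ← Real.rpow_natCast, Nat.cast_pred hm]
        congr 2
        ring
      · rw [indicator_of_notMem hrδ, indicator_of_notMem (fun h => hrδ (hmem.1 h)), mul_zero]
    · rw [indicator_of_notMem (fun h => hr (mem_Ioi.1 h)),
        indicator_of_notMem (fun h => hr h.1)]
  have hIeq : ∀ k θ, I k θ = (1 - sk k) * ∫ r in Ioo 0 δ, r ^ (-sk k) * (r ^ (m - 1 + sk k) *
        fk k (r • (θ : EuclideanSpace ℝ (Fin m)))) := by
    intro k θ
    rw [hI]
    simp only
    rw [← integral_indicator measurableSet_Ioi, hslice, integral_indicator measurableSet_Ioo]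
  have hgbd : ∀ᶠ k in atTop, ∀ θ : sphere (0 : EuclideanSpace ℝ (Fin m)) 1, ∀ r ∈ Ioo 0 δ,
      |r ^ (m - 1 + sk k) * fk k (r • (θ : EuclideanSpace ℝ (Fin m)))| ≤ M := by
    filter_upwards [hbd] with k hk θ r hr
    have hrn : ‖r • (θ : EuclideanSpace ℝ (Fin m))‖ = r := by
      rw [norm_smul, hnorm, mul_one, Real.norm_of_nonneg hr.1.le]
    have h1 := hk (r • (θ : EuclideanSpace ℝ (Fin m)))
      (mem_ball_zero_iff.2 (by rw [hrn]; exact hr.2))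
    rw [hrn] at h1
    have hpos : 0 < r ^ (m - 1 + sk k) := Real.rpow_pos_of_pos hr.1 _
    rw [abs_mul, abs_of_pos hpos]
    calc r ^ (m - 1 + sk k) * |fk k (r • (θ : EuclideanSpace ℝ (Fin m)))|
        ≤ r ^ (m - 1 + sk k) * (M * r ^ (1 - m - sk k)) := by gcongr
      _ = M * (r ^ (m - 1 + sk k) * r ^ (1 - m - sk k)) := by ring
      _ = M := by
        rw [← Real.rpow_add hr.1, show (m : ℝ) - 1 + sk k + (1 - m - sk k) = 0 by ring,
          Real.rpow_zero, mul_one]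
  have hpolar : ∀ᶠ k in atTop, (1 - sk k) * ∫ x in ball 0 δ, fk k x
      = ∫ θ, I k θ ∂(volume : Measure (EuclideanSpace ℝ (Fin m))).toSphere := by
    filter_upwards [hind] with k hk
    rw [← integral_indicator measurableSet_ball, integral_polar hk, integral_const_mul]
  have hsliceint : ∀ᵐ θ : sphere (0 : EuclideanSpace ℝ (Fin m)) 1
      ∂(volume : Measure (EuclideanSpace ℝ (Fin m))).toSphere, ∀ᶠ k in atTop,
      IntegrableOn (fun r => r ^ (-sk k) * (r ^ (m - 1 + sk k) *
        fk k (r • (θ : EuclideanSpace ℝ (Fin m))))) (Ioo 0 δ) := by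
    obtain ⟨K, hK⟩ := eventually_atTop.1 hind
    have h1 : ∀ᵐ θ : sphere (0 : EuclideanSpace ℝ (Fin m)) 1
        ∂(volume : Measure (EuclideanSpace ℝ (Fin m))).toSphere, ∀ k : ℕ, K ≤ k →
        IntegrableOn (fun r : ℝ => r ^ (m - 1) *
          (ball 0 δ).indicator (fk k) (r • (θ : EuclideanSpace ℝ (Fin m)))) (Ioi 0) := by
      rw [ae_all_iff]
      intro k
      by_cases hk : K ≤ k
      · filter_upwards [integrable_polar_slice (hK k hk)] with θ hθ _
        exact hθ
      · exact Eventually.of_forall fun θ h => absurd h hk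
    filter_upwards [h1] with θ hθ
    filter_upwards [eventually_ge_atTop K] with k hk
    have h2 := (integrable_indicator_iff measurableSet_Ioi).2 (hθ k hk)
    rw [show (Ioi (0 : ℝ)).indicator _ = _ from hslice k θ] at h2
    exact (integrable_indicator_iff measurableSet_Ioo).1 h2
  have hδs : ∀ k, δ ^ (1 - sk k) ≤ max δ 1 := by
    intro k
    have h1 : 0 ≤ 1 - sk k := by linarith [(hsk k).2]
    calc δ ^ (1 - sk k) ≤ (max δ 1) ^ (1 - sk k) :=
          Real.rpow_le_rpow hδ.le (le_max_left _ _) h1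
      _ ≤ (max δ 1) ^ (1 : ℝ) :=
          Real.rpow_le_rpow_of_exponent_le (le_max_right _ _) (by linarith [(hsk k).1])
      _ = max δ 1 := Real.rpow_one _
  refine Tendsto.congr' (hpolar.mono fun k hk => hk.symm) ?_
  refine tendsto_integral_filter_of_dominated_convergence (fun _ => |M| * max δ 1) ?_ ?_
    (integrable_const _) ?_
  · filter_upwards [hind] with k hk
    exact (aestronglyMeasurable_polar_slice hk).const_mul _
  · filter_upwards [hgbd] with k hk
    refine Eventually.of_forall fun θ => ?_
    obtain ⟨hi, hv⟩ := setIntegral_rpow_neg (hsk k).2 hδ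
    have h1s : 0 < 1 - sk k := by linarith [(hsk k).2]
    have h2 := norm_integral_le_of_norm_le (μ := volume.restrict (Ioo 0 δ))
      (f := fun r => r ^ (-sk k) * (r ^ (m - 1 + sk k) * fk k (r • (θ : EuclideanSpace ℝ (Fin m)))))
      (hi.mul_const |M|) ((ae_restrict_iff' measurableSet_Ioo).2 (Eventually.of_forall
        fun r hr => by
          have hr0 : 0 ≤ r ^ (-sk k) := Real.rpow_nonneg hr.1.le _
          rw [norm_mul, Real.norm_of_nonneg hr0, Real.norm_eq_abs]
          exact mul_le_mul_of_nonneg_left ((hk θ r hr).trans (le_abs_self _)) hr0))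
    rw [integral_mul_const] at h2
    rw [hIeq, norm_mul, Real.norm_of_nonneg h1s.le]
    calc _ ≤ (1 - sk k) * ((∫ r in Ioo 0 δ, r ^ (-sk k)) * |M|) :=
          mul_le_mul_of_nonneg_left h2 h1s.le
      _ = |M| * δ ^ (1 - sk k) := by rw [← hv]; ring
      _ ≤ |M| * max δ 1 := by gcongr; exact hδs k
  · filter_upwards [hsliceint] with θ hθ
    simp only [hIeq]
    exact tendsto_concentration hsk hlim hδ (hgbd.mono fun k hk => hk θ) hθ (hΨ θ (hnorm θ))

end Polar

/-! ### The band integral near a point of a `C²` graph -/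

section SecondOrder

theorem continuous_slopeKernel :
    Continuous fun y : ℝ × ℝ => (√(1 + y.1 ^ 2) ^ y.2)⁻¹ := by
  have hpos : ∀ t : ℝ, 0 < √(1 + t ^ 2) := fun t => Real.sqrt_pos.2 (by positivity)
  refine Continuous.inv₀ ?_ (fun y => (Real.rpow_pos_of_pos (hpos _) _).ne')
  exact Continuous.rpow (by fun_prop) (by fun_prop) fun y => Or.inl (hpos _).ne'

/-- If the end points converge to the same limit, a rescaled integral converges to the limit of the
rescaled length times the limit of the integrand. -/
theorem tendsto_rescaled_integral {ι : Type*} {l : Filter ι} {a b c p : ι → ℝ} {β p₀ D : ℝ}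
    (ha : Tendsto a l (𝓝 β)) (hb : Tendsto b l (𝓝 β)) (hp : Tendsto p l (𝓝 p₀))
    (hD : Tendsto (fun i => c i * (b i - a i)) l (𝓝 D)) :
    Tendsto (fun i => c i * ∫ τ in a i..b i, (√(1 + τ ^ 2) ^ p i)⁻¹) l
      (𝓝 (D * (√(1 + β ^ 2) ^ p₀)⁻¹)) := by
  set κ : ℝ × ℝ → ℝ := fun y => (√(1 + y.1 ^ 2) ^ y.2)⁻¹ with hκ
  have hκc : Continuous κ := continuous_slopeKernel
  have hκ1 : ∀ q : ℝ, Continuous fun τ : ℝ => κ (τ, q) := fun q =>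
    hκc.comp (continuous_id.prodMk continuous_const)
  suffices h : Tendsto (fun i => c i * ∫ τ in a i..b i, (κ (τ, p i) - κ (β, p₀))) l (𝓝 0) by
    have h1 := h.add (hD.mul_const (κ (β, p₀)))
    rw [zero_add] at h1
    refine h1.congr fun i => ?_
    rw [intervalIntegral.integral_sub ((hκ1 _).intervalIntegrable _ _)
      (continuous_const.intervalIntegrable _ _), intervalIntegral.integral_const, smul_eq_mul]
    ring
  rw [Metric.tendsto_nhds]
  intro ε hε
  set ε' := ε / (2 * (|D| + 1)) with hε'
  have hε'pos : 0 < ε' := by positivity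
  obtain ⟨d, hd, hκd⟩ := Metric.continuousAt_iff.1 (hκc.continuousAt (x := (β, p₀))) ε' hε'pos
  have hDabs : ∀ᶠ i in l, |c i * (b i - a i)| < |D| + 1 :=
    hD.abs.eventually (Iio_mem_nhds (by linarith))
  filter_upwards [(Metric.tendsto_nhds.1 ha) d hd, (Metric.tendsto_nhds.1 hb) d hd,
    (Metric.tendsto_nhds.1 hp) d hd, hDabs] with i hai hbi hpi hDi
  have hmem : ∀ τ ∈ uIoc (a i) (b i), ‖κ (τ, p i) - κ (β, p₀)‖ ≤ ε' := by
    intro τ hτ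
    have hτ' : τ ∈ ball β d := (convex_ball β d).ordConnected.uIcc_subset (mem_ball.2 hai)
      (mem_ball.2 hbi) (uIoc_subset_uIcc hτ)
    rw [← dist_eq_norm]
    refine (hκd ?_).le
    rw [Prod.dist_eq]
    exact max_lt hτ' hpi
  have h1 := intervalIntegral.norm_integral_le_of_norm_le_const hmem
  rw [dist_zero_right, norm_mul]
  calc ‖c i‖ * ‖∫ τ in a i..b i, (κ (τ, p i) - κ (β, p₀))‖
      ≤ ‖c i‖ * (ε' * |b i - a i|) := by gcongr
    _ = ε' * |c i * (b i - a i)| := by rw [abs_mul, Real.norm_eq_abs]; ring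
    _ ≤ ε' * (|D| + 1) := by gcongr
    _ = ε / 2 := by rw [hε']; field_simp
    _ < ε := half_lt_self hε

variable {m : ℕ}

theorem bandIntegral_smul {θ : EuclideanSpace ℝ (Fin m)} (hθ : ‖θ‖ = 1) {r : ℝ} (hr : 0 < r) (p : ℝ)
    (φ : EuclideanSpace ℝ (Fin m) → ℝ) :
    bandIntegral p φ (r • θ) = r ^ (1 - p) *
      ∫ τ in (-φ (-(r • θ)) / r)..(φ (r • θ) / r), (√(1 + τ ^ 2) ^ p)⁻¹ := by
  have hn : ‖r • θ‖ = r := by rw [norm_smul, hθ, mul_one, Real.norm_of_nonneg hr.le]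
  have hk : ∀ t : ℝ, (√(‖r • θ‖ ^ 2 + t ^ 2) ^ p)⁻¹
      = r ^ (-p) * (√(1 + (t / r) ^ 2) ^ p)⁻¹ := by
    intro t
    have : ‖r • θ‖ ^ 2 + t ^ 2 = r ^ 2 * (1 + (t / r) ^ 2) := by
      rw [hn]; field_simp
    rw [this, Real.sqrt_mul (sq_nonneg r), Real.sqrt_sq hr.le,
      Real.mul_rpow hr.le (Real.sqrt_nonneg _), mul_inv, Real.rpow_neg hr.le]
  rw [bandIntegral]
  simp only [hk]
  rw [intervalIntegral.integral_const_mul,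
    intervalIntegral.integral_comp_div (fun τ : ℝ => (√(1 + τ ^ 2) ^ p)⁻¹) hr.ne', smul_eq_mul,
    ← mul_assoc]
  congr 1
  rw [Real.rpow_sub hr, Real.rpow_one, Real.rpow_neg hr.le, inv_mul_eq_div]

/-- Uniform smallness near the origin, extracted from a limit along a product filter. -/
theorem exists_ball_of_tendsto_prod {X Y : Type*} [NormedAddCommGroup X] [NormedAddCommGroup Y]
    {f : ℕ → X → Y} {B : Y} (h : Tendsto (fun y : ℕ × X => f y.1 y.2) (atTop ×ˢ 𝓝 0) (𝓝 B))
    {ε : ℝ} (hε : 0 < ε) :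
    ∃ η > 0, ∀ᶠ k in atTop, ∀ x ∈ ball (0 : X) η, ‖f k x - B‖ ≤ ε := by
  have h1 := (Metric.tendsto_nhds.1 h) ε hε
  obtain ⟨pa, hpa, pb, hpb, hp⟩ := eventually_prod_iff.1 h1
  obtain ⟨η, hη, hη'⟩ := Metric.mem_nhds_iff.1 hpb
  refine ⟨η, hη, hpa.mono fun k hk x hx => ?_⟩
  rw [← dist_eq_norm]
  exact (hp hk (hη' hx)).le

theorem tendsto_prod_of_uniform {X Y : Type*} [NormedAddCommGroup X] [NormedAddCommGroup Y]
    {fk : ℕ → X → Y} {f : X → Y} {R : ℝ} (hR : 0 < R) (hf : ContinuousAt f 0)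
    (h : ∀ ε > 0, ∀ᶠ k in atTop, ∀ x ∈ ball (0 : X) R, ‖fk k x - f x‖ ≤ ε) :
    Tendsto (fun y : ℕ × X => fk y.1 y.2) (atTop ×ˢ 𝓝 0) (𝓝 (f 0)) := by
  rw [Metric.tendsto_nhds]
  intro ε hε
  have h1 : ∀ᶠ x in 𝓝 (0 : X), x ∈ ball (0 : X) R ∧ dist (f x) (f 0) < ε / 2 :=
    Filter.Eventually.and (ball_mem_nhds (0 : X) hR) ((Metric.tendsto_nhds.1 hf) _ (half_pos hε))
  filter_upwards [(h (ε / 2) (half_pos hε)).prod_mk h1] with y hy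
  have h2 := hy.1 y.2 hy.2.1
  rw [← dist_eq_norm] at h2
  linarith [dist_triangle (fk y.1 y.2) (f y.2) (f 0), hy.2.2]

variable {uk : ℕ → EuclideanSpace ℝ (Fin m) → ℝ} {xk : ℕ → EuclideanSpace ℝ (Fin m)} {R : ℝ}
  {B : EuclideanSpace ℝ (Fin m) →L[ℝ] ℝ}
  {A : EuclideanSpace ℝ (Fin m) →L[ℝ] EuclideanSpace ℝ (Fin m) →L[ℝ] ℝ}

theorem eventually_prod_small {η : ℝ} (hη : 0 < η) (hxk : Tendsto xk atTop (𝓝 0)) {P : ℕ → Prop}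
    (hP : ∀ᶠ k in atTop, P k) :
    ∀ᶠ y : ℕ × ℝ in atTop ×ˢ 𝓝[>] 0, (P y.1 ∧ ‖xk y.1‖ < η) ∧ y.2 ∈ Ioo 0 η := by
  have h1 : ∀ᶠ k in atTop, ‖xk k‖ < η := by
    have := hxk.norm
    rw [norm_zero] at this
    exact this.eventually (Iio_mem_nhds hη)
  exact (hP.and h1).prod_mk (Ioo_mem_nhdsGT hη)

theorem tendsto_difference_quotient (hR : 0 < R)
    (hdiff : ∀ᶠ k in atTop, ∀ x ∈ ball 0 R, DifferentiableAt ℝ (uk k) x)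
    (hB : Tendsto (fun y : ℕ × EuclideanSpace ℝ (Fin m) => fderiv ℝ (uk y.1) y.2) (atTop ×ˢ 𝓝 0)
      (𝓝 B))
    (hxk : Tendsto xk atTop (𝓝 0)) {θ : EuclideanSpace ℝ (Fin m)} (hθ : ‖θ‖ = 1) :
    Tendsto (fun y : ℕ × ℝ => centredAt (uk y.1) (xk y.1) (y.2 • θ) / y.2) (atTop ×ˢ 𝓝[>] 0)
      (𝓝 (B θ)) := by
  rw [Metric.tendsto_nhds]
  intro ε hε
  obtain ⟨η, hη, hk⟩ := exists_ball_of_tendsto_prod (f := fun k => fderiv ℝ (uk k)) hB (half_pos hε)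
  have hηR : 0 < min η R / 2 := half_pos (lt_min hη hR)
  filter_upwards [eventually_prod_small hηR hxk (hk.and hdiff)] with ⟨k, r⟩ ⟨⟨⟨h1, h2⟩, h3⟩, h4⟩
  simp only at h1 h2 h3 h4 ⊢
  have hsub : ∀ x : EuclideanSpace ℝ (Fin m), x ∈ ball 0 (min η R) → x ∈ ball 0 η ∧ x ∈ ball 0 R :=
    fun x hx => ⟨ball_subset_ball (min_le_left _ _) hx, ball_subset_ball (min_le_right _ _) hx⟩
  have hn : ‖r • θ‖ = r := by rw [norm_smul, hθ, mul_one, Real.norm_of_nonneg h4.1.le]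
  have hx1 : xk k ∈ ball (0 : EuclideanSpace ℝ (Fin m)) (min η R) :=
    mem_ball_zero_iff.2 (by linarith)
  have hx2 : xk k + r • θ ∈ ball (0 : EuclideanSpace ℝ (Fin m)) (min η R) :=
    mem_ball_zero_iff.2 (by linarith [norm_add_le (xk k) (r • θ), h4.2])
  have h5 := (convex_ball (0 : EuclideanSpace ℝ (Fin m)) (min η R)).norm_image_sub_le_of_norm_fderiv_le'
    (𝕜 := ℝ) (f := uk k) (φ := B) (C := ε / 2) (fun x hx => h2 x (hsub x hx).2)
    (fun x hx => h1 x (hsub x hx).1) hx1 hx2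
  rw [add_sub_cancel_left, hn, map_smul, smul_eq_mul] at h5
  rw [Real.dist_eq, centredAt, show (uk k (xk k + r • θ) - uk k (xk k)) / r - B θ
    = (uk k (xk k + r • θ) - uk k (xk k) - r * B θ) / r by have := h4.1.ne'; field_simp,
    abs_div, abs_of_pos h4.1, div_lt_iff₀ h4.1]
  calc _ ≤ ε / 2 * r := h5
    _ < ε * r := by have := h4.1; gcongr; linarith

theorem tendsto_second_difference_quotient (hR : 0 < R)
    (hdiff : ∀ᶠ k in atTop, ∀ x ∈ ball 0 R,
      DifferentiableAt ℝ (uk k) x ∧ DifferentiableAt ℝ (fderiv ℝ (uk k)) x)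
    (hA : Tendsto (fun y : ℕ × EuclideanSpace ℝ (Fin m) => fderiv ℝ (fderiv ℝ (uk y.1)) y.2)
      (atTop ×ˢ 𝓝 0) (𝓝 A))
    (hxk : Tendsto xk atTop (𝓝 0)) {θ : EuclideanSpace ℝ (Fin m)} (hθ : ‖θ‖ = 1) :
    Tendsto (fun y : ℕ × ℝ => (centredAt (uk y.1) (xk y.1) (y.2 • θ)
        + centredAt (uk y.1) (xk y.1) (-(y.2 • θ))) / y.2 ^ 2) (atTop ×ˢ 𝓝[>] 0)
      (𝓝 (A θ θ)) := by
  rw [Metric.tendsto_nhds]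
  intro ε hε
  obtain ⟨η, hη, hk⟩ := exists_ball_of_tendsto_prod (f := fun k => fderiv ℝ (fderiv ℝ (uk k))) hA (show 0 < ε / 4 by positivity)
  have hηR : 0 < min η R / 2 := half_pos (lt_min hη hR)
  filter_upwards [eventually_prod_small hηR hxk (hk.and hdiff)] with ⟨k, r⟩ ⟨⟨⟨h1, h2⟩, h3⟩, h4⟩
  simp only at h1 h2 h3 h4 ⊢
  have hsub : ∀ x : EuclideanSpace ℝ (Fin m), x ∈ ball 0 (min η R) → x ∈ ball 0 η ∧ x ∈ ball 0 R :=
    fun x hx => ⟨ball_subset_ball (min_le_left _ _) hx, ball_subset_ball (min_le_right _ _) hx⟩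
  have hn : ‖r • θ‖ = r := by rw [norm_smul, hθ, mul_one, Real.norm_of_nonneg h4.1.le]
  have hmem : ∀ τ ∈ Icc (-1 : ℝ) 1, xk k + τ • r • θ ∈
      ball (0 : EuclideanSpace ℝ (Fin m)) (min η R) := by
    intro τ hτ
    have := HasGradBounds.add_smul_mem_ball (r := min η R / 2) h3 (by rw [hn]; exact h4.2) hτ
    rwa [mul_div_cancel₀ _ (two_ne_zero)] at this
  have h5 := abs_symm_second_difference_sub_le (f := uk k) (x := xk k) (z := r • θ)
    (c := r ^ 2 * A θ θ) (K := ε / 2 * r ^ 2)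
    (fun τ hτ => (h2 _ (hsub _ (hmem τ hτ)).2).1) (fun τ hτ => ?_)
  · rw [Real.dist_eq, show (centredAt (uk k) (xk k) (r • θ) + centredAt (uk k) (xk k) (-(r • θ)))
      / r ^ 2 - A θ θ = (uk k (xk k + r • θ) + uk k (xk k + -(r • θ)) - 2 * uk k (xk k)
        - r ^ 2 * A θ θ) / r ^ 2 by have := h4.1.ne'; simp only [centredAt]; field_simp; ring,
      abs_div, abs_of_pos (pow_pos h4.1 2), div_lt_iff₀ (pow_pos h4.1 2)]
    calc _ ≤ ε / 2 * r ^ 2 := h5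
      _ < ε * r ^ 2 := by have := h4.1; gcongr; linarith
  · have hy1 := hmem τ ⟨by linarith [hτ.1], hτ.2⟩
    have hy2 := hmem (-τ) ⟨by linarith [hτ.2], by linarith [hτ.1]⟩
    have h6 := (convex_ball (0 : EuclideanSpace ℝ (Fin m))
      (min η R)).norm_image_sub_le_of_norm_fderiv_le'
      (𝕜 := ℝ) (f := fderiv ℝ (uk k)) (φ := A) (C := ε / 4)
      (fun x hx => (h2 x (hsub x hx).2).2) (fun x hx => h1 x (hsub x hx).1) hy2 hy1
    have hdiff' : xk k + τ • r • θ - (xk k + (-τ) • r • θ) = (2 * τ) • r • θ := by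
      rw [add_sub_add_left_eq_sub, ← sub_smul]; ring_nf
    rw [hdiff', norm_smul, hn, Real.norm_of_nonneg (by linarith [hτ.1])] at h6
    set T := fderiv ℝ (uk k) (xk k + τ • r • θ) - fderiv ℝ (uk k) (xk k + (-τ) • r • θ)
      - A ((2 * τ) • r • θ) with hT
    have h7 : fderiv ℝ (uk k) (xk k + τ • r • θ) (r • θ)
        - fderiv ℝ (uk k) (xk k + (-τ) • r • θ) (r • θ) - 2 * τ * (r ^ 2 * A θ θ) = T (r • θ) := by
      simp only [hT, sub_apply, map_smul, smul_apply, smul_eq_mul]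
      ring
    rw [h7]
    calc |T (r • θ)| ≤ ‖T‖ * ‖r • θ‖ := T.le_opNorm _
      _ ≤ ε / 4 * (2 * τ * r) * r := by rw [hn]; have := h4.1; gcongr
      _ = ε / 2 * r ^ 2 * τ := by ring
      _ ≤ ε / 2 * r ^ 2 * 1 := by gcongr; exact hτ.2
      _ = ε / 2 * r ^ 2 := mul_one _

theorem tendsto_bandIntegral_radial (hR : 0 < R)
    (hdiff : ∀ᶠ k in atTop, ∀ x ∈ ball 0 R,
      DifferentiableAt ℝ (uk k) x ∧ DifferentiableAt ℝ (fderiv ℝ (uk k)) x)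
    (hB : Tendsto (fun y : ℕ × EuclideanSpace ℝ (Fin m) => fderiv ℝ (uk y.1) y.2) (atTop ×ˢ 𝓝 0)
      (𝓝 B))
    (hA : Tendsto (fun y : ℕ × EuclideanSpace ℝ (Fin m) => fderiv ℝ (fderiv ℝ (uk y.1)) y.2)
      (atTop ×ˢ 𝓝 0) (𝓝 A))
    (hxk : Tendsto xk atTop (𝓝 0)) {sk : ℕ → ℝ} (hsk : Tendsto sk atTop (𝓝 1))
    {θ : EuclideanSpace ℝ (Fin m)} (hθ : ‖θ‖ = 1) :
    Tendsto (fun y : ℕ × ℝ => y.2 ^ (m - 1 + sk y.1) *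
        bandIntegral (((m + 1 : ℕ) : ℝ) + sk y.1) (centredAt (uk y.1) (xk y.1)) (y.2 • θ))
      (atTop ×ˢ 𝓝[>] 0) (𝓝 (A θ θ * (√(1 + B θ ^ 2) ^ ((m : ℝ) + 2))⁻¹)) := by
  have hb := tendsto_difference_quotient hR (hdiff.mono fun k hk x hx => (hk x hx).1) hB hxk hθ
  have ha := (tendsto_difference_quotient hR (hdiff.mono fun k hk x hx => (hk x hx).1) hB hxk
    (θ := -θ) (by rwa [norm_neg])).neg
  simp only [map_neg, neg_neg, smul_neg, ← neg_div] at ha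
  have hD := tendsto_second_difference_quotient hR hdiff hA hxk hθ
  have hp : Tendsto (fun y : ℕ × ℝ => ((m + 1 : ℕ) : ℝ) + sk y.1) (atTop ×ˢ 𝓝[>] 0)
      (𝓝 ((m : ℝ) + 2)) := by
    have := (hsk.comp (tendsto_fst (f := atTop) (g := 𝓝[>] (0 : ℝ)))).const_add ((m + 1 : ℕ) : ℝ)
    rwa [show ((m + 1 : ℕ) : ℝ) + 1 = m + 2 by push_cast; ring] at this
  have h := tendsto_rescaled_integral (c := fun y : ℕ × ℝ => y.2⁻¹) ha hb hp (D := A θ θ) (by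
    refine hD.congr fun y => ?_
    rcases eq_or_ne y.2 0 with h0 | h0
    · simp [h0]
    · field_simp
      ring)
  refine h.congr' ?_
  have hpos : ∀ᶠ y : ℕ × ℝ in atTop ×ˢ 𝓝[>] 0, 0 < y.2 :=
    (tendsto_snd (f := (atTop : Filter ℕ)) (g := 𝓝[>] (0 : ℝ))).eventually self_mem_nhdsWithin
  filter_upwards [hpos] with y hy
  rw [bandIntegral_smul hθ hy, ← mul_assoc, ← Real.rpow_add hy,
    show (m : ℝ) - 1 + sk y.1 + (1 - (((m + 1 : ℕ) : ℝ) + sk y.1)) = -1 by push_cast; ring,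
    Real.rpow_neg_one]

end SecondOrder

/-! ### An integral over the sphere and the mean curvature -/

section MeanCurvature

variable {m : ℕ}

/-- The sum `∑ i, A(e_i, e_i)` over the standard basis: the trace of a bilinear form. -/
def bilinTrace (A : EuclideanSpace ℝ (Fin m) →L[ℝ] EuclideanSpace ℝ (Fin m) →L[ℝ] ℝ) : ℝ :=
  ∑ i, A (EuclideanSpace.single i 1) (EuclideanSpace.single i 1)

theorem sum_smul_single (x : EuclideanSpace ℝ (Fin m)) :
    ∑ i, x i • EuclideanSpace.single i (1 : ℝ) = x := by
  simpa using (EuclideanSpace.basisFun (Fin m) ℝ).sum_repr x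

theorem bilin_apply_self (A : EuclideanSpace ℝ (Fin m) →L[ℝ] EuclideanSpace ℝ (Fin m) →L[ℝ] ℝ)
    (x : EuclideanSpace ℝ (Fin m)) :
    A x x = ∑ i, ∑ j, A (EuclideanSpace.single i 1) (EuclideanSpace.single j 1) * (x i * x j) := by
  conv_lhs => rw [← sum_smul_single x]
  simp only [map_sum, map_smul, _root_.sum_apply, smul_apply, smul_eq_mul, Finset.mul_sum]
  rw [Finset.sum_comm]
  refine Finset.sum_congr rfl fun i _ => Finset.sum_congr rfl fun j _ => ?_
  ring

theorem integrableOn_coord_mul (i j : Fin m) :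
    IntegrableOn (fun x : EuclideanSpace ℝ (Fin m) => x i * x j) (ball 0 1) := by
  have h : ContinuousOn (fun x : EuclideanSpace ℝ (Fin m) => x i * x j) (closedBall 0 1) := by
    fun_prop
  exact (h.integrableOn_compact (isCompact_closedBall _ _)).mono_set ball_subset_closedBall

theorem setIntegral_ball_isometry (T : EuclideanSpace ℝ (Fin m) ≃ₗᵢ[ℝ] EuclideanSpace ℝ (Fin m))
    (f : EuclideanSpace ℝ (Fin m) → ℝ) :
    ∫ x in ball 0 1, f (T x) = ∫ x in ball 0 1, f x := by
  have h := T.measurePreserving.setIntegral_preimage_emb T.toHomeomorph.measurableEmbedding f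
    (ball 0 1)
  have hpre : T ⁻¹' ball 0 1 = ball 0 1 := by
    ext x; simp
  rwa [hpre] at h

theorem setIntegral_ball_coord_mul_of_ne {i j : Fin m} (hij : i ≠ j) :
    ∫ x in ball (0 : EuclideanSpace ℝ (Fin m)) 1, x i * x j = 0 := by
  let T : EuclideanSpace ℝ (Fin m) ≃ₗᵢ[ℝ] EuclideanSpace ℝ (Fin m) :=
    LinearIsometryEquiv.piLpCongrRight 2 fun l =>
      if l = i then LinearIsometryEquiv.neg ℝ else LinearIsometryEquiv.refl ℝ ℝ
  have h := setIntegral_ball_isometry T fun x => x i * x j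
  have hT : ∀ x, T x i * T x j = -(x i * x j) := by
    intro x
    simp [T, LinearIsometryEquiv.piLpCongrRight_apply, hij.symm]
  simp only [hT] at h
  rw [integral_neg] at h
  linarith

theorem setIntegral_ball_coord_sq (i j : Fin m) :
    ∫ x in ball (0 : EuclideanSpace ℝ (Fin m)) 1, x i * x i
      = ∫ x in ball (0 : EuclideanSpace ℝ (Fin m)) 1, x j * x j := by
  let T : EuclideanSpace ℝ (Fin m) ≃ₗᵢ[ℝ] EuclideanSpace ℝ (Fin m) :=
    LinearIsometryEquiv.piLpCongrLeft 2 ℝ ℝ (Equiv.swap i j)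
  have h := setIntegral_ball_isometry T fun x => x i * x i
  have hT : ∀ x, T x i = x j := by
    intro x
    simp [T, LinearIsometryEquiv.piLpCongrLeft_apply, Equiv.piCongrLeft']
  simp only [hT] at h
  exact h.symm

/-- The average of a quadratic form over the ball. -/
theorem setIntegral_ball_bilin (hm : 0 < m)
    (A : EuclideanSpace ℝ (Fin m) →L[ℝ] EuclideanSpace ℝ (Fin m) →L[ℝ] ℝ) :
    ∫ x in ball 0 1, A x x
      = bilinTrace A / m * ∫ x in ball (0 : EuclideanSpace ℝ (Fin m)) 1, ‖x‖ ^ 2 := by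
  have i₀ : Fin m := ⟨0, hm⟩
  set c := ∫ x in ball (0 : EuclideanSpace ℝ (Fin m)) 1, x i₀ * x i₀ with hc
  have h1 : ∫ x in ball 0 1, A x x = bilinTrace A * c := by
    simp only [bilin_apply_self A]
    rw [integral_finsetSum _ fun i _ => integrable_finsetSum _ fun j _ =>
      (integrableOn_coord_mul i j).const_mul _, bilinTrace, Finset.sum_mul]
    refine Finset.sum_congr rfl fun i _ => ?_
    rw [integral_finsetSum _ fun j _ => (integrableOn_coord_mul i j).const_mul _,
      Finset.sum_eq_single i]
    · rw [integral_const_mul, hc, setIntegral_ball_coord_sq i i₀]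
    · intro j _ hj
      rw [integral_const_mul, setIntegral_ball_coord_mul_of_ne hj.symm, mul_zero]
    · simp
  have h2 : ∫ x in ball (0 : EuclideanSpace ℝ (Fin m)) 1, ‖x‖ ^ 2 = m * c := by
    have : ∀ x : EuclideanSpace ℝ (Fin m), ‖x‖ ^ 2 = ∑ i, x i * x i := by
      intro x
      rw [EuclideanSpace.norm_sq_eq]
      refine Finset.sum_congr rfl fun i _ => ?_
      rw [Real.norm_eq_abs, sq_abs, sq]
    simp only [this]
    rw [integral_finsetSum _ fun i _ => integrableOn_coord_mul i i]
    rw [Finset.sum_congr rfl fun i _ => setIntegral_ball_coord_sq i i₀, ← hc]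
    simp
  have hm' : (m : ℝ) ≠ 0 := by exact_mod_cast hm.ne'
  rw [h1, h2]
  field_simp

/-- The radial integral of a quadratic form over an ellipsoid. -/
theorem integral_radial_ellipsoid (hm : 0 < m) (Q : ℝ) {q : ℝ} (hq : 0 < q) :
    ∫ r in Ioi (0 : ℝ), r ^ (m - 1) * (if r ^ 2 * q < 1 then r ^ 2 * Q else 0)
      = Q * (√q ^ ((m : ℝ) + 2))⁻¹ / (m + 2) := by
  have hsq : 0 < √q := Real.sqrt_pos.2 hq
  have h1 : ∀ r : ℝ, (Ioi (0 : ℝ)).indicator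
      (fun r => r ^ (m - 1) * (if r ^ 2 * q < 1 then r ^ 2 * Q else 0)) r
      = (Ioo 0 (√q)⁻¹).indicator (fun r => Q * r ^ (m + 1)) r := by
    intro r
    by_cases hr : 0 < r
    · have hiff : r ^ 2 * q < 1 ↔ r < (√q)⁻¹ := by
        rw [lt_inv_comm₀ hr hsq, Real.sqrt_lt' (inv_pos.2 hr), inv_pow, mul_comm,
          ← lt_div_iff₀ (by positivity), one_div]
      rw [indicator_of_mem (mem_Ioi.2 hr)]
      by_cases hr2 : r < (√q)⁻¹
      · rw [indicator_of_mem (show r ∈ Ioo 0 (√q)⁻¹ from ⟨hr, hr2⟩), if_pos (hiff.2 hr2),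
          show m + 1 = (m - 1) + 2 by omega, pow_add]
        ring
      · rw [indicator_of_notMem (fun h => hr2 h.2), if_neg (fun h => hr2 (hiff.1 h)), mul_zero]
    · rw [indicator_of_notMem (fun h => hr (mem_Ioi.1 h)),
        indicator_of_notMem (fun h => hr h.1)]
  rw [← integral_indicator measurableSet_Ioi]
  simp only [h1]
  rw [integral_indicator measurableSet_Ioo, integral_const_mul, ← integral_Ioc_eq_integral_Ioo,
    ← intervalIntegral.integral_of_le (by positivity), integral_pow,
    show (m : ℝ) + 2 = ((m + 2 : ℕ) : ℝ) by push_cast; ring, Real.rpow_natCast, inv_pow]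
  push_cast
  ring

theorem setIntegral_ball_norm_sq (hm : 0 < m) :
    ∫ x in ball (0 : EuclideanSpace ℝ (Fin m)) 1, ‖x‖ ^ 2 = sphereArea m / (m + 2) := by
  have : Nonempty (Fin m) := ⟨⟨0, hm⟩⟩
  have hint : Integrable ((ball (0 : EuclideanSpace ℝ (Fin m)) 1).indicator fun x => ‖x‖ ^ 2) := by
    rw [integrable_indicator_iff measurableSet_ball]
    have h : ContinuousOn (fun x : EuclideanSpace ℝ (Fin m) => ‖x‖ ^ 2) (closedBall 0 1) := by
      fun_prop
    exact (h.integrableOn_compact (isCompact_closedBall _ _)).mono_set ball_subset_closedBall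
  rw [← integral_indicator measurableSet_ball, integral_polar hint]
  have h1 : ∀ θ : sphere (0 : EuclideanSpace ℝ (Fin m)) 1,
      ∫ r in Ioi (0 : ℝ), r ^ (m - 1) * (ball (0 : EuclideanSpace ℝ (Fin m)) 1).indicator
        (fun x => ‖x‖ ^ 2) (r • (θ : EuclideanSpace ℝ (Fin m))) = 1 / (m + 2) := by
    intro θ
    have h2 := integral_radial_ellipsoid hm 1 one_pos
    rw [Real.sqrt_one, Real.one_rpow, inv_one, mul_one] at h2
    rw [← h2]
    refine setIntegral_congr_fun measurableSet_Ioi fun r hr => ?_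
    have hr' : 0 < r := hr
    have hn : ‖r • (θ : EuclideanSpace ℝ (Fin m))‖ = r := by
      rw [norm_smul, Real.norm_of_nonneg hr'.le]; simp
    simp only [indicator, mem_ball_zero_iff, hn, mul_one, sq_lt_one_iff₀ hr'.le]
  simp only [h1]
  rw [integral_const, smul_eq_mul, sphereArea]
  ring

/-- The mean curvature of a graph in terms of the first two derivatives. -/
theorem graphMeanCurvature_eq {u : EuclideanSpace ℝ (Fin m) → ℝ}
    (hu : DifferentiableAt ℝ (fderiv ℝ u) 0) :
    graphMeanCurvature u = 1 / (m : ℝ) *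
      ((√(1 + ‖fderiv ℝ u 0‖ ^ 2))⁻¹ * bilinTrace (fderiv ℝ (fderiv ℝ u) 0)
        - (√(1 + ‖fderiv ℝ u 0‖ ^ 2))⁻¹ ^ 3 *
          fderiv ℝ (fderiv ℝ u) 0 (gradient u 0) (gradient u 0)) := by
  set A := fderiv ℝ (fderiv ℝ u) 0 with hA
  set b := gradient u 0 with hb
  set J : (EuclideanSpace ℝ (Fin m) →L[ℝ] ℝ) →L[ℝ] EuclideanSpace ℝ (Fin m) :=
    LinearMap.mkContinuous
      { toFun := (InnerProductSpace.toDual ℝ (EuclideanSpace ℝ (Fin m))).symm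
        map_add' := fun _ _ => map_add _ _ _
        map_smul' := fun c ℓ => by simp } 1 (fun ℓ => by simp) with hJ
  have hJi : ∀ (ℓ : EuclideanSpace ℝ (Fin m) →L[ℝ] ℝ) y, inner ℝ (J ℓ) y = ℓ y := fun ℓ y =>
    InnerProductSpace.toDual_symm_apply
  have hG : HasFDerivAt (gradient u) (J.comp A) 0 := J.hasFDerivAt.comp 0 hu.hasFDerivAt
  have hbn : ‖b‖ = ‖fderiv ℝ u 0‖ := LinearIsometryEquiv.norm_map _ _
  set w := √(1 + ‖b‖ ^ 2) with hw
  have hwpos : 0 < w := Real.sqrt_pos.2 (by positivity)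
  have hne : 1 + ‖gradient u 0‖ ^ 2 ≠ 0 := by positivity
  have hN : HasFDerivAt (fun x => (√(1 + ‖gradient u x‖ ^ 2))⁻¹) _ 0 :=
    (hasDerivAt_inv (by rw [← hb, ← hw]; exact hwpos.ne')).comp_hasFDerivAt 0
      ((hG.norm_sq.const_add 1).sqrt hne)
  have hF := (hN.smul hG).fderiv
  rw [graphMeanCurvature]
  change 1 / (m : ℝ) * LinearMap.trace ℝ _ (fderiv ℝ ((fun x => (√(1 + ‖gradient u x‖ ^ 2))⁻¹)
    • gradient u) 0).toLinearMap = _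
  rw [hF, LinearMap.trace_eq_sum_inner _ (EuclideanSpace.basisFun (Fin m) ℝ), ← hb, ← hw, ← hbn,
    ← hw]
  congr 1
  have hterm : ∀ i : Fin m, inner ℝ (EuclideanSpace.single i (1 : ℝ)) b = b i := fun i => by
    rw [EuclideanSpace.inner_single_left, map_one, one_mul]
  have hbb : A b b = ∑ i, b i * A (EuclideanSpace.single i 1) b := by
    conv_lhs => rw [show A b = A (∑ i, b i • EuclideanSpace.single i (1 : ℝ)) by
      rw [sum_smul_single]]
    simp [_root_.sum_apply]
  rw [hbb, bilinTrace, Finset.mul_sum, Finset.mul_sum, ← Finset.sum_sub_distrib]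
  refine Finset.sum_congr rfl fun i _ => ?_
  have e1 : inner ℝ (EuclideanSpace.single i (1 : ℝ)) (J (A (EuclideanSpace.single i 1)))
      = A (EuclideanSpace.single i 1) (EuclideanSpace.single i 1) := by
    rw [real_inner_comm, hJi]
  have e2 : inner ℝ b (J (A (EuclideanSpace.single i 1))) = A (EuclideanSpace.single i 1) b := by
    rw [real_inner_comm, hJi]
  simp only [EuclideanSpace.basisFun_apply, ContinuousLinearMap.coe_coe, add_apply, smul_apply,
    ContinuousLinearMap.smulRight_apply, ContinuousLinearMap.comp_apply, inner_add_right,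
    inner_smul_right, e1, hterm, innerSL_apply_apply, e2, smul_eq_mul, nsmul_eq_mul]
  push_cast
  field_simp
  ring

end MeanCurvature

section SphereIntegral

variable {m : ℕ}

/-- The ellipsoid `|x|² + ⟨b, x⟩² < 1` is the preimage of the unit ball under
`x ↦ x + c ⟨b, x⟩ b`, `c = (1 + √(1 + |b|²))⁻¹`, a linear map of determinant `√(1 + |b|²)`. -/
theorem integral_ellipsoid_bilin (hm : 0 < m)
    (A : EuclideanSpace ℝ (Fin m) →L[ℝ] EuclideanSpace ℝ (Fin m) →L[ℝ] ℝ)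
    (b : EuclideanSpace ℝ (Fin m)) :
    ∫ x : EuclideanSpace ℝ (Fin m), (if ‖x‖ ^ 2 + inner ℝ b x ^ 2 < 1 then A x x else 0)
      = 1 / (m : ℝ) * ((√(1 + ‖b‖ ^ 2))⁻¹ * bilinTrace A - (√(1 + ‖b‖ ^ 2))⁻¹ ^ 3 * A b b)
        * (sphereArea m / (m + 2)) := by
  set w := √(1 + ‖b‖ ^ 2) with hw
  have hwpos : 0 < w := Real.sqrt_pos.2 (by positivity)
  have hwsq : w ^ 2 = 1 + ‖b‖ ^ 2 := Real.sq_sqrt (by positivity)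
  set c := (1 + w)⁻¹ with hc
  have hc1 : c * (1 + w) = 1 := inv_mul_cancel₀ (by positivity)
  set d := c * w⁻¹ with hd
  have hwinv : w * w⁻¹ = 1 := mul_inv_cancel₀ hwpos.ne'
  have hbb : inner ℝ b b = ‖b‖ ^ 2 := real_inner_self_eq_norm_sq b
  have hcb : 1 + c * ‖b‖ ^ 2 = w := by
    have : ‖b‖ ^ 2 = (w - 1) * (1 + w) := by linarith
    rw [this]
    linear_combination (w - 1) * hc1
  set T : EuclideanSpace ℝ (Fin m) →ₗ[ℝ] EuclideanSpace ℝ (Fin m) :=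
    LinearMap.transvection (innerSL ℝ b).toLinearMap (c • b) with hT
  have hTx : ∀ x, T x = x + inner ℝ b x • c • b := fun x => by
    simp [hT, LinearMap.transvection.apply]
  have hdet : LinearMap.det T = w := by
    rw [hT, LinearMap.transvection.det]
    simp only [ContinuousLinearMap.coe_coe, innerSL_apply_apply, inner_smul_right, hbb]
    exact hcb
  set S : EuclideanSpace ℝ (Fin m) →L[ℝ] EuclideanSpace ℝ (Fin m) :=
    ContinuousLinearMap.id ℝ _ - (innerSL ℝ b).smulRight (d • b) with hS
  have hSx : ∀ x, S x = x - inner ℝ b x • d • b := fun x => by simp [hS]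
  have hST : ∀ x, S (T x) = x := by
    intro x
    rw [hSx, hTx, inner_add_right, inner_smul_right, inner_smul_right, hbb, add_sub_assoc,
      smul_smul, smul_smul, ← sub_smul]
    have : inner ℝ b x * c - (inner ℝ b x + inner ℝ b x * (c * ‖b‖ ^ 2)) * d = 0 := by
      have h1 : inner ℝ b x + inner ℝ b x * (c * ‖b‖ ^ 2) = inner ℝ b x * w := by
        rw [← hcb]; ring
      rw [h1, hd]
      linear_combination (-inner ℝ b x * c) * hwinv
    rw [this, zero_smul, add_zero]
  have hTn : ∀ x, ‖T x‖ ^ 2 = ‖x‖ ^ 2 + inner ℝ b x ^ 2 := by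
    intro x
    rw [hTx, norm_add_sq_real, inner_smul_right, inner_smul_right, norm_smul, norm_smul,
      real_inner_comm b x, mul_pow, mul_pow, Real.norm_eq_abs, Real.norm_eq_abs, sq_abs, sq_abs]
    have h1 : ‖b‖ ^ 2 = w ^ 2 - 1 := by linarith
    have h2 : 2 * c + c ^ 2 * ‖b‖ ^ 2 = 1 := by
      rw [h1]
      linear_combination (c * (w - 1) + 1) * hc1
    linear_combination (inner ℝ b x ^ 2) * h2
  set g : EuclideanSpace ℝ (Fin m) → ℝ := (ball 0 1).indicator fun y => A (S y) (S y) with hg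
  have hgm : Measurable g :=
    (Continuous.measurable (by fun_prop)).indicator measurableSet_ball
  have hTm : Measurable T := T.continuous_of_finiteDimensional.measurable
  have hcomp : ∀ x : EuclideanSpace ℝ (Fin m),
      (if ‖x‖ ^ 2 + inner ℝ b x ^ 2 < 1 then A x x else 0) = g (T x) := by
    intro x
    have hiff : T x ∈ ball (0 : EuclideanSpace ℝ (Fin m)) 1 ↔ ‖x‖ ^ 2 + inner ℝ b x ^ 2 < 1 := by
      rw [mem_ball_zero_iff, ← hTn, sq_lt_one_iff₀ (norm_nonneg _)]
    by_cases h : ‖x‖ ^ 2 + inner ℝ b x ^ 2 < 1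
    · rw [if_pos h, hg, indicator_of_mem (hiff.2 h), hST]
    · rw [if_neg h, hg, indicator_of_notMem fun h' => h (hiff.1 h')]
  have hdet0 : LinearMap.det T ≠ 0 := by rw [hdet]; exact hwpos.ne'
  have hmap := Measure.map_linearMap_addHaar_eq_smul_addHaar
    (volume : Measure (EuclideanSpace ℝ (Fin m))) hdet0
  have hval : ∫ x, g (T x) = w⁻¹ * ∫ y in ball 0 1, A (S y) (S y) := by
    rw [← integral_map hTm.aemeasurable hgm.aestronglyMeasurable, hmap, integral_smul_measure,
      hdet, abs_of_pos (inv_pos.2 hwpos), ENNReal.toReal_ofReal (inv_pos.2 hwpos).le, hg,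
      integral_indicator measurableSet_ball, smul_eq_mul]
  have htr : bilinTrace (A.bilinearComp S S) = bilinTrace A - w⁻¹ ^ 2 * A b b := by
    have hb : ∑ i, b i • EuclideanSpace.single i (1 : ℝ) = b := sum_smul_single b
    have h1 : ∑ i, b i * A b (EuclideanSpace.single i 1) = A b b := by
      conv_rhs => rw [show A b b = A b (∑ i, b i • EuclideanSpace.single i (1 : ℝ)) by rw [hb]]
      simp
    have h2 : ∑ i, b i * A (EuclideanSpace.single i 1) b = A b b := by
      conv_rhs => rw [show A b = A (∑ i, b i • EuclideanSpace.single i (1 : ℝ)) by rw [hb]]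
      simp [_root_.sum_apply]
    have h3 : ∑ i, b i * b i = ‖b‖ ^ 2 := by
      rw [EuclideanSpace.norm_sq_eq]
      refine Finset.sum_congr rfl fun i _ => ?_
      rw [Real.norm_eq_abs, sq_abs, sq]
    have h4 : ∀ i : Fin m, A.bilinearComp S S (EuclideanSpace.single i 1)
        (EuclideanSpace.single i 1)
        = A (EuclideanSpace.single i 1) (EuclideanSpace.single i 1)
          - d * (b i * A b (EuclideanSpace.single i 1))
          - d * (b i * A (EuclideanSpace.single i 1) b) + d ^ 2 * A b b * (b i * b i) := by
      intro i
      have h5 : inner ℝ b (EuclideanSpace.single i (1 : ℝ)) = b i := by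
        rw [real_inner_comm, EuclideanSpace.inner_single_left, map_one, one_mul]
      rw [ContinuousLinearMap.bilinearComp_apply, hSx, h5]
      simp only [map_sub, map_smul, sub_apply, smul_apply, smul_eq_mul]
      ring
    have h6 : -2 * d + d ^ 2 * ‖b‖ ^ 2 = -w⁻¹ ^ 2 := by
      have h7 : ‖b‖ ^ 2 = w ^ 2 - 1 := by linarith
      rw [h7, hd, hc]
      field_simp
      ring
    simp only [bilinTrace, h4, Finset.sum_add_distrib, Finset.sum_sub_distrib, ← Finset.mul_sum,
      h1, h2, h3]
    linear_combination (A b b) * h6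
  simp only [hcomp]
  rw [hval]
  have hfin := setIntegral_ball_bilin hm (A.bilinearComp S S)
  simp only [ContinuousLinearMap.bilinearComp_apply] at hfin
  rw [hfin, htr, setIntegral_ball_norm_sq hm]
  ring

/-- In polar coordinates the integral over the ellipsoid becomes an integral over the sphere. -/
theorem integral_sphere_bilin (hm : 0 < m)
    (A : EuclideanSpace ℝ (Fin m) →L[ℝ] EuclideanSpace ℝ (Fin m) →L[ℝ] ℝ)
    (b : EuclideanSpace ℝ (Fin m)) :
    ∫ θ : sphere (0 : EuclideanSpace ℝ (Fin m)) 1,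
      A (θ : EuclideanSpace ℝ (Fin m)) (θ : EuclideanSpace ℝ (Fin m))
        * (√(1 + inner ℝ b (θ : EuclideanSpace ℝ (Fin m)) ^ 2) ^ ((m : ℝ) + 2))⁻¹
        ∂(volume : Measure (EuclideanSpace ℝ (Fin m))).toSphere
      = sphereArea m * (1 / (m : ℝ) *
        ((√(1 + ‖b‖ ^ 2))⁻¹ * bilinTrace A - (√(1 + ‖b‖ ^ 2))⁻¹ ^ 3 * A b b)) := by
  have : Nonempty (Fin m) := ⟨⟨0, hm⟩⟩
  set f : EuclideanSpace ℝ (Fin m) → ℝ :=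
    fun x => if ‖x‖ ^ 2 + inner ℝ b x ^ 2 < 1 then A x x else 0 with hf
  set U : Set (EuclideanSpace ℝ (Fin m)) := {x | ‖x‖ ^ 2 + inner ℝ b x ^ 2 < 1} with hU
  have hUm : MeasurableSet U :=
    (isOpen_lt (by fun_prop) continuous_const).measurableSet
  have hfU : f = U.indicator fun x => A x x := by
    funext x
    simp only [hf, indicator, hU]
    rfl
  have hUsub : U ⊆ closedBall 0 1 := by
    intro x hx
    have hx' : ‖x‖ ^ 2 + inner ℝ b x ^ 2 < 1 := hx
    rw [mem_closedBall_zero_iff]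
    nlinarith [sq_nonneg (inner ℝ b x : ℝ), norm_nonneg x]
  have hint : Integrable f := by
    rw [hfU, integrable_indicator_iff hUm]
    have h : ContinuousOn (fun x : EuclideanSpace ℝ (Fin m) => A x x) (closedBall 0 1) :=
      Continuous.continuousOn (by fun_prop)
    exact (h.integrableOn_compact (isCompact_closedBall _ _)).mono_set hUsub
  have h1 := integral_polar hint
  have h2 : ∀ θ : sphere (0 : EuclideanSpace ℝ (Fin m)) 1,
      ∫ r in Ioi (0 : ℝ), r ^ (m - 1) * f (r • (θ : EuclideanSpace ℝ (Fin m)))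
        = A (θ : EuclideanSpace ℝ (Fin m)) (θ : EuclideanSpace ℝ (Fin m))
        * (√(1 + inner ℝ b (θ : EuclideanSpace ℝ (Fin m)) ^ 2) ^ ((m : ℝ) + 2))⁻¹ / (m + 2) := by
    intro θ
    have hn : ‖(θ : EuclideanSpace ℝ (Fin m))‖ = 1 := by simp
    rw [← integral_radial_ellipsoid hm _
      (show 0 < 1 + inner ℝ b (θ : EuclideanSpace ℝ (Fin m)) ^ 2 by positivity)]
    refine setIntegral_congr_fun measurableSet_Ioi fun r hr => ?_
    have e1 : ‖r • (θ : EuclideanSpace ℝ (Fin m))‖ ^ 2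
        + inner ℝ b (r • (θ : EuclideanSpace ℝ (Fin m))) ^ 2
        = r ^ 2 * (1 + inner ℝ b (θ : EuclideanSpace ℝ (Fin m)) ^ 2) := by
      rw [norm_smul, hn, inner_smul_right, mul_one, Real.norm_eq_abs, sq_abs]; ring
    have e2 : A (r • (θ : EuclideanSpace ℝ (Fin m))) (r • (θ : EuclideanSpace ℝ (Fin m)))
        = r ^ 2 * A (θ : EuclideanSpace ℝ (Fin m)) (θ : EuclideanSpace ℝ (Fin m)) := by
      simp only [map_smul, smul_apply, smul_eq_mul]; ring
    simp only [hf, e1, e2]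
  simp only [h2] at h1
  rw [integral_div, hf, integral_ellipsoid_bilin hm A b] at h1
  have hm2 : (m : ℝ) + 2 ≠ 0 := by positivity
  field_simp at h1 ⊢
  linarith

end SphereIntegral

/-! ### The limit `s ↑ 1` in the `C²` sense -/

section ClassicalLimit

variable {m : ℕ}

theorem c2NormOn_lt_top {R : ℝ} (hR : 0 < R) {u : EuclideanSpace ℝ (Fin m) → ℝ}
    (hu : ContDiffOn ℝ 2 u (closedBall 0 R)) : c2NormOn (closedBall 0 R) u < ∞ := by
  have hS : UniqueDiffOn ℝ (closedBall (0 : EuclideanSpace ℝ (Fin m)) R) :=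
    uniqueDiffOn_convex (convex_closedBall _ _)
      ⟨0, interior_mono ball_subset_closedBall (by rw [isOpen_ball.interior_eq]; simpa using hR)⟩
  have key : ∀ {F : Type} [NormedAddCommGroup F] (v : EuclideanSpace ℝ (Fin m) → F),
      ContinuousOn v (closedBall 0 R) → supNormOn (closedBall 0 R) v < ∞ := by
    intro F _ v hv
    obtain ⟨C, hC⟩ := (isCompact_closedBall (0 : EuclideanSpace ℝ (Fin m)) R).exists_bound_of_continuousOn hv
    refine lt_of_le_of_lt (iSup₂_le fun x hx => ?_) (ENNReal.ofReal_lt_top (r := C))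
    rw [← ofReal_norm]
    exact ENNReal.ofReal_le_ofReal (hC x hx)
  have h1 : ContDiffOn ℝ 1 (fderivWithin ℝ u (closedBall 0 R)) (closedBall 0 R) :=
    hu.fderivWithin hS (by norm_num)
  refine ENNReal.add_lt_top.2 ⟨key _ hu.continuousOn, ENNReal.add_lt_top.2
    ⟨key _ h1.continuousOn, key _ (h1.continuousOn_fderivWithin hS le_rfl)⟩⟩

theorem c2NormOn_sub_self (S : Set (EuclideanSpace ℝ (Fin m))) (u : EuclideanSpace ℝ (Fin m) → ℝ) :
    c2NormOn S (u - u) = 0 := by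
  have h0 : ∀ {F : Type} [NormedAddCommGroup F] [NormedSpace ℝ F],
      fderivWithin ℝ (0 : EuclideanSpace ℝ (Fin m) → F) S = 0 := by
    intro F _ _
    exact fderivWithin_zero
  rw [sub_self, c2NormOn, h0, h0]
  simp [supNormOn]

theorem sphereArea_zero : sphereArea 0 = 0 := by simp [sphereArea_eq]

theorem sphereArea_pos (hm : 0 < m) : 0 < sphereArea m := by
  rw [sphereArea_eq]
  have h1 : (0 : ℝ) < m := by exact_mod_cast hm
  have h2 : 0 < (volume : Measure (EuclideanSpace ℝ (Fin m))).real (ball 0 1) :=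
    ENNReal.toReal_pos (measure_ball_pos volume _ one_pos).ne' measure_ball_lt_top.ne
  positivity

/-- Convergence in `C²` gives convergence of the first and second derivatives along points tending
to the origin. -/
theorem tendsto_fderiv_of_c2 {R : ℝ} (hR : 0 < R) {u : EuclideanSpace ℝ (Fin m) → ℝ}
    {uk : ℕ → EuclideanSpace ℝ (Fin m) → ℝ} (hu : ContDiffOn ℝ 2 u (closedBall 0 R))
    (huk : ∀ k, ContDiffOn ℝ 2 (uk k) (closedBall 0 R))
    (hN : Tendsto (fun k => c2NormOn (closedBall 0 R) (uk k - u)) atTop (𝓝 0)) :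
    Tendsto (fun y : ℕ × EuclideanSpace ℝ (Fin m) => fderiv ℝ (uk y.1) y.2) (atTop ×ˢ 𝓝 0)
        (𝓝 (fderiv ℝ u 0)) ∧
      Tendsto (fun y : ℕ × EuclideanSpace ℝ (Fin m) => fderiv ℝ (fderiv ℝ (uk y.1)) y.2)
        (atTop ×ˢ 𝓝 0) (𝓝 (fderiv ℝ (fderiv ℝ u) 0)) := by
  have hsmall : ∀ ε > 0, ∀ᶠ k in atTop,
      c2NormOn (closedBall 0 R) (uk k - u) ≤ ENNReal.ofReal ε := fun ε hε =>
    hN.eventually (Iic_mem_nhds (ENNReal.ofReal_pos.2 hε))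
  have h0 : (0 : EuclideanSpace ℝ (Fin m)) ∈ ball (0 : EuclideanSpace ℝ (Fin m)) R :=
    mem_ball_self hR
  have hfd : ∀ k, ∀ x ∈ ball (0 : EuclideanSpace ℝ (Fin m)) R,
      fderiv ℝ (uk k - u) x = fderiv ℝ (uk k) x - fderiv ℝ u x := fun k x hx =>
    fderiv_sub ((huk k).differentiableAt_ball one_le_two hx)
      (hu.differentiableAt_ball one_le_two hx)
  constructor
  · refine tendsto_prod_of_uniform (fk := fun k => fderiv ℝ (uk k)) hR
      (hu.differentiableAt_fderiv_ball h0).continuousAt fun ε hε => ?_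
    filter_upwards [hsmall ε hε] with k hk x hx
    rw [← hfd k x hx]
    exact (hasGradBounds_of_c2NormOn_le hε.le ((huk k).sub hu) hk).bound x hx
  · have hcont : ContinuousAt (fderiv ℝ (fderiv ℝ u)) 0 := by
      have h1 : ContDiffAt ℝ 2 u 0 := hu.contDiffAt
        (Filter.mem_of_superset (isOpen_ball.mem_nhds h0) ball_subset_closedBall)
      have h2 : ContDiffAt ℝ 1 (fderiv ℝ u) 0 := h1.fderiv_right (by norm_num)
      exact (h2.fderiv_right (m := 0) (by norm_num)).continuousAt
    refine tendsto_prod_of_uniform (fk := fun k => fderiv ℝ (fderiv ℝ (uk k))) hR hcont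
      fun ε hε => ?_
    filter_upwards [hsmall ε hε] with k hk x hx
    have he : fderiv ℝ (uk k - u) =ᶠ[𝓝 x] fderiv ℝ (uk k) - fderiv ℝ u :=
      Filter.eventuallyEq_of_mem (isOpen_ball.mem_nhds hx) fun y hy => hfd k y hy
    have h1 := norm_fderiv_fderiv_le_of_c2NormOn_le hε.le hk hx
    rwa [he.fderiv_eq, fderiv_sub ((huk k).differentiableAt_fderiv_ball hx)
      (hu.differentiableAt_fderiv_ball hx)] at h1

/-- The band integrals, multiplied by `1 - s`, converge to the mean curvature. -/
theorem tendsto_bandIntegral_meanCurvature {R δ M : ℝ} (hR : 0 < R) (hδ : 0 < δ) (hM : 0 ≤ M)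
    {u : EuclideanSpace ℝ (Fin m) → ℝ}
    {uk : ℕ → EuclideanSpace ℝ (Fin m) → ℝ} (hu : ContDiffOn ℝ 2 u (closedBall 0 R))
    (huk : ∀ k, ContDiffOn ℝ 2 (uk k) (closedBall 0 R))
    (hN : Tendsto (fun k => c2NormOn (closedBall 0 R) (uk k - u)) atTop (𝓝 0))
    {xk : ℕ → EuclideanSpace ℝ (Fin m)} (hxk : Tendsto xk atTop (𝓝 0)) {sk : ℕ → ℝ}
    (hsk : ∀ k, sk k ∈ Ioo (0 : ℝ) 1) (hlim : Tendsto sk atTop (𝓝 1))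
    (hint : ∀ᶠ k in atTop,
      IntegrableOn (bandIntegral (((m + 1 : ℕ) : ℝ) + sk k) (centredAt (uk k) (xk k))) (ball 0 δ))
    (hbd : ∀ᶠ k in atTop, ∀ x ∈ ball 0 δ,
      |centredAt (uk k) (xk k) x + centredAt (uk k) (xk k) (-x)| ≤ M * ‖x‖ ^ (1 + (1 : ℝ))) :
    Tendsto (fun k => (1 - sk k) * ∫ x in ball 0 δ,
        bandIntegral (((m + 1 : ℕ) : ℝ) + sk k) (centredAt (uk k) (xk k)) x) atTop
      (𝓝 (sphereArea m * graphMeanCurvature u)) := by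
  rcases Nat.eq_zero_or_pos m with rfl | hm
  -- In `ℝ^0` the only point is the origin, where the band is empty; the sphere is empty as well.
  · have h0 : ∀ k, ∀ x : EuclideanSpace ℝ (Fin 0),
        bandIntegral (((0 + 1 : ℕ) : ℝ) + sk k) (centredAt (uk k) (xk k)) x = 0 := by
      intro k x
      rw [Subsingleton.elim x 0]
      exact bandIntegral_zero _ (by simp [centredAt])
    simp only [h0, integral_zero, mul_zero, sphereArea_zero, zero_mul]
    exact tendsto_const_nhds
  obtain ⟨hB, hA⟩ := tendsto_fderiv_of_c2 hR hu huk hN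
  have h := tendsto_integral_asymptotically_homogeneous hm hsk hlim hδ hint (M := M)
    (Ψ := fun θ => fderiv ℝ (fderiv ℝ u) 0 θ θ
      * (√(1 + fderiv ℝ u 0 θ ^ 2) ^ ((m : ℝ) + 2))⁻¹)
    (by
      filter_upwards [hbd] with k hk x hx
      have hs := (hsk k).1
      have h1 := abs_bandIntegral_le (p := ((m + 1 : ℕ) : ℝ) + sk k) (by positivity)
        (by norm_num) hM hk hx
      rwa [show 1 + (1 : ℝ) - (((m + 1 : ℕ) : ℝ) + sk k) = 1 - m - sk k by push_cast; ring] at h1)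
    (fun θ hθ => tendsto_bandIntegral_radial hR (Eventually.of_forall fun k x hx =>
      ⟨(huk k).differentiableAt_ball one_le_two hx, (huk k).differentiableAt_fderiv_ball hx⟩)
      hB hA hxk hlim hθ)
  have h1 := integral_sphere_bilin hm (fderiv ℝ (fderiv ℝ u) 0) (gradient u 0)
  have hbi : ∀ x, inner ℝ (gradient u 0) x = fderiv ℝ u 0 x := fun x =>
    InnerProductSpace.toDual_symm_apply
  have hbn : ‖gradient u 0‖ = ‖fderiv ℝ u 0‖ := LinearIsometryEquiv.norm_map _ _
  simp only [hbi, hbn] at h1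
  rw [h1, ← graphMeanCurvature_eq (hu.differentiableAt_fderiv_ball (mem_ball_self hR))] at h
  exact h

/-- The limit of the fractional curvatures in a fixed representation by graphs. -/
theorem tendsto_fracCurvature_graphMeanCurvature
    {E : ℕ → Set (EuclideanSpace ℝ (Fin (m + 1)))}
    {q : EuclideanSpace ℝ (Fin (m + 1))} {qk : ℕ → EuclideanSpace ℝ (Fin (m + 1))} {sk : ℕ → ℝ}
    (hE : ∀ k, NullMeasurableSet (E k) volume) (hqk : ∀ k, qk k ∈ frontier (E k))
    (hq : Tendsto qk atTop (𝓝 q)) (hsk : ∀ k, sk k ∈ Ioo (0 : ℝ) 1)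
    (hlim : Tendsto sk atTop (𝓝 1))
    {L : EuclideanSpace ℝ (Fin (m + 1)) ≃ₗᵢ[ℝ] EuclideanSpace ℝ (Fin (m + 1))} {r h : ℝ}
    {u : EuclideanSpace ℝ (Fin m) → ℝ} {uk : ℕ → EuclideanSpace ℝ (Fin m) → ℝ}
    (hr : 0 < r) (hh : 0 < h) (hu : ContDiffOn ℝ 2 u (closedBall 0 (2 * r)))
    (huk : ∀ k, ContDiffOn ℝ 2 (uk k) (closedBall 0 (2 * r)))
    (hEuk : ∀ k, IsSupergraphIn (E k) q L (2 * r) (2 * h) (uk k))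
    (hN : Tendsto (fun k => c2NormOn (closedBall 0 (2 * r)) (uk k - u)) atTop (𝓝 0)) :
    (∀ᶠ k in atTop, FracCurvatureExists (sk k) (E k) (qk k)) ∧
      Tendsto (fun k => (1 - sk k) * fracCurvature (sk k) (E k) (qk k)) atTop
        (𝓝 (sphereArea m * graphMeanCurvature u)) := by
  have h2r : 0 < 2 * r := by positivity
  obtain ⟨-, Λ, hΛ, -, hguk⟩ := exists_uniform_gradBounds (α := 1) (R := 2 * r)
    (N := c2NormOn (closedBall 0 (2 * r)))
    (fun w C hC hw hle => hasGradBounds_of_c2NormOn_le hC (by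
      rcases hw with rfl | ⟨k, rfl⟩
      · exact hu
      · exact (huk k).sub hu) hle)
    (fun w C hC hle x hx => abs_le_of_c2NormOn_le hC hle hx) (c2NormOn_lt_top h2r hu) hN
  set δ := min r (h / Λ) with hδdef
  have hδ : 0 < δ := lt_min hr (div_pos hh hΛ)
  have hδr : δ ≤ r := min_le_left _ _
  have hδh : Λ * δ ≤ h := by
    have : δ ≤ h / Λ := min_le_right _ _
    rwa [le_div_iff₀ hΛ, mul_comm] at this
  have hz := tendsto_localCoordinate L hq
  have hx : Tendsto (fun k => horiz (L.symm (qk k - q))) atTop (𝓝 0) := by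
    have := (continuous_horiz.tendsto _).comp hz
    rwa [horiz_zero] at this
  have ht : Tendsto (fun k => vert (L.symm (qk k - q))) atTop (𝓝 0) := by
    have := (continuous_vert.tendsto _).comp hz
    rwa [vert_zero] at this
  have hxr : ∀ᶠ k in atTop, ‖horiz (L.symm (qk k - q))‖ < r := by
    have := hx.norm
    rw [norm_zero] at this
    exact this.eventually (Iio_mem_nhds hr)
  have hth : ∀ᶠ k in atTop, |vert (L.symm (qk k - q))| < h := by
    have := ht.abs
    rw [abs_zero] at this
    exact this.eventually (Iio_mem_nhds hh)
  have hEk0 := (hguk.and (hxr.and hth)).mono fun k hk =>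
    (hEuk k).tendsto_truncFracCurvature (hE k) hk.1 zero_le_one le_rfl hΛ hΛ.le hδ hδr hδh (hqk k)
      hk.2.1 hk.2.2 (hsk k)
  refine ⟨hEk0.mono fun k hk => ⟨_, hk⟩, ?_⟩
  have hnear := tendsto_bandIntegral_meanCurvature h2r hδ (M := 2 * Λ) (by positivity) hu huk hN hx
    hsk hlim
    (by
      filter_upwards [hguk, hxr, hth] with k hk1 hk2 hk3
      have := (hsk k).1
      exact integrableOn_bandIntegral (nullMeasurableSet_rigidMotion (hE k) (qk k) L)
        ((hEuk k).isCentredGraph hk1 hΛ hδr hδh (hqk k) hk2 hk3) (by norm_num) (by positivity)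
        (abs_centredAt_add_neg_le hk1 zero_le_one le_rfl hΛ.le hδr hk2) (hsk k).2
        (by positivity))
    (by
      filter_upwards [hguk, hxr] with k hk1 hk2
      exact abs_centredAt_add_neg_le hk1 zero_le_one le_rfl hΛ.le hδr hk2)
  -- the far field is bounded, hence negligible after multiplication by `1 - s`
  obtain ⟨C, hC⟩ := exists_farField_bound (n := m + 1) (p₀ := ((m + 1 : ℕ) : ℝ) + 1 / 2)
    (p₁ := ((m + 1 : ℕ) : ℝ) + 1) (lt_min hδ hh) (by linarith)
    (ball_subset_graphCylinder (min_le_left _ _) (min_le_right _ _))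
    (isOpen_graphCylinder δ h).measurableSet
  have hs0 : Tendsto (fun k => 1 - sk k) atTop (𝓝 0) := by
    simpa using hlim.const_sub 1
  have hfar : Tendsto (fun k => (1 - sk k) * ∫ z in (graphCylinder m δ h)ᶜ,
      sideSign {z | qk k + L z ∈ E k} z * (‖z‖ ^ (((m + 1 : ℕ) : ℝ) + sk k))⁻¹) atTop (𝓝 0) := by
    have hb : Tendsto (fun k => (1 - sk k) * C) atTop (𝓝 0) := by simpa using hs0.mul_const C
    refine squeeze_zero_norm' ?_ hb
    filter_upwards [hlim.eventually (Ioi_mem_nhds (show (1 / 2 : ℝ) < 1 by norm_num))] with k hk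
    have hk' : 1 / 2 < sk k := hk
    have h1s : 0 ≤ 1 - sk k := by linarith [(hsk k).2]
    rw [norm_mul, Real.norm_of_nonneg h1s]
    exact mul_le_mul_of_nonneg_left
      (hC _ _ ⟨by linarith, by linarith [(hsk k).2]⟩) h1s
  have hsum := hnear.add hfar
  rw [add_zero] at hsum
  refine hsum.congr' ?_
  filter_upwards [hEk0] with k hk
  rw [fracCurvature_eq_of_tendsto hk]
  ring

/-- The mean curvature is determined by the set: in every representation it is the limit of
`(1 - s) I_s` divided by the area of the unit sphere. -/
theorem IsMeanCurvatureAt.unique {E : Set (EuclideanSpace ℝ (Fin (m + 1)))}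
    {q : EuclideanSpace ℝ (Fin (m + 1))} (hE : NullMeasurableSet E volume) (hq : q ∈ frontier E)
    {H H' : ℝ} (h1 : IsMeanCurvatureAt E q H) (h2 : IsMeanCurvatureAt E q H') : H = H' := by
  rcases Nat.eq_zero_or_pos m with rfl | hm
  -- For `m = 0` the factor `1 / m` is `0`, so the mean curvature is `0` by convention.
  · obtain ⟨-, -, -, u, -, -, -, -, -, rfl⟩ := h1
    obtain ⟨-, -, -, v, -, -, -, -, -, rfl⟩ := h2
    simp [graphMeanCurvature]
  set sk : ℕ → ℝ := fun k => 1 - 1 / ((k : ℝ) + 2) with hskdef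
  have hsk : ∀ k, sk k ∈ Ioo (0 : ℝ) 1 := by
    intro k
    have h2 : (2 : ℝ) ≤ (k : ℝ) + 2 := by linarith [Nat.cast_nonneg (α := ℝ) k]
    have h3 : 1 / ((k : ℝ) + 2) ≤ 1 / 2 := one_div_le_one_div_of_le two_pos h2
    have h4 : 0 < 1 / ((k : ℝ) + 2) := by positivity
    exact ⟨by simp only [hskdef]; linarith, by simp only [hskdef]; linarith⟩
  have hlim : Tendsto sk atTop (𝓝 1) := by
    have h3 : Tendsto (fun k : ℕ => 1 / ((k : ℝ) + 2)) atTop (𝓝 0) :=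
      tendsto_const_nhds.div_atTop
        (tendsto_atTop_add_const_right _ _ tendsto_natCast_atTop_atTop)
    have h4 := h3.const_sub 1
    rwa [sub_zero] at h4
  have key : ∀ H : ℝ, IsMeanCurvatureAt E q H →
      Tendsto (fun k => (1 - sk k) * fracCurvature (sk k) E q) atTop (𝓝 (sphereArea m * H)) := by
    rintro H ⟨L, r, h, u, hr, hh, -, hu, hEu, rfl⟩
    refine (tendsto_fracCurvature_graphMeanCurvature (E := fun _ => E) (qk := fun _ => q)
      (r := r / 2) (h := h / 2) (uk := fun _ => u) (L := L) (fun _ => hE) (fun _ => hq)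
      tendsto_const_nhds hsk hlim (half_pos hr) (half_pos hh)
      ?_ ?_ ?_ ?_).2
    · rwa [mul_div_cancel₀ _ two_ne_zero]
    · intro _
      rwa [mul_div_cancel₀ _ two_ne_zero]
    · intro _
      rwa [mul_div_cancel₀ _ two_ne_zero, mul_div_cancel₀ _ two_ne_zero]
    · simp only [c2NormOn_sub_self]
      exact tendsto_const_nhds
  exact mul_left_cancel₀ (sphereArea_pos hm).ne' (tendsto_nhds_unique (key H h1) (key H' h2))

end ClassicalLimit

end

/-- Here `n = m + 1` is the dimension of the space. -/
theorem theorem5p2 (m : ℕ) :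
    (∀ (α : ℝ), 0 < α → α ≤ 1 →
      ∀ (E : Set (EuclideanSpace ℝ (Fin (m + 1))))
        (Ek : ℕ → Set (EuclideanSpace ℝ (Fin (m + 1))))
        (q : EuclideanSpace ℝ (Fin (m + 1))) (qk : ℕ → EuclideanSpace ℝ (Fin (m + 1)))
        (s : ℝ) (sk : ℕ → ℝ),
      NullMeasurableSet E volume → (∀ k, NullMeasurableSet (Ek k) volume) →
      q ∈ frontier E → ConvergesC1Holder α Ek E q →
      (∀ k, qk k ∈ frontier (Ek k)) → Tendsto qk atTop (𝓝 q) →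
      s ∈ Ioo 0 α → (∀ k, sk k ∈ Ioo 0 α) → Tendsto sk atTop (𝓝 s) →
      FracCurvatureExists s E q ∧
      (∀ᶠ k in atTop, FracCurvatureExists (sk k) (Ek k) (qk k)) ∧
      Tendsto (fun k => fracCurvature (sk k) (Ek k) (qk k)) atTop (𝓝 (fracCurvature s E q))) ∧
    (∀ (E : Set (EuclideanSpace ℝ (Fin (m + 1))))
        (Ek : ℕ → Set (EuclideanSpace ℝ (Fin (m + 1))))
        (q : EuclideanSpace ℝ (Fin (m + 1))) (qk : ℕ → EuclideanSpace ℝ (Fin (m + 1)))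
        (sk : ℕ → ℝ),
      NullMeasurableSet E volume → (∀ k, NullMeasurableSet (Ek k) volume) →
      q ∈ frontier E → ConvergesC2 Ek E q →
      (∀ k, qk k ∈ frontier (Ek k)) → Tendsto qk atTop (𝓝 q) →
      (∀ k, sk k ∈ Ioo 0 1) → Tendsto sk atTop (𝓝 1) →
      (∃! H : ℝ, IsMeanCurvatureAt E q H) ∧
      (∀ᶠ k in atTop, FracCurvatureExists (sk k) (Ek k) (qk k)) ∧
      Tendsto (fun k => (1 - sk k) * fracCurvature (sk k) (Ek k) (qk k)) atTop
        (𝓝 (sphereArea m * meanCurvature E q))) := by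
  refine ⟨fun α hα hα1 E Ek q qk s sk hE hEk hqE hconv hqk hq hs hsk hlim =>
    fracCurvature_tendsto_of_convergesC1Holder hα hα1 hE hEk hqE hconv hqk hq hs hsk hlim, ?_⟩
  intro E Ek q qk sk hE hEk hqE hconv hqk hq hsk hlim
  obtain ⟨-, L, r, h, u, uk, hr, hh, hu0, hu, hEu, huk, hEuk, hN⟩ := hconv
  have hH : IsMeanCurvatureAt E q (graphMeanCurvature u) :=
    ⟨L, 2 * r, 2 * h, u, by positivity, by positivity, hu0, hu, hEu, rfl⟩
  have huniq : ∃! H : ℝ, IsMeanCurvatureAt E q H :=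
    ⟨_, hH, fun H' hH' => hH'.unique hE hqE hH⟩
  have hmean : meanCurvature E q = graphMeanCurvature u :=
    (Classical.epsilon_spec (p := IsMeanCurvatureAt E q) ⟨_, hH⟩).unique hE hqE hH
  rw [hmean]
  exact ⟨huniq, tendsto_fracCurvature_graphMeanCurvature hEk hqk hq hsk hlim hr hh hu huk hEuk hN⟩
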